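/- **Setting.** Let $d\ge 1$ and $p\ge 1$. Let $\Omega\subset\mathbb R^d$ be an open set whose closure is triangulated by simplicial meshes $\mathcal T_0,\dots,\mathcal T_L$ that are finite, conforming (each facet of a cell is a facet of another cell or is contained in $\partial\Omega$), nested (each cell of $\mathcal T_{\ell-1}$ is a union of cells of $\mathcal T_\ell$), shape regular, quasi-uniform with characteristic lengths $h_\ell>0$, and satisfy $h_\ell\ge c_{\rm ref}h_{\ell-1}$ with $c_{\rm ref}>0$. Let $\tau_\ell>0$ be arbitrary penalty parameters. Let $M_\ell$ be the space of functions on the skeleton that are, on each facet separately, a polynomial of degree at most $p$ and vanish on every facet contained in $\partial\Omega$, with the inner product $$\langle\lambda,\mu\rangle_\ell=\sum_{T\in\mathcal T_\ell}\frac{|T|}{|\partial T|}\int_{\partial T}\lambda\mu\,d\sigma,\qquad \|\lambda\|_\ell^2=\langle\lambda,\lambda\rangle_\ell .$$ For $\lambda\in M_\ell$ let $(\mathcal U_\ell\lambda,\mathcal Q_\ell\lambda)|_T=(u,q)\in \mathcal P_p\times\mathcal P_p^d$ be, on each cell $T$ with outward unit normal $\nu$, the solution of the local problem $$\int_T q\cdot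 r-\int_T u\,\nabla\!\cdot r=-\int_{\partial T}\lambda\, r\cdot\nu,\qquad -\int_T q\cdot\nabla v+\int_{\partial T}(q\cdot\nu+\tau_\ell u)v=\tau_\ell\int_{\partial T}\lambda v$$ for all $r\in\mathcal P_p^d$, $v\in\mathcal P_p$. Put $$a_\ell(\lambda,\mu)=\int_\Omega\mathcal Q_\ell\lambda\cdot\mathcal Q_\ell\mu\,dx+\sum_{T\in\mathcal T_\ell}\int_{\partial T}\tau_\ell(\mathcal U_\ell\lambda-\lambda)(\mathcal U_\ell\mu-\mu)\,d\sigma ,$$ define $A_\ell:M_\ell\to M_\ell$ by $\langle A_\ell\lambda,\mu\rangle_\ell=a_\ell(\lambda,\mu)$, and let $\lambda_{\max}(A_\ell)$ be its largest eigenvalue. For a linear $R_\ell:M_\ell\to M_\ell$ with $\langle\cdot,\cdot\rangle_\ell$-adjoint $R_\ell^\dagger$ put $$K_\ell=\bigl(1-(1-R_\ell A_\ell)(1-R_\ell^\dagger A_\ell)\bigr)A_\ell^{-1}.$$ Fix a basis $(b_j)_{j=1}^{N}$ of the polynomials of degree at most $p$ on the reference $(d-1)$-simplex (for example a Lagrange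 basis). For every facet $F\not\subset\partial\Omega$ of $\mathcal T_\ell$, transport it to $F$ by the affine map given by an arbitrary numbering of the vertices of $F$ and extend it by zero to the other facets. This gives a family $(\varphi_i)$ in $M_\ell$, the degrees of freedom. Let $S_i g=\frac{\langle g,\varphi_i\rangle_\ell}{a_\ell(\varphi_i,\varphi_i)}\varphi_i$. The damped Jacobi smoother is $R_\ell=\gamma\sum_i S_i$. The Gauss–Seidel smoother, for an arbitrary ordering $i_1,\dots,i_n$ of all degrees of freedom, is $R_\ell g=x_n$, where $x_0=0$ and $x_k=x_{k-1}+S_{i_k}(g-A_\ell x_{k-1})$. **Claim.** 1. The local problems are uniquely solvable, $A_\ell$ and all $\langle\cdot,\cdot\rangle_\ell$-adjoints exist and are unique, $A_\ell$ is invertible, and if $M_\ell\neq 0$ then $A_\ell$ has a largest eigenvalue, which is positive. The limited interaction property holds: if $a_\ell(\varphi_i,\varphi_j)\ne0$, then the facets of $i$ and $j$ belong to a common cell, and for each $i$ there are at most $n_0:=(2d+1)N$ indices $j$ with $a_\ell(\varphi_i,\varphi_j)\neq 0$. 2. For every $\gamma$ with $0<\gamma<2/n_0$ there is a constant $C_3>0$,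 depending only on $d$, $p$, the reference basis and $\gamma$, such that for the damped Jacobi smoother, for all such mesh hierarchies, all $\tau_\ell>0$, all vertex numberings and all levels $\ell$, $$\frac{\|\lambda\|_\ell^2}{\lambda_{\max}(A_\ell)}\le C_3\,\langle K_\ell\lambda,\lambda\rangle_\ell\qquad\text{for all }\lambda\in M_\ell$$ (if $M_\ell=0$, the left-hand side is read as $0$). 3. There is a constant $C_3>0$, depending only on $d$, $p$ and the reference basis, such that the same inequality holds for the Gauss–Seidel smoother, for all such mesh hierarchies, all $\tau_\ell>0$, all vertex numberings, all orderings of the degrees of freedom and all levels $\ell$. -/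

import Mathlib

open MeasureTheory

noncomputable section

namespace HDG

/-- Euclidean space `ℝ^d`. -/
abbrev E (d : ℕ) : Type := EuclideanSpace ℝ (Fin d)

/-- The closed simplex spanned by a finite set of vertices. -/
abbrev hull {d : ℕ} (S : Finset (E d)) : Set (E d) := convexHull ℝ (S : Set (E d))

/-! ### Meshes -/

/-- A conforming simplicial mesh of `Ω ⊆ ℝ^d`: a finite, purely `d`-dimensional simplicial complex
(cells, facets, ... are represented by their vertex sets) that covers the closure of `Ω`. -/
structure Mesh {d : ℕ} (Ω : Set (E d)) where
  /-- the underlying simplicial complex -/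
  K : Geometry.SimplicialComplex ℝ (E d)
  finite : K.faces.Finite
  pure : ∀ s ∈ K.faces, ∃ T ∈ K.faces, s ⊆ T ∧ T.card = d + 1
  space_eq : K.space = closure Ω
  /-- each facet of a cell is either a facet of another cell or on the boundary -/
  regular : ∀ T ∈ K.faces, T.card = d + 1 → ∀ F ⊆ T, F.card = d →
    (∃ T' ∈ K.faces, T'.card = d + 1 ∧ T' ≠ T ∧ F ⊆ T') ∨ hull F ⊆ frontier Ω

variable {d : ℕ} {Ω : Set (E d)}

/-- The cells (`d`-dimensional simplices) of the mesh. -/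
abbrev Mesh.Cell (𝒯 : Mesh Ω) : Type := {T : Finset (E d) // T ∈ 𝒯.K.faces ∧ T.card = d + 1}

/-- The facets (`(d-1)`-dimensional simplices) of the mesh. -/
abbrev Mesh.Facet (𝒯 : Mesh Ω) : Type := {F : Finset (E d) // F ∈ 𝒯.K.faces ∧ F.card = d}

instance (𝒯 : Mesh Ω) : Fintype 𝒯.Cell :=
  (𝒯.finite.subset fun _ h => h.1 : {T | T ∈ 𝒯.K.faces ∧ T.card = d + 1}.Finite).fintype

instance (𝒯 : Mesh Ω) : Fintype 𝒯.Facet :=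
  (𝒯.finite.subset fun _ h => h.1 : {F | F ∈ 𝒯.K.faces ∧ F.card = d}.Finite).fintype

/-- The Dirichlet facets, i.e. those contained in `∂Ω`. -/
def Mesh.IsDirichlet (𝒯 : Mesh Ω) (F : 𝒯.Facet) : Prop := hull F.1 ⊆ frontier Ω

/-- The facets that are not Dirichlet facets. -/
abbrev Mesh.FreeFacet (𝒯 : Mesh Ω) : Type := {F : 𝒯.Facet // ¬ 𝒯.IsDirichlet F}

instance (𝒯 : Mesh Ω) : Fintype 𝒯.FreeFacet := Fintype.ofFinite _

open Classical in
/-- The facets contained in the boundary of a cell. -/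
def Mesh.facetsOf (𝒯 : Mesh Ω) (T : 𝒯.Cell) : Finset 𝒯.Facet :=
  Finset.univ.filter fun F => F.1 ⊆ T.1

/-- A hierarchy `𝒯_0, …, 𝒯_L` of successively refined simplicial meshes of the open set `Ω`, with
characteristic lengths `h ℓ`, that is quasi-uniform and shape regular with constant `κ`, and whose
refinement is not too fast (constant `cref`). -/
structure MeshHierarchy {d : ℕ} (Ω : Set (E d)) (L : ℕ) (κ cref : ℝ) where
  isOpen : IsOpen Ω
  mesh : Fin (L + 1) → Mesh Ω
  h : Fin (L + 1) → ℝ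
  h_pos : ∀ ℓ, 0 < h ℓ
  κ_pos : 0 < κ
  cref_pos : 0 < cref
  /-- each cell is the union of cells of the next mesh -/
  nested : ∀ (ℓ : Fin L) (T : (mesh ℓ.castSucc).Cell),
    ∃ S : Set (mesh ℓ.succ).Cell, hull T.1 = ⋃ T' ∈ S, hull T'.1
  /-- all cells of level `ℓ` have diameter at most `κ h_ℓ` -/
  diam_le : ∀ (ℓ : Fin (L + 1)) (T : (mesh ℓ).Cell), Metric.diam (hull T.1) ≤ κ * h ℓ
  /-- all cells of level `ℓ` contain a ball of radius `h_ℓ / κ` -/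
  ball_subset : ∀ (ℓ : Fin (L + 1)) (T : (mesh ℓ).Cell),
    ∃ x, Metric.closedBall x (h ℓ / κ) ⊆ hull T.1
  h_succ : ∀ ℓ : Fin L, cref * h ℓ.castSucc ≤ h ℓ.succ

/-! ### Integrals, normals and the skeletal space -/

/-- The integral over the facet `F` with respect to the surface measure. -/
def facetInt (F : Finset (E d)) (f : E d → ℝ) : ℝ := ∫ x in hull F, f x ∂μHE[d - 1]

/-- The integral over the cell `T`. -/
def cellInt (T : Finset (E d)) (f : E d → ℝ) : ℝ := ∫ x in hull T, f x

/-- The volume `|T|` of a cell. -/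
def cellVol (T : Finset (E d)) : ℝ := (volume : Measure (E d)).real (hull T)

/-- The surface area `|∂T|` of a cell. -/
def surfaceArea (𝒯 : Mesh Ω) (T : 𝒯.Cell) : ℝ :=
  ∑ F ∈ 𝒯.facetsOf T, (μHE[d - 1] : Measure (E d)).real (hull F.1)

/-- The component orthogonal to the facet `F` of the vector from the barycentre of the cell `T` to
the barycentre of its facet `F`. -/
def normalDir (T F : Finset (E d)) : E d :=
  (vectorSpan ℝ (F : Set (E d)))ᗮ.starProjection (F.centroid ℝ id - T.centroid ℝ id)

/-- The outward unit normal `ν` of the cell `T` on its facet `F`. -/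
def normal (T F : Finset (E d)) : E d := ‖normalDir T F‖⁻¹ • normalDir T F

/-- Evaluation of a polynomial in `d` variables at a point of `ℝ^d`. -/
def pev (q : MvPolynomial (Fin d) ℝ) (x : E d) : ℝ := MvPolynomial.eval (fun i => x i) q

/-- A function on the skeleton is given by its restrictions `λ F` to the facets `F`, extended by
zero outside of `F`; its values on different facets are independent of each other.
`M_ℓ`: on each facet a polynomial of degree at most `p`, and zero on the Dirichlet facets. -/
def skeletal (𝒯 : Mesh Ω) (p : ℕ) : Submodule ℝ (𝒯.Facet → E d → ℝ) where
  carrier := {lam | (∀ F, ∃ q : MvPolynomial (Fin d) ℝ, q.totalDegree ≤ p ∧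
      lam F = (hull F.1).indicator (pev q)) ∧ ∀ F, 𝒯.IsDirichlet F → lam F = 0}
  zero_mem' := ⟨fun _ => ⟨0, by simp, by ext x; simp [pev, Set.indicator]⟩, fun _ _ => rfl⟩
  add_mem' := by
    rintro l m ⟨hl, hl'⟩ ⟨hm, hm'⟩
    refine ⟨fun F => ?_, fun F hF => by simp [hl' F hF, hm' F hF]⟩
    obtain ⟨q, hq, e⟩ := hl F
    obtain ⟨r, hr, e'⟩ := hm F
    refine ⟨q + r, (MvPolynomial.totalDegree_add _ _).trans (max_le hq hr), ?_⟩
    rw [Pi.add_apply, e, e', ← Set.indicator_add']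
    congr 1
    ext x
    simp [pev]
  smul_mem' := by
    rintro c l ⟨hl, hl'⟩
    refine ⟨fun F => ?_, fun F hF => by simp [hl' F hF]⟩
    obtain ⟨q, hq, e⟩ := hl F
    refine ⟨c • q, (MvPolynomial.totalDegree_smul_le _ _).trans hq, ?_⟩
    rw [Pi.smul_apply, e]
    ext x
    by_cases hx : x ∈ hull F.1 <;> simp [hx, pev, MvPolynomial.smul_eval]

/-- The inner product `⟨λ, μ⟩_ℓ = ∑_T |T| / |∂T| ∫_{∂T} λ μ dσ`. -/
def ip (𝒯 : Mesh Ω) (lam mu : 𝒯.Facet → E d → ℝ) : ℝ :=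
  ∑ T : 𝒯.Cell, cellVol T.1 / surfaceArea 𝒯 T *
    ∑ F ∈ 𝒯.facetsOf T, facetInt F.1 fun x => lam F x * mu F x

/-! ### The local solver and the condensed bilinear form -/

/-- The local space `V_T × W_T = P_p × P_p^d` (a polynomial is determined by its values on a
cell). -/
abbrev LocalSpace (d p : ℕ) : Type :=
  MvPolynomial.restrictTotalDegree (Fin d) ℝ p ×
    (Fin d → MvPolynomial.restrictTotalDegree (Fin d) ℝ p)

/-- `w = (u_T, q_T)` solves the local HDG problem on the cell `T` with skeletal datum `λ` and
penalty parameter `τ`. -/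
def IsLocalSolution (𝒯 : Mesh Ω) (p : ℕ) (τ : ℝ) (T : 𝒯.Cell) (lam : 𝒯.Facet → E d → ℝ)
    (w : LocalSpace d p) : Prop :=
  (∀ r : Fin d → MvPolynomial.restrictTotalDegree (Fin d) ℝ p,
    cellInt T.1 (fun x => ∑ i, pev (w.2 i) x * pev (r i) x)
      - cellInt T.1 (fun x => pev w.1 x * ∑ i, pev (MvPolynomial.pderiv i (r i).1) x)
      = - ∑ F ∈ 𝒯.facetsOf T,
          facetInt F.1 fun x => lam F x * ∑ i, pev (r i) x * normal T.1 F.1 i) ∧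
  (∀ v : MvPolynomial.restrictTotalDegree (Fin d) ℝ p,
    - cellInt T.1 (fun x => ∑ i, pev (w.2 i) x * pev (MvPolynomial.pderiv i v.1) x)
      + ∑ F ∈ 𝒯.facetsOf T, facetInt F.1 (fun x =>
          ((∑ i, pev (w.2 i) x * normal T.1 F.1 i) + τ * pev w.1 x) * pev v x)
      = τ * ∑ F ∈ 𝒯.facetsOf T, facetInt F.1 fun x => lam F x * pev v x)

/-- The solution `(u_T, q_T)` of the local problem. -/
def localSol (𝒯 : Mesh Ω) (p : ℕ) (τ : ℝ) (T : 𝒯.Cell) (lam : 𝒯.Facet → E d → ℝ) :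
    LocalSpace d p :=
  Classical.epsilon (IsLocalSolution 𝒯 p τ T lam)

/-- `U_ℓ λ` on the cell `T`. -/
def locU (𝒯 : Mesh Ω) (p : ℕ) (τ : ℝ) (lam : 𝒯.Facet → E d → ℝ) (T : 𝒯.Cell) (x : E d) : ℝ :=
  pev (localSol 𝒯 p τ T lam).1 x

/-- The `i`-th component of `Q_ℓ λ` on the cell `T`. -/
def locQ (𝒯 : Mesh Ω) (p : ℕ) (τ : ℝ) (lam : 𝒯.Facet → E d → ℝ) (T : 𝒯.Cell) (i : Fin d)
    (x : E d) : ℝ :=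
  pev ((localSol 𝒯 p τ T lam).2 i) x

/-- The condensed bilinear form
`a_ℓ(λ, μ) = ∫_Ω Q_ℓ λ · Q_ℓ μ dx + ∑_T ∫_{∂T} τ_ℓ (U_ℓ λ - λ) (U_ℓ μ - μ) dσ`. -/
def form (𝒯 : Mesh Ω) (p : ℕ) (τ : ℝ) (lam mu : 𝒯.Facet → E d → ℝ) : ℝ :=
  (∑ T : 𝒯.Cell, cellInt T.1 fun x => ∑ i, locQ 𝒯 p τ lam T i x * locQ 𝒯 p τ mu T i x) +
  ∑ T : 𝒯.Cell, ∑ F ∈ 𝒯.facetsOf T, facetInt F.1 fun x =>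
    τ * (locU 𝒯 p τ lam T x - lam F x) * (locU 𝒯 p τ mu T x - mu F x)

/-! ### Operators on the skeletal space -/

/-- `A` represents `a_ℓ` with respect to `⟨·,·⟩_ℓ`. -/
def Represents (𝒯 : Mesh Ω) (p : ℕ) (τ : ℝ) (A : Module.End ℝ (skeletal 𝒯 p)) : Prop :=
  ∀ lam mu : skeletal 𝒯 p, ip 𝒯 (A lam) mu = form 𝒯 p τ lam mu

/-- The operator `A_ℓ`. -/
def opA (𝒯 : Mesh Ω) (p : ℕ) (τ : ℝ) : Module.End ℝ (skeletal 𝒯 p) :=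
  Classical.epsilon (Represents 𝒯 p τ)

/-- `S` is adjoint to `R` with respect to `⟨·,·⟩_ℓ`. -/
def IsAdjoint (𝒯 : Mesh Ω) (p : ℕ) (R S : Module.End ℝ (skeletal 𝒯 p)) : Prop :=
  ∀ lam mu : skeletal 𝒯 p, ip 𝒯 (R lam) mu = ip 𝒯 lam (S mu)

/-- The adjoint `R†` of `R` with respect to `⟨·,·⟩_ℓ`. -/
def dagger (𝒯 : Mesh Ω) (p : ℕ) (R : Module.End ℝ (skeletal 𝒯 p)) :
    Module.End ℝ (skeletal 𝒯 p) :=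
  Classical.epsilon (IsAdjoint 𝒯 p R)

/-- `K_ℓ = (1 - (1 - R_ℓ A_ℓ) (1 - R_ℓ† A_ℓ)) A_ℓ⁻¹`. -/
def opK (𝒯 : Mesh Ω) (p : ℕ) (τ : ℝ) (R : Module.End ℝ (skeletal 𝒯 p)) :
    Module.End ℝ (skeletal 𝒯 p) :=
  (1 - (1 - R * opA 𝒯 p τ) * (1 - dagger 𝒯 p R * opA 𝒯 p τ)) * Ring.inverse (opA 𝒯 p τ)

/-- The eigenvalues of `A_ℓ`. -/
def eigs (𝒯 : Mesh Ω) (p : ℕ) (τ : ℝ) : Set ℝ :=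
  {c | Module.End.HasEigenvalue (opA 𝒯 p τ) c}

/-- The largest eigenvalue of `A_ℓ`. -/
def lamMax (𝒯 : Mesh Ω) (p : ℕ) (τ : ℝ) : ℝ := sSup (eigs 𝒯 p τ)

/-- All objects above are well defined: the local problems are uniquely solvable, `A_ℓ` and all
adjoints exist and are unique, `A_ℓ` is invertible, and it has a largest eigenvalue (unless
`M_ℓ = 0`), which is positive. -/
def WellPosed (𝒯 : Mesh Ω) (p : ℕ) (τ : ℝ) : Prop :=
  (∀ (T : 𝒯.Cell) (lam : skeletal 𝒯 p), ∃! w, IsLocalSolution 𝒯 p τ T lam w) ∧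
  (∃! A, Represents 𝒯 p τ A) ∧
  IsUnit (opA 𝒯 p τ) ∧
  (∀ R, ∃! S, IsAdjoint 𝒯 p R S) ∧
  (Nontrivial (skeletal 𝒯 p) → IsGreatest (eigs 𝒯 p τ) (lamMax 𝒯 p τ) ∧ 0 < lamMax 𝒯 p τ)

/-- The smoothing hypothesis for the smoother `R_ℓ` with constant `C`. -/
def SmoothingHypothesis (𝒯 : Mesh Ω) (p : ℕ) (τ : ℝ) (R : Module.End ℝ (skeletal 𝒯 p))
    (C : ℝ) : Prop :=
  ∀ lam : skeletal 𝒯 p,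
    ip 𝒯 lam lam / lamMax 𝒯 p τ ≤ C * ip 𝒯 (opK 𝒯 p τ R lam) lam

/-! ### Degrees of freedom -/

/-- The polynomials of degree at most `p` on the reference facet, the standard `(d-1)`-simplex
`{t ∈ ℝ^d | t ≥ 0, ∑ t_k = 1}`. -/
def refPoly (d p : ℕ) : Submodule ℝ (stdSimplex ℝ (Fin d) → ℝ) where
  carrier := {f | ∃ q : MvPolynomial (Fin d) ℝ, q.totalDegree ≤ p ∧
    ∀ t, f t = MvPolynomial.eval t.1 q}
  zero_mem' := ⟨0, by simp, by simp⟩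
  add_mem' := by
    rintro f g ⟨q, hq, e⟩ ⟨r, hr, e'⟩
    exact ⟨q + r, (MvPolynomial.totalDegree_add _ _).trans (max_le hq hr), by simp [e, e']⟩
  smul_mem' := by
    rintro c f ⟨q, hq, e⟩
    exact ⟨c • q, (MvPolynomial.totalDegree_smul_le _ _).trans hq,
      by simp [e, MvPolynomial.smul_eval]⟩

/-- A numbering of the vertices of each facet. -/
abbrev Mesh.Numbering (𝒯 : Mesh Ω) : Type := ∀ F : 𝒯.Facet, Fin d ≃ F.1

/-- The affine parametrization of the facet `F` by the reference facet. -/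
def param {𝒯 : Mesh Ω} (ord : 𝒯.Numbering) (F : 𝒯.Facet) (t : stdSimplex ℝ (Fin d)) : E d :=
  ∑ k, t.1 k • (ord F k : E d)

open Classical in
/-- The transport of a function `f` on the reference facet to the facet `F`, extended by zero. -/
def transport {𝒯 : Mesh Ω} (ord : 𝒯.Numbering) (F : 𝒯.Facet) (f : stdSimplex ℝ (Fin d) → ℝ)
    (x : E d) : ℝ :=
  if h : ∃ t, param ord F t = x then f h.choose else 0

lemma totalDegree_aeval_le {n p : ℕ} (l : Fin d → MvPolynomial (Fin n) ℝ)
    (hl : ∀ k, (l k).totalDegree ≤ 1) (q : MvPolynomial (Fin d) ℝ) (hq : q.totalDegree ≤ p) :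
    (MvPolynomial.aeval l q).totalDegree ≤ p := by
  rw [MvPolynomial.aeval_def, MvPolynomial.eval₂_eq]
  refine MvPolynomial.totalDegree_finsetSum_le fun m hm => ?_
  refine (MvPolynomial.totalDegree_mul _ _).trans ?_
  have h1 : (∏ i ∈ m.support, l i ^ m i).totalDegree ≤ ∑ i ∈ m.support, m i := by
    refine (MvPolynomial.totalDegree_finsetProd _ _).trans (Finset.sum_le_sum fun i _ => ?_)
    refine (MvPolynomial.totalDegree_pow _ _).trans ?_
    nlinarith [hl i]
  have h2 : ∑ i ∈ m.support, m i ≤ p := (MvPolynomial.le_totalDegree hm).trans hq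
  have h3 : (algebraMap ℝ (MvPolynomial (Fin n) ℝ) (q.coeff m)).totalDegree = 0 :=
    MvPolynomial.totalDegree_C _
  omega

/-- There are polynomials of degree one that invert the parametrization of a facet. -/
lemma exists_param_inverse {𝒯 : Mesh Ω} (ord : 𝒯.Numbering) (F : 𝒯.Facet) :
    ∃ l : Fin d → MvPolynomial (Fin d) ℝ, (∀ k, (l k).totalDegree ≤ 1) ∧
      ∀ (t : stdSimplex ℝ (Fin d)) (k : Fin d), pev (l k) (param ord F t) = t.1 k := by
  let f : (Fin d → ℝ) →ₗ[ℝ] ℝ × E d :=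
    (∑ k, LinearMap.proj k).prod
      (∑ k, (LinearMap.proj k : (Fin d → ℝ) →ₗ[ℝ] ℝ).smulRight (ord F k : E d))
  have hf : ∀ t, f t = (∑ k, t k, ∑ k, t k • (ord F k : E d)) := fun t => by
    simp [f]
  have hker : LinearMap.ker f = ⊥ := by
    rw [LinearMap.ker_eq_bot']
    intro t ht
    rw [hf, Prod.mk_eq_zero] at ht
    have hi : AffineIndependent ℝ (fun k => (ord F k : E d)) :=
      (𝒯.K.indep F.2.1).comp_embedding (ord F).toEmbedding
    ext k
    exact affineIndependent_iff.1 hi Finset.univ t ht.1 ht.2 k (Finset.mem_univ k)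
  obtain ⟨g, hg⟩ := f.exists_leftInverse_of_injective hker
  let e : Fin d → E d := fun i => EuclideanSpace.single i 1
  refine ⟨fun k => MvPolynomial.C (g (1, 0) k) +
    ∑ i, MvPolynomial.C (g (0, e i) k) * MvPolynomial.X i, fun k => ?_, fun t k => ?_⟩
  · refine (MvPolynomial.totalDegree_add _ _).trans (max_le (by simp) ?_)
    refine MvPolynomial.totalDegree_finsetSum_le fun i _ => ?_
    refine (MvPolynomial.totalDegree_mul _ _).trans ?_
    simp
  · have hx : ∀ x : E d, ((1 : ℝ), x) = (1, 0) + ∑ i, x i • ((0 : ℝ), e i) := by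
      intro x
      ext j
      · simp [Prod.fst_sum]
      · simp [Prod.snd_sum, e, Finset.sum_apply, Pi.single_apply]
    have ht : g (1, param ord F t) = t.1 := by
      have := LinearMap.congr_fun hg t.1
      rw [LinearMap.comp_apply, hf] at this
      simpa [param, t.2.2] using this
    have h2 : g (1, 0) k + ∑ i, param ord F t i * g (0, e i) k = t.1 k := by
      rw [← ht, hx (param ord F t), map_add, map_sum]
      simp only [map_smul, Pi.add_apply, Finset.sum_apply, Pi.smul_apply, smul_eq_mul]
    rw [← h2]
    simp [pev, mul_comm]

lemma param_injective {𝒯 : Mesh Ω} (ord : 𝒯.Numbering) (F : 𝒯.Facet) :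
    Function.Injective (param ord F) := by
  obtain ⟨l, _, hl⟩ := exists_param_inverse ord F
  intro s t h
  ext k
  exact (hl s k).symm.trans ((congrArg (pev (l k)) h).trans (hl t k))

lemma range_param {𝒯 : Mesh Ω} (ord : 𝒯.Numbering) (F : 𝒯.Facet) :
    Set.range (param ord F) = hull F.1 := by
  have h : (F.1 : Set (E d)) = Set.range fun k => (ord F k : E d) := by
    ext x
    constructor
    · intro hx
      exact ⟨(ord F).symm ⟨x, hx⟩, by simp⟩
    · rintro ⟨k, rfl⟩
      exact (ord F k).2
  let f : (Fin d → ℝ) →ₗ[ℝ] E d :=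
    ∑ k, (LinearMap.proj k : (Fin d → ℝ) →ₗ[ℝ] ℝ).smulRight (ord F k : E d)
  have hf : ∀ t, f t = ∑ k, t k • (ord F k : E d) := fun t => by simp [f, LinearMap.sum_apply]
  have h' : f '' stdSimplex ℝ (Fin d) = hull F.1 := by
    rw [← convexHull_rangle_single_eq_stdSimplex, LinearMap.image_convexHull, ← Set.range_comp,
      hull, h]
    congr 2
    ext k
    simp [hf, Pi.single_apply]
  rw [← h']
  ext x
  constructor
  · rintro ⟨t, rfl⟩
    exact ⟨t.1, t.2, hf _⟩
  · rintro ⟨t, ht, rfl⟩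
    exact ⟨⟨t, ht⟩, (hf _).symm⟩

lemma transport_param {𝒯 : Mesh Ω} (ord : 𝒯.Numbering) (F : 𝒯.Facet)
    (f : stdSimplex ℝ (Fin d) → ℝ) (t : stdSimplex ℝ (Fin d)) :
    transport ord F f (param ord F t) = f t := by
  have h : ∃ s, param ord F s = param ord F t := ⟨t, rfl⟩
  rw [transport, dif_pos h]
  exact congrArg f (param_injective ord F h.choose_spec)

lemma transport_mem {p : ℕ} {𝒯 : Mesh Ω} (ord : 𝒯.Numbering) (F : 𝒯.Facet) (f : refPoly d p) :
    ∃ q : MvPolynomial (Fin d) ℝ, q.totalDegree ≤ p ∧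
      transport ord F f.1 = (hull F.1).indicator (pev q) := by
  obtain ⟨q, hq, hf⟩ := f.2
  obtain ⟨l, hl1, hl⟩ := exists_param_inverse ord F
  refine ⟨MvPolynomial.aeval l q, totalDegree_aeval_le l hl1 q hq, ?_⟩
  ext x
  by_cases hx : x ∈ hull F.1
  · rw [Set.indicator_of_mem hx]
    rw [← range_param ord F] at hx
    obtain ⟨t, rfl⟩ := hx
    rw [transport_param, hf, pev, ← MvPolynomial.coe_aeval_eq_eval, ← MvPolynomial.coe_aeval_eq_eval,
      RingHom.coe_coe, RingHom.coe_coe, ← AlgHom.comp_apply, MvPolynomial.comp_aeval]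
    congr 2
    ext k
    exact (hl t k).symm
  · rw [Set.indicator_of_notMem hx, transport, dif_neg]
    rw [← range_param ord F] at hx
    exact hx

/-- The degrees of freedom on a mesh, for a basis on the reference facet indexed by `ι`. -/
abbrev Mesh.Dof (𝒯 : Mesh Ω) (ι : Type*) : Type _ := 𝒯.FreeFacet × ι

open Classical in
/-- The basis function of `M_ℓ` that belongs to a degree of freedom: the transported reference
basis function on its facet, and zero on all other facets. -/
def basisFun {p : ℕ} {ι : Type*} (b : Module.Basis ι ℝ (refPoly d p)) {𝒯 : Mesh Ω}
    (ord : 𝒯.Numbering) (i : 𝒯.Dof ι) : skeletal 𝒯 p :=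
  ⟨fun F => if F = i.1.1 then transport ord F (b i.2).1 else 0, fun F => by
    by_cases hF : F = i.1.1
    · simpa only [if_pos hF] using transport_mem ord F (b i.2)
    · refine ⟨0, by simp, ?_⟩
      ext x
      simp [hF, pev, Set.indicator], fun F hD => if_neg fun h => i.1.2 (by rwa [← h])⟩

/-! ### Linearity of the inner product -/

lemma isCompact_hull (S : Finset (E d)) : IsCompact (hull S) := S.finite_toSet.isCompact_convexHull ℝ

lemma facet_measure_lt_top {𝒯 : Mesh Ω} (F : 𝒯.Facet) :
    (μHE[d - 1] : Measure (E d)) (hull F.1) < ⊤ := by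
  obtain ⟨x0, hx0⟩ := 𝒯.K.nonempty_of_mem_faces F.2.1
  let V := vectorSpan ℝ (F.1 : Set (E d))
  have hc : F.1.card = (d - 1) + 1 := by
    have := Finset.card_pos.2 ⟨x0, hx0⟩
    have := F.2.2
    omega
  have hV : Module.finrank ℝ V = d - 1 := by
    have h1 := (𝒯.K.indep F.2.1).finrank_vectorSpan (n := d - 1) (by simpa using hc)
    rwa [Subtype.range_coe_subtype, Finset.setOfPred_mem] at h1
  let g : V → E d := fun v => v.1 + x0
  have hg : Isometry g := (IsometryEquiv.addRight x0).isometry.comp isometry_subtype_coe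
  have hsub : hull F.1 ⊆ Set.range g := by
    intro x hx
    have hx1 : x ∈ affineSpan ℝ (F.1 : Set (E d)) := convexHull_subset_affineSpan _ hx
    have hx2 : x -ᵥ x0 ∈ V := (direction_affineSpan ℝ (F.1 : Set (E d))).le
      (AffineSubspace.vsub_mem_direction hx1 (subset_affineSpan ℝ _ hx0))
    exact ⟨⟨x -ᵥ x0, hx2⟩, by simp [g]⟩
  have h1 := hg.euclideanHausdorffMeasure_preimage (d := d - 1) (hull F.1)
  rw [Set.inter_eq_left.2 hsub] at h1
  rw [← h1, ← hV]
  exact (hg.isClosedEmbedding.isCompact_preimage (isCompact_hull F.1)).measure_lt_top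

lemma continuous_pev (q : MvPolynomial (Fin d) ℝ) : Continuous (pev q) := by
  unfold pev
  exact (MvPolynomial.continuous_eval q).comp (by fun_prop)

lemma integrable_skeletal_mul {p : ℕ} {𝒯 : Mesh Ω} (l m : skeletal 𝒯 p) (F : 𝒯.Facet) :
    IntegrableOn (fun x => l.1 F x * m.1 F x) (hull F.1) μHE[d - 1] := by
  obtain ⟨q, _, hq⟩ := l.2.1 F
  obtain ⟨r, _, hr⟩ := m.2.1 F
  have h : IntegrableOn (fun x => pev q x * pev r x) (hull F.1) μHE[d - 1] := by
    obtain ⟨C, hC⟩ := (isCompact_hull F.1).exists_bound_of_continuousOn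
      ((continuous_pev q).mul (continuous_pev r)).continuousOn
    refine IntegrableOn.of_bound (facet_measure_lt_top F)
      ((continuous_pev q).mul (continuous_pev r)).aestronglyMeasurable C ?_
    exact (ae_restrict_iff' (isCompact_hull F.1).measurableSet).2 (ae_of_all _ hC)
  refine h.congr_fun (fun x hx => ?_) (isCompact_hull F.1).measurableSet
  simp [hq, hr, Set.indicator_of_mem hx]

lemma ip_add_left {p : ℕ} {𝒯 : Mesh Ω} (l l' m : skeletal 𝒯 p) :
    ip 𝒯 (l + l' : skeletal 𝒯 p) m = ip 𝒯 l m + ip 𝒯 l' m := by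
  unfold ip
  rw [← Finset.sum_add_distrib]
  refine Finset.sum_congr rfl fun T _ => ?_
  rw [← mul_add, ← Finset.sum_add_distrib]
  congr 1
  refine Finset.sum_congr rfl fun F _ => ?_
  rw [facetInt, facetInt, facetInt,
    ← integral_add (integrable_skeletal_mul l m F) (integrable_skeletal_mul l' m F)]
  simp [add_mul]

lemma ip_smul_left {p : ℕ} {𝒯 : Mesh Ω} (c : ℝ) (l m : skeletal 𝒯 p) :
    ip 𝒯 (c • l : skeletal 𝒯 p) m = c * ip 𝒯 l m := by
  unfold ip
  rw [Finset.mul_sum]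
  refine Finset.sum_congr rfl fun T _ => ?_
  have h : ∀ F, facetInt F.1 (fun x => (c • l : skeletal 𝒯 p).1 F x * m.1 F x) =
      c * facetInt F.1 (fun x => l.1 F x * m.1 F x) := fun F => by
    rw [facetInt, facetInt, ← integral_const_mul]
    simp [mul_assoc]
  simp only [h, ← Finset.mul_sum]
  ring

/-! ### Smoothers -/

/-- The solution in the one-dimensional space spanned by `φ` of the problem with right-hand side
`g`: the multiple `c φ` of `φ` with `a_ℓ(c φ, φ) = ⟨g, φ⟩_ℓ`, as a linear map in `g`. -/
def lineSolve (𝒯 : Mesh Ω) (p : ℕ) (τ : ℝ) (φ : skeletal 𝒯 p) : Module.End ℝ (skeletal 𝒯 p) where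
  toFun g := (ip 𝒯 g φ / form 𝒯 p τ φ φ) • φ
  map_add' g g' := by rw [ip_add_left, add_div, add_smul]
  map_smul' c g := by rw [ip_smul_left, mul_div_assoc, mul_smul, RingHom.id_apply]

variable {p : ℕ} {ι : Type*}

/-- The Jacobi smoother with damping factor `γ`: all one-dimensional problems are solved
independently and the results are added. -/
def jacobi [Fintype ι] (b : Module.Basis ι ℝ (refPoly d p)) {𝒯 : Mesh Ω} (τ : ℝ)
    (ord : 𝒯.Numbering) (γ : ℝ) : Module.End ℝ (skeletal 𝒯 p) :=
  γ • ∑ i : 𝒯.Dof ι, lineSolve 𝒯 p τ (basisFun b ord i)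

/-- The Gauss–Seidel smoother for the sequence `s` of degrees of freedom: starting with `x = 0`,
the iterate `x` for the right-hand side `g` is successively corrected for each degree of freedom by
the solution of the one-dimensional problem whose right-hand side is the residual `g - A_ℓ x`. -/
def gaussSeidel (b : Module.Basis ι ℝ (refPoly d p)) {𝒯 : Mesh Ω} (τ : ℝ)
    (ord : 𝒯.Numbering) (s : List (𝒯.Dof ι)) : Module.End ℝ (skeletal 𝒯 p) :=
  s.foldl (fun R i => R + lineSolve 𝒯 p τ (basisFun b ord i) * (1 - opA 𝒯 p τ * R)) 0

/-- The limited interaction property: two degrees of freedom interact only if their facets belong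
to a common cell, and each degree of freedom interacts with at most `(2 d + 1) |ι|` others
(including itself), `|ι|` being the number of degrees of freedom per facet. -/
def LimitedInteraction [Fintype ι] (b : Module.Basis ι ℝ (refPoly d p)) {𝒯 : Mesh Ω} (τ : ℝ)
    (ord : 𝒯.Numbering) : Prop :=
  (∀ i j : 𝒯.Dof ι, form 𝒯 p τ (basisFun b ord i) (basisFun b ord j) ≠ 0 →
    ∃ T : 𝒯.Cell, i.1.1 ∈ 𝒯.facetsOf T ∧ j.1.1 ∈ 𝒯.facetsOf T) ∧
  ∀ i : 𝒯.Dof ι, {j | form 𝒯 p τ (basisFun b ord i) (basisFun b ord j) ≠ 0}.ncard ≤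
    (2 * d + 1) * Fintype.card ι

end HDG

end

/-!
The argument has an algebraic and a geometric part.

*Algebra.* Let `g` and `a` be the inner product `⟨·,·⟩_ℓ` and the condensed form, `A w = λ`, and
`φ_i` the degrees of freedom. Then `⟨K λ, λ⟩ = a(w, w) - a(z, z)` with `z = w - R† A w`, the energy
decrease in one adjoint smoothing step (`inner_symmetrized_smoother`). For both smoothers it
dominates `∑ ⟨λ, φ_i⟩² / a(φ_i, φ_i)`. For the Jacobi smoother, `2 a(w, x) - a(x, x)` with
`x = R λ` is estimated by pairing interacting unknowns (`jacobi_lower_bound`). For the Gauss–Seidel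
smoother, the adjoint step visits the unknowns in the reverse order, the energy decrease is the sum
of the squares of the normalized corrections, and every residual `a(w, φ_k)` is a sum of corrections
of unknowns that interact with `φ_k` (`gaussSeidel_corrections`, `gaussSeidel_lower_bound`). On the
other hand `‖λ‖² ≤ λ_max C ∑ ⟨λ, φ_i⟩² / a(φ_i, φ_i)` by the Cauchy–Schwarz inequality, whenever the
splitting `λ = ∑ c_i φ_i` satisfies `∑ ‖c_i φ_i‖² ≤ C ‖λ‖²` (`sum_sq_div_lower_bound`). The weighted
norm is a sum over facets, and the surface measure of a facet is a multiple of the measure of the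
reference facet, so `C` depends on the reference basis only (`sum_dofCoeff_sq_le`). This is why no
mesh parameter and no penalty parameter enters.

*Geometry.* Two facts about meshes are needed. A facet lies in at most two cells, on opposite sides
of it (`not_same_side`, `normal_eq_neg`, `eq_or_eq_of_facet`); this bounds the number of interacting
unknowns. And the forms are definite, which rests on the divergence theorem for polynomials on a
simplex (`cellInt_pderiv`). By linearity it suffices to prove that theorem for the directions of the
edges. For an edge, Fubini's theorem along the edge direction expresses the integral by the two
facets opposite to its end points; the constants are identified by `exists_hyperplane_jacobian`. The
local problem is then uniquely solvable by its energy identity (`localForm_self`). If the energy of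
`λ` vanishes, then `U λ` is constant on each cell and equals `λ` on its boundary; since
`∫_T u² = ∑_F ν_0 ∫_F u² x_0` for constant `u`, and the two normals of a free facet cancel, summation
over all cells gives `U λ = 0` (`eq_zero_of_form_self`).
-/

noncomputable section

namespace HDG

open MeasureTheory
open scoped RealInnerProductSpace

/-! ### Surface measure on a hyperplane -/

/-- A linear parametrization scales Lebesgue measure by a constant, by uniqueness of Haar measure. -/
lemma exists_map_volume_eq_smul {n : ℕ} {W : Type*} [NormedAddCommGroup W] [InnerProductSpace ℝ W]
    [MeasurableSpace W] [BorelSpace W] [FiniteDimensional ℝ W] (M : (Fin n → ℝ) ≃ₗ[ℝ] W) :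
    ∃ c : NNReal, c ≠ 0 ∧ (volume : Measure (Fin n → ℝ)).map M = c • (volume : Measure W) := by
  have h : ((volume : Measure (Fin n → ℝ)).map M.toContinuousLinearEquiv).IsAddHaarMeasure :=
    ContinuousLinearEquiv.isAddHaarMeasure_map _ _
  refine ⟨_, ?_, Measure.isAddLeftInvariant_eq_smul _ _⟩
  exact (Measure.addHaarScalarFactor_pos_of_isAddHaarMeasure
    ((volume : Measure (Fin n → ℝ)).map M.toContinuousLinearEquiv) (volume : Measure W)).ne'

/-- A hyperplane `x₀ + range L` with unit normal `ν` and an affine parametrization of it: the same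
constant `J` appears in the change of variables for the surface measure and, multiplied by
`|⟨ξ, ν⟩|`, in Fubini's theorem for the slices in an arbitrary transversal direction `ξ`. -/
theorem exists_hyperplane_jacobian {n : ℕ} (L : (Fin n → ℝ) →ₗ[ℝ] E (n + 1))
    (hL : Function.Injective L) {ν : E (n + 1)} (hν : ‖ν‖ = 1) (hLν : ∀ y, ⟪L y, ν⟫ = 0)
    (x₀ : E (n + 1)) :
    ∃ J : ℝ, 0 < J ∧
      (∀ (S : Set (Fin n → ℝ)) (g : E (n + 1) → ℝ),
        ∫ x in (fun y => x₀ + L y) '' S, g x ∂μHE[n] = J * ∫ y in S, g (x₀ + L y)) ∧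
      ∀ ξ : E (n + 1), ⟪ξ, ν⟫ ≠ 0 → ∀ g : E (n + 1) → ℝ,
        ∫ x, g x = |⟪ξ, ν⟫| * J * ∫ z : (Fin n → ℝ) × ℝ, g (x₀ + L z.1 + z.2 • ξ) := by
  set W := LinearMap.range L with hWdef
  let M : (Fin n → ℝ) ≃ₗ[ℝ] W := LinearEquiv.ofInjective L hL
  have hM : ∀ y, (M y : E (n + 1)) = L y := fun y => rfl
  have hMemb : MeasurableEmbedding M :=
    M.toContinuousLinearEquiv.toHomeomorph.measurableEmbedding
  obtain ⟨c, hc, hcM⟩ := exists_map_volume_eq_smul M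
  have hcpos : (0 : ℝ) < c := NNReal.coe_pos.2 (pos_iff_ne_zero.2 hc)
  have hW : Module.finrank ℝ W = n := by
    rw [← M.finrank_eq]; simp
  have hWo : Module.finrank ℝ Wᗮ = 1 := by
    have := W.finrank_add_finrank_orthogonal
    rw [hW] at this
    simp only [finrank_euclideanSpace, Fintype.card_fin] at this
    omega
  have hνW : ν ∈ Wᗮ := by
    rw [Submodule.mem_orthogonal]
    rintro _ ⟨y, rfl⟩
    exact hLν y
  have hν0 : ν ≠ 0 := by
    rintro rfl
    simp at hν
  refine ⟨(c : ℝ)⁻¹, inv_pos.2 hcpos, fun S g => ?_, fun ξ hξ g => ?_⟩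
  · let i : W → E (n + 1) := fun w => x₀ + w
    have hi : Isometry i := (IsometryEquiv.addLeft x₀).isometry.comp isometry_subtype_coe
    have hie : MeasurableEmbedding i := hi.isClosedEmbedding.measurableEmbedding
    have himg : (fun y => x₀ + L y) '' S = i '' (M '' S) := by
      rw [Set.image_image]; rfl
    have hsub : (fun y => x₀ + L y) '' S ⊆ Set.range i := by
      rw [himg]; exact Set.image_subset_range _ _
    have h1 : (μHE[n] : Measure (E (n + 1))).restrict ((fun y => x₀ + L y) '' S) =
        (((volume : Measure W).map i)).restrict ((fun y => x₀ + L y) '' S) := by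
      rw [← InnerProductSpace.euclideanHausdorffMeasure_eq_volume, hW,
        hi.map_euclideanHausdorffMeasure]
      rw [Measure.restrict_restrict_of_subset hsub]
    rw [h1, hie.setIntegral_map, himg, hi.injective.preimage_image]
    have h2 : (volume : Measure W) = c⁻¹ • (volume : Measure (Fin n → ℝ)).map M := by
      rw [hcM, smul_smul, inv_mul_cancel₀ hc, one_smul]
    rw [h2, Measure.restrict_smul, integral_smul_nnreal_measure, hMemb.setIntegral_map,
      M.injective.preimage_image, NNReal.smul_def, smul_eq_mul, NNReal.coe_inv]
    rfl
  -- The direction `ξ` is reached from `ν` by scaling with `h` and a shear along `W`.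
  · set h := ⟪ξ, ν⟫ with hh
    have hζ : ξ - h • ν ∈ W := by
      have : W = (ℝ ∙ ν)ᗮ := by
        refine Submodule.eq_of_le_of_finrank_eq ?_ ?_
        · rintro _ ⟨y, rfl⟩
          rw [Submodule.mem_orthogonal_singleton_iff_inner_left]
          exact hLν y
        · have h3 := (ℝ ∙ ν).finrank_add_finrank_orthogonal
          rw [finrank_span_singleton hν0] at h3
          simp only [finrank_euclideanSpace, Fintype.card_fin] at h3
          omega
      rw [this, Submodule.mem_orthogonal_singleton_iff_inner_left, inner_sub_left, inner_smul_left]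
      simp [hν, hh]
    let ζ : W := ⟨ξ - h • ν, hζ⟩
    let ν' : Wᗮ := ⟨ν, hνW⟩
    have h1 : MeasurePreserving (fun p : ℝ × (Fin n → ℝ) => (h * p.1, M p.2 + p.1 • ζ))
        ((volume : Measure ℝ).prod (volume : Measure (Fin n → ℝ)))
        ((ENNReal.ofReal |h⁻¹| • (volume : Measure ℝ)).prod (c • (volume : Measure W))) := by
      refine MeasurePreserving.skew_product (f := fun t => h * t) (g := fun t y => M y + t • ζ)
        ⟨measurable_const_mul h, Real.map_volume_mul_left hξ⟩ ?_ ?_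
      · exact (hMemb.measurable.comp measurable_snd).add (measurable_fst.smul_const ζ)
      · refine ae_of_all _ fun t => ?_
        have : (fun y => M y + t • ζ) = (fun w => w + t • ζ) ∘ M := rfl
        rw [this, ← Measure.map_map (measurable_add_const _) hMemb.measurable, hcM]
        rw [Measure.map_smul, map_add_right_eq_self]
    have h2 : MeasurePreserving (fun s : ℝ => s • ν') volume volume := by
      refine ⟨measurable_id.smul_const _, ?_⟩
      have hn : ‖ν'‖ = 1 := hν
      rw [volume_eq_of_finrank_eq_one hWo (v := ν') (by rintro h'; rw [h'] at hn; simp at hn)]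
      rw [← ofReal_norm, hn]
      simp
    have h3 := (W.measurePreserving_measurableEquivProd x₀).symm
    have h4 : MeasurePreserving (fun p : W × ℝ => (p.1, p.2 • ν'))
        ((volume : Measure W).prod volume) ((volume : Measure W).prod volume) :=
      (MeasurePreserving.id _).prod h2
    have hfr : (μHE[Module.finrank ℝ (E (n + 1))] : Measure (E (n + 1))) = volume := by
      rw [InnerProductSpace.euclideanHausdorffMeasure_eq_volume]
    rw [hfr] at h3
    let Ψ : (Fin n → ℝ) × ℝ → E (n + 1) := fun z => x₀ + L z.1 + z.2 • ξ
    have hΨ : MeasurePreserving Ψ volume ((ENNReal.ofReal |h⁻¹| * c) • volume) := by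
      have h5 : MeasurePreserving (fun p : ℝ × (Fin n → ℝ) => (h * p.1, M p.2 + p.1 • ζ))
          (volume.prod volume)
          ((ENNReal.ofReal |h⁻¹| * c) • ((volume : Measure ℝ).prod (volume : Measure W))) := by
        convert h1 using 1
        rw [Measure.prod_smul_left]
        change _ = _ • Measure.prod _ ((c : ENNReal) • volume)
        rw [Measure.prod_smul_right, smul_smul]
      have h6 := (h3.comp h4).comp (Measure.measurePreserving_swap (μ := (volume : Measure ℝ))
        (ν := (volume : Measure W)))
      have h7 := ((h6.smul_measure (ENNReal.ofReal |h⁻¹| * c)).comp h5).comp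
        (Measure.measurePreserving_swap (μ := (volume : Measure (Fin n → ℝ)))
        (ν := (volume : Measure ℝ)))
      refine (congrArg (fun f => MeasurePreserving f volume _) (funext fun z => ?_)).mp h7
      simp only [Function.comp, Ψ, Prod.swap, Submodule.measurableEquivProd_symm_apply]
      simp only [vadd_eq_add, Submodule.coe_add, Submodule.coe_smul, hM, ζ, ν']
      module
    have hemb : MeasurableEmbedding Ψ := by
      have hinj : Function.Injective Ψ := by
        intro z z' hz
        have e : L z.1 + z.2 • ξ = L z'.1 + z'.2 • ξ := by
          simpa [Ψ, add_assoc] using hz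
        have e2 : z.2 = z'.2 := by
          have := congrArg (fun v => ⟪v, ν⟫) e
          simp only [inner_add_left, hLν, inner_smul_left, zero_add] at this
          exact mul_right_cancel₀ hξ (by simpa using this)
        rw [e2] at e
        exact Prod.ext (hL (add_right_cancel e)) e2
      exact Continuous.measurableEmbedding (by
        have := L.continuous_of_finiteDimensional
        fun_prop) hinj
    have h8 := hemb.integral_map (μ := volume) g
    rw [hΨ.map_eq, integral_smul_measure] at h8
    change _ = |h| * (c : ℝ)⁻¹ * ∫ z, g (Ψ z)
    rw [← h8]
    have : |h| ≠ 0 := abs_ne_zero.2 hξ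
    simp [abs_inv]
    field_simp

/-! ### Simplices and the divergence theorem for edge directions -/

/-- The reference simplex `{y ∈ ℝ^m | y ≥ 0, ∑ y_j ≤ 1}`. -/
def refSimplex (m : ℕ) : Set (Fin m → ℝ) := {y | (∀ j, 0 ≤ y j) ∧ ∑ j, y j ≤ 1}

lemma isCompact_refSimplex (m : ℕ) : IsCompact (refSimplex m) := by
  refine (isCompact_Icc (a := (0 : Fin m → ℝ)) (b := 1)).of_isClosed_subset ?_ ?_
  · have h1 : IsClosed {y : Fin m → ℝ | ∀ j, 0 ≤ y j} := by
      simp only [Set.ofPred_forall]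
      exact isClosed_iInter fun j => isClosed_le continuous_const (continuous_apply j)
    exact h1.inter (isClosed_le (continuous_finsetSum _ fun j _ => continuous_apply j) continuous_const)
  · rintro y ⟨h0, h1⟩
    exact ⟨h0, fun j => (Finset.single_le_sum (fun i _ => h0 i) (Finset.mem_univ j)).trans h1⟩

lemma convex_refSimplex (m : ℕ) : Convex ℝ (refSimplex m) := by
  rintro x ⟨hx, hx'⟩ y ⟨hy, hy'⟩ a b ha hb hab
  refine ⟨fun j => add_nonneg (mul_nonneg ha (hx j)) (mul_nonneg hb (hy j)), ?_⟩
  simp only [Pi.add_apply, Pi.smul_apply, smul_eq_mul, Finset.sum_add_distrib, ← Finset.mul_sum]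
  nlinarith

lemma interior_refSimplex_nonempty (m : ℕ) : (interior (refSimplex m)).Nonempty := by
  have ho : IsOpen {y : Fin m → ℝ | (∀ j, 0 < y j) ∧ ∑ j, y j < 1} := by
    have h1 : IsOpen {y : Fin m → ℝ | ∀ j, 0 < y j} := by
      simp only [Set.ofPred_forall]
      exact isOpen_iInter_of_finite fun j => isOpen_lt continuous_const (continuous_apply j)
    exact h1.inter (isOpen_lt (continuous_finsetSum _ fun j _ => continuous_apply j) continuous_const)
  refine ⟨fun _ => (1 : ℝ) / (m + 1), interior_maximal ?_ ho ⟨fun j => by positivity, ?_⟩⟩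
  · exact fun y hy => ⟨fun j => (hy.1 j).le, hy.2.le⟩
  · simp only [Finset.sum_const, Finset.card_univ, Fintype.card_fin, nsmul_eq_mul]
    rw [mul_one_div, div_lt_one (by positivity)]
    simp

lemma refSimplex_subset_closure_interior (m : ℕ) :
    refSimplex m ⊆ closure (interior (refSimplex m)) := by
  rw [(convex_refSimplex m).closure_interior_eq_closure_of_nonempty_interior
    (interior_refSimplex_nonempty m)]
  exact subset_closure

section SimplexMap

variable {V : Type*} [AddCommGroup V] [Module ℝ V] {m : ℕ}

/-- The linear part of the affine map that sends the vertices of the reference simplex to the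
points `w`. -/
def simplexLin (w : Fin (m + 1) → V) : (Fin m → ℝ) →ₗ[ℝ] V :=
  ∑ j, (LinearMap.proj j : (Fin m → ℝ) →ₗ[ℝ] ℝ).smulRight (w j.succ - w 0)

lemma simplexLin_apply (w : Fin (m + 1) → V) (y : Fin m → ℝ) :
    simplexLin w y = ∑ j, y j • (w j.succ - w 0) := by
  simp [simplexLin, LinearMap.sum_apply]

/-- The affine map that sends the origin to `w 0` and the `j`-th unit vector to `w (j + 1)`. -/
def simplexMap (w : Fin (m + 1) → V) (y : Fin m → ℝ) : V := w 0 + simplexLin w y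

lemma simplexMap_eq_sum (w : Fin (m + 1) → V) (y : Fin m → ℝ) :
    simplexMap w y = (1 - ∑ j, y j) • w 0 + ∑ j, y j • w j.succ := by
  rw [simplexMap, simplexLin_apply]
  simp only [smul_sub, Finset.sum_sub_distrib, ← Finset.sum_smul]
  module

lemma simplexLin_injective {w : Fin (m + 1) → V} (hw : AffineIndependent ℝ w) :
    Function.Injective (simplexLin w) := by
  rw [← LinearMap.ker_eq_bot, LinearMap.ker_eq_bot']
  intro y hy
  have h := affineIndependent_iff.1 hw Finset.univ (Fin.cons (-∑ j, y j) y)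
    (by simp [Fin.sum_univ_succ]) (by
      rw [Fin.sum_univ_succ]
      simp only [Fin.cons_zero, Fin.cons_succ]
      rw [← hy, simplexLin_apply]
      simp only [smul_sub, Finset.sum_sub_distrib, ← Finset.sum_smul]
      module)
  ext j
  simpa using h j.succ (Finset.mem_univ _)

lemma simplexMap_injective {w : Fin (m + 1) → V} (hw : AffineIndependent ℝ w) :
    Function.Injective (simplexMap w) := fun _ _ h => simplexLin_injective hw (add_left_cancel h)

lemma image_simplexMap (w : Fin (m + 1) → V) :
    simplexMap w '' refSimplex m = convexHull ℝ (Set.range w) := by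
  ext x
  rw [convexHull_range_eq_exists_affineCombination, Set.mem_image]
  constructor
  · rintro ⟨y, ⟨h0, h1⟩, rfl⟩
    have hs : ∑ i, (Fin.cons (1 - ∑ j, y j) y : Fin (m + 1) → ℝ) i = 1 := by
      simp [Fin.sum_univ_succ]
    refine ⟨Finset.univ, Fin.cons (1 - ∑ j, y j) y, ?_, hs, ?_⟩
    · intro i _
      refine Fin.cases ?_ (fun j => ?_) i
      · simpa using h1
      · simpa using h0 j
    · rw [Finset.affineCombination_eq_linear_combination _ _ _ hs, Fin.sum_univ_succ,
        simplexMap_eq_sum]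
      simp
  · rintro ⟨s, c, hc, hs, rfl⟩
    classical
    let c' : Fin (m + 1) → ℝ := fun i => if i ∈ s then c i else 0
    have hc' : ∀ i, 0 ≤ c' i := fun i => by
      by_cases h : i ∈ s
      · simpa [c', h] using hc i h
      · simp [c', h]
    have hs' : ∑ i, c' i = 1 := by simpa [c'] using hs
    rw [Fin.sum_univ_succ] at hs'
    refine ⟨fun j => c' j.succ, ⟨fun j => hc' _, ?_⟩, ?_⟩
    · linarith [hc' 0]
    · rw [Finset.affineCombination_eq_linear_combination _ _ _ hs, simplexMap_eq_sum,
        ← hs', add_sub_cancel_right, ← Fin.sum_univ_succ (f := fun i => c' i • w i)]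
      simp [c', ite_smul]

/-- Coordinates of a simplex along the edge from `w 0` to `b`. -/
lemma simplexMap_add_smul_mem_iff {w : Fin (m + 1) → V} {b : V}
    (hw : AffineIndependent ℝ (Fin.snoc w b : Fin (m + 2) → V)) (y : Fin m → ℝ) (t : ℝ) :
    simplexMap w y + t • (b - w 0) ∈ convexHull ℝ (insert b (Set.range w)) ↔
      y ∈ refSimplex m ∧ t ∈ Set.Icc 0 (1 - ∑ j, y j) := by
  have h1 : simplexMap w y + t • (b - w 0) =
      simplexMap (Fin.snoc w b : Fin (m + 2) → V) (Fin.snoc y t) := by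
    rw [simplexMap, simplexMap, simplexLin_apply, simplexLin_apply, Fin.sum_univ_castSucc]
    have h0 : (Fin.snoc w b : Fin (m + 2) → V) 0 = w 0 := Fin.snoc_castSucc (α := fun _ => V) b w 0
    have h2 : ∀ j : Fin m, (Fin.snoc w b : Fin (m + 2) → V) j.castSucc.succ = w j.succ := fun j =>
      Fin.snoc_castSucc (α := fun _ => V) b w j.succ
    have h3 : (Fin.snoc w b : Fin (m + 2) → V) (Fin.last m).succ = b :=
      Fin.snoc_last (α := fun _ => V) b w
    simp only [h0, h2, h3, Fin.snoc_castSucc, Fin.snoc_last, add_assoc]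
  rw [← Fin.range_snoc, h1, ← image_simplexMap, (simplexMap_injective hw).mem_set_image]
  simp only [refSimplex, Set.mem_ofPred_eq, Fin.sum_univ_castSucc, Fin.snoc_castSucc, Fin.snoc_last,
    Set.mem_Icc, Fin.forall_fin_succ']
  constructor
  · rintro ⟨⟨h, h'⟩, h''⟩
    exact ⟨⟨h, by linarith⟩, h', by linarith⟩
  · rintro ⟨⟨h, h'⟩, h'', h3⟩
    exact ⟨⟨h, h''⟩, by linarith⟩

end SimplexMap

lemma hasDerivAt_pev_line {d : ℕ} (q : MvPolynomial (Fin d) ℝ) (x ξ : E d) (t : ℝ) :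
    HasDerivAt (fun t : ℝ => pev q (x + t • ξ))
      (∑ i, ξ i * pev (MvPolynomial.pderiv i q) (x + t • ξ)) t := by
  induction q using MvPolynomial.induction_on with
  | C a => simpa [pev] using hasDerivAt_const t a
  | add q r hq hr =>
    have := hq.add hr
    simp only [pev, map_add, mul_add, Finset.sum_add_distrib] at this ⊢
    exact this
  | mul_X q k hq =>
    have hk : HasDerivAt (fun t : ℝ => x k + t * ξ k) (ξ k) t := by
      simpa using ((hasDerivAt_id t).mul_const (ξ k)).const_add (x k)
    have := hq.mul hk
    simp only [pev, map_mul, Derivation.leibniz, MvPolynomial.pderiv_X, smul_eq_mul, map_add,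
      MvPolynomial.eval_X, PiLp.add_apply, PiLp.smul_apply] at this ⊢
    refine this.congr_deriv ?_
    simp only [mul_add, Finset.sum_add_distrib, Finset.sum_mul]
    rw [add_comm]
    congr 1
    · rw [Finset.sum_eq_single k]
      · simp [mul_comm]
      · intro i _ hi
        simp [hi.symm]
      · simp
    · rw [← Finset.sum_add_distrib]
      exact Finset.sum_congr rfl fun i _ => by ring

variable {n : ℕ}

/-- Fubini's theorem on a simplex with apex `b` over the facet `w`, for the slices parallel to the
edge from `w 0` to `b`. -/
lemma integral_simplex_eq {w : Fin (n + 1) → E (n + 1)} {b ν : E (n + 1)} {J : ℝ}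
    (hw : AffineIndependent ℝ (Fin.snoc w b : Fin (n + 2) → E (n + 1)))
    (hJ : ∀ g : E (n + 1) → ℝ, ∫ x, g x = |⟪b - w 0, ν⟫| * J *
      ∫ z : (Fin n → ℝ) × ℝ, g (w 0 + simplexLin w z.1 + z.2 • (b - w 0)))
    {g : E (n + 1) → ℝ} (hg : Continuous g) :
    ∫ x in convexHull ℝ (insert b (Set.range w)), g x = |⟪b - w 0, ν⟫| * J *
      ∫ y in refSimplex n, ∫ t in (0 : ℝ)..(1 - ∑ j, y j),
        g (simplexMap w y + t • (b - w 0)) := by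
  have hK : IsCompact (convexHull ℝ (insert b (Set.range w))) :=
    ((Set.finite_range w).insert b).isCompact_convexHull ℝ
  rw [← integral_indicator hK.measurableSet, hJ]
  congr 1
  let S : Set ((Fin n → ℝ) × ℝ) := {z | z.1 ∈ refSimplex n ∧ z.2 ∈ Set.Icc 0 (1 - ∑ j, z.1 j)}
  have hS : IsCompact S := by
    refine ((isCompact_refSimplex n).prod (isCompact_Icc (a := (0 : ℝ)) (b := 1))).of_isClosed_subset
      ?_ ?_
    · have h1 : IsClosed {z : (Fin n → ℝ) × ℝ | z.1 ∈ refSimplex n} :=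
        (isCompact_refSimplex n).isClosed.preimage continuous_fst
      have h2 : IsClosed {z : (Fin n → ℝ) × ℝ | 0 ≤ z.2} :=
        isClosed_le continuous_const continuous_snd
      have h3 : IsClosed {z : (Fin n → ℝ) × ℝ | z.2 ≤ 1 - ∑ j, z.1 j} :=
        isClosed_le continuous_snd (by fun_prop)
      exact h1.inter (h2.inter h3)
    · rintro z ⟨h1, h2, h3⟩
      refine ⟨h1, h2, h3.trans ?_⟩
      have := Finset.sum_nonneg fun j (_ : j ∈ Finset.univ) => h1.1 j
      linarith
  let G : (Fin n → ℝ) × ℝ → ℝ := fun z => g (simplexMap w z.1 + z.2 • (b - w 0))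
  have hGc : Continuous G := by
    have := (simplexLin w).continuous_of_finiteDimensional
    unfold G simplexMap
    fun_prop
  have h1 : ∀ z : (Fin n → ℝ) × ℝ, (convexHull ℝ (insert b (Set.range w))).indicator g
      (w 0 + simplexLin w z.1 + z.2 • (b - w 0)) = S.indicator G z := by
    intro z
    have h := simplexMap_add_smul_mem_iff hw z.1 z.2
    rw [simplexMap] at h
    by_cases hz : z ∈ S
    · rw [Set.indicator_of_mem hz, Set.indicator_of_mem (h.2 hz)]; rfl
    · rw [Set.indicator_of_notMem hz, Set.indicator_of_notMem fun h' => hz (h.1 h')]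
  simp only [h1]
  have hint : Integrable (S.indicator G) :=
    (integrable_indicator_iff hS.measurableSet).2 (hGc.continuousOn.integrableOn_compact hS)
  rw [Measure.volume_eq_prod] at hint ⊢
  rw [integral_prod _ hint, ← integral_indicator (isCompact_refSimplex n).measurableSet]
  refine integral_congr_ae (ae_of_all _ fun y => ?_)
  simp only
  by_cases hy : y ∈ refSimplex n
  · rw [Set.indicator_of_mem hy, intervalIntegral.integral_of_le (by linarith [hy.2]),
      ← integral_Icc_eq_integral_Ioc, ← integral_indicator measurableSet_Icc]
    refine integral_congr_ae (ae_of_all _ fun t => ?_)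
    simp only [Set.indicator, S, Set.mem_ofPred_eq, hy, true_and, G]
  · rw [Set.indicator_of_notMem hy, ← integral_zero (G := ℝ) (μ := (volume : Measure ℝ))]
    refine integral_congr_ae (ae_of_all _ fun t => ?_)
    exact Set.indicator_of_notMem (fun h => hy h.1) _

lemma inner_simplexLin {w : Fin (n + 1) → E (n + 1)} {ν : E (n + 1)}
    (h : ∀ j : Fin n, ⟪w j.succ - w 0, ν⟫ = 0) (y : Fin n → ℝ) : ⟪simplexLin w y, ν⟫ = 0 := by
  rw [simplexLin_apply, sum_inner]
  exact Finset.sum_eq_zero fun j _ => by rw [inner_smul_left, h, mul_zero]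

/-- The divergence theorem on a simplex for the constant direction of an edge: only the two facets
opposite to its end points contribute. -/
theorem edge_divergence {w : Fin (n + 1) → E (n + 1)} {b ν ν' : E (n + 1)}
    (hw : AffineIndependent ℝ (Fin.snoc w b : Fin (n + 2) → E (n + 1)))
    (hw' : AffineIndependent ℝ
      (Fin.snoc (Fin.cons b (Fin.tail w)) (w 0) : Fin (n + 2) → E (n + 1)))
    (hν : ‖ν‖ = 1) (hν' : ‖ν'‖ = 1) (hwν : ∀ j : Fin n, ⟪w j.succ - w 0, ν⟫ = 0)
    (hwν' : ∀ j : Fin n, ⟪w j.succ - b, ν'⟫ = 0) (hξ : ⟪b - w 0, ν⟫ ≠ 0)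
    (hξ' : ⟪b - w 0, ν'⟫ ≠ 0) (q : MvPolynomial (Fin (n + 1)) ℝ) :
    ∫ x in convexHull ℝ (insert b (Set.range w)),
        ∑ i, (b - w 0) i * pev (MvPolynomial.pderiv i q) x =
      |⟪b - w 0, ν'⟫| * ∫ x in convexHull ℝ (insert b (w '' {0}ᶜ)), pev q x ∂μHE[n]
      - |⟪b - w 0, ν⟫| * ∫ x in convexHull ℝ (Set.range w), pev q x ∂μHE[n] := by
  set w' : Fin (n + 1) → E (n + 1) := Fin.cons b (Fin.tail w) with hw'def
  have hw0 : AffineIndependent ℝ w := by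
    have := hw.comp_embedding Fin.castSuccEmb
    convert this using 1
    ext1 i
    exact (Fin.snoc_castSucc (α := fun _ => E (n + 1)) b w i).symm
  have hw0' : AffineIndependent ℝ w' := by
    have := hw'.comp_embedding Fin.castSuccEmb
    convert this using 1
    ext1 i
    exact (Fin.snoc_castSucc (α := fun _ => E (n + 1)) (w 0) w' i).symm
  have htail : w '' {0}ᶜ = Set.range (Fin.tail w) := by
    ext x
    constructor
    · rintro ⟨i, hi, rfl⟩
      obtain ⟨j, rfl⟩ := Fin.exists_succ_eq.2 hi
      exact ⟨j, rfl⟩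
    · rintro ⟨j, rfl⟩
      exact ⟨j.succ, Fin.succ_ne_zero j, rfl⟩
  have hr' : Set.range w' = insert b (w '' {0}ᶜ) := by rw [hw'def, Fin.range_cons, htail]
  have hr : insert (w 0) (Set.range w') = insert b (Set.range w) := by
    rw [hr', htail]
    conv_rhs => rw [← Fin.cons_self_tail w, Fin.range_cons]
    exact Set.insert_comm _ _ _
  have h0' : w' 0 = b := rfl
  obtain ⟨J, hJ0, hJF, hJ⟩ := exists_hyperplane_jacobian (simplexLin w) (simplexLin_injective hw0)
    hν (inner_simplexLin hwν) (w 0)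
  obtain ⟨J', hJ0', hJF', hJ'⟩ := exists_hyperplane_jacobian (simplexLin w')
    (simplexLin_injective hw0') hν' (inner_simplexLin hwν') (w' 0)
  have hI := fun g (hg : Continuous g) => integral_simplex_eq hw (hJ _ hξ) (g := g) hg
  have hξ'' : ⟪w 0 - w' 0, ν'⟫ ≠ 0 := by
    rw [h0', ← neg_sub, inner_neg_left]; exact neg_ne_zero.2 hξ'
  have hI' := fun g (hg : Continuous g) => integral_simplex_eq hw' (hJ' _ hξ'') (g := g) hg
  have habs : |⟪w 0 - w' 0, ν'⟫| = |⟪b - w 0, ν'⟫| := by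
    rw [h0', ← neg_sub, inner_neg_left, abs_neg]
  -- both parametrizations compute the volume of the simplex, so their Jacobians agree
  have hJJ : |⟪b - w 0, ν⟫| * J = |⟪b - w 0, ν'⟫| * J' := by
    have e1 := hI (fun _ => 1) continuous_const
    have e2 := hI' (fun _ => 1) continuous_const
    rw [hr, habs, e1] at e2
    refine mul_right_cancel₀ ?_ e2
    have hpos : (0 : ℝ) < |⟪b - w 0, ν⟫| * J *
        ∫ y in refSimplex n, ∫ t in (0 : ℝ)..(1 - ∑ j, y j), (1 : ℝ) := by
      rw [← e1]
      simp only [integral_const, smul_eq_mul, mul_one, measureReal_restrict_apply_univ]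
      have hK : IsCompact (convexHull ℝ (insert b (Set.range w))) :=
        ((Set.finite_range w).insert b).isCompact_convexHull ℝ
      refine ENNReal.toReal_pos ?_ hK.measure_lt_top.ne
      refine (Measure.measure_pos_of_nonempty_interior _ ?_).ne'
      rw [interior_convexHull_nonempty_iff_affineSpan_eq_top, ← Fin.range_snoc]
      exact hw.affineSpan_eq_top_iff_card_eq_finrank_add_one.2 (by simp)
    exact (right_ne_zero_of_mul hpos.ne')
  have hmap : ∀ y, simplexMap w y + (1 - ∑ j, y j) • (b - w 0) = simplexMap w' y := by
    intro y
    rw [simplexMap_eq_sum, simplexMap_eq_sum, h0']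
    have : ∀ j : Fin n, w' j.succ = w j.succ := fun j => rfl
    simp only [this]
    module
  rw [hI _ (by
    refine continuous_finsetSum _ fun i _ => continuous_const.mul (continuous_pev _))]
  have hftc : ∀ y, (∫ t in (0 : ℝ)..(1 - ∑ j, y j), ∑ i, (b - w 0) i *
      pev (MvPolynomial.pderiv i q) (simplexMap w y + t • (b - w 0))) =
      pev q (simplexMap w' y) - pev q (simplexMap w y) := by
    intro y
    rw [intervalIntegral.integral_eq_sub_of_hasDerivAt
      (fun t _ => hasDerivAt_pev_line q (simplexMap w y) (b - w 0) t), hmap]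
    · simp
    · refine Continuous.intervalIntegrable ?_ _ _
      refine continuous_finsetSum _ fun i _ => continuous_const.mul ?_
      exact (continuous_pev _).comp (by fun_prop)
  simp only [hftc]
  have hcont : ∀ v : Fin (n + 1) → E (n + 1), IntegrableOn (fun y => pev q (simplexMap v y))
      (refSimplex n) := fun v => by
    refine ContinuousOn.integrableOn_compact (isCompact_refSimplex n) (Continuous.continuousOn ?_)
    have := (simplexLin v).continuous_of_finiteDimensional
    exact (continuous_pev q).comp (by unfold simplexMap; fun_prop)
  rw [integral_sub (hcont w') (hcont w), ← hr', ← image_simplexMap w', ← image_simplexMap w]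
  have e1 := hJF (refSimplex n) (pev q)
  have e2 := hJF' (refSimplex n) (pev q)
  change ∫ x in simplexMap w '' refSimplex n, _ ∂_ = J * ∫ y in refSimplex n, pev q (simplexMap w y)
    at e1
  change ∫ x in simplexMap w' '' refSimplex n, _ ∂_ =
    J' * ∫ y in refSimplex n, pev q (simplexMap w' y) at e2
  rw [e1, e2, mul_sub, ← mul_assoc, ← mul_assoc, hJJ]

/-! ### Facet normals and the divergence theorem on a simplex -/

lemma centroid_sub_eq {V : Type*} [AddCommGroup V] [Module ℝ V] {S : Finset V} (hS : S.Nonempty)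
    (y : V) : S.centroid ℝ id - y = (S.card : ℝ)⁻¹ • ∑ x ∈ S, (x - y) := by
  have hc : (S.card : ℝ) ≠ 0 := Nat.cast_ne_zero.2 hS.card_pos.ne'
  rw [Finset.centroid_def, Finset.affineCombination_eq_linear_combination _ _ _
    (S.sum_centroidWeights_eq_one_of_nonempty ℝ hS)]
  simp only [Finset.centroidWeights_apply, id, Finset.sum_sub_distrib,
    Finset.sum_const]
  rw [← Finset.smul_sum, smul_sub, ← Nat.cast_smul_eq_nsmul ℝ, smul_smul, inv_mul_cancel₀ hc, one_smul]

lemma inner_normalDir_eq_zero {T F : Finset (E n)} {z : E n}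
    (hz : z ∈ vectorSpan ℝ (F : Set (E n))) : ⟪z, normalDir T F⟫ = 0 :=
  (Submodule.mem_orthogonal _ _).1 (Submodule.starProjection_apply_mem _ _) z hz

lemma inner_normal_eq_zero {T F : Finset (E n)} {z : E n}
    (hz : z ∈ vectorSpan ℝ (F : Set (E n))) : ⟪z, normal T F⟫ = 0 := by
  rw [normal, inner_smul_right, inner_normalDir_eq_zero hz, mul_zero]

section Simplex

open Classical

variable {T : Finset (E (n + 1))} (hT : AffineIndependent ℝ ((↑) : T → E (n + 1)))
  {v y : E (n + 1)}

include hT in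
lemma sub_notMem_vectorSpan_erase (hv : v ∈ T) (hy : y ∈ T.erase v) :
    y - v ∉ vectorSpan ℝ (T.erase v : Set (E (n + 1))) := by
  intro h
  have h1 := hT.notMem_affineSpan_sdiff ⟨v, hv⟩ Set.univ
  apply h1
  have h2 : ((↑) : T → E (n + 1)) '' (Set.univ \ {⟨v, hv⟩}) = (T.erase v : Set (E (n + 1))) := by
    ext x
    simp [and_comm]
  rw [h2]
  have h3 : -(y - v) +ᵥ y ∈ affineSpan ℝ (T.erase v : Set (E (n + 1))) :=
    AffineSubspace.vadd_mem_of_mem_direction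
      (by rw [direction_affineSpan]; exact Submodule.neg_mem _ h) (subset_affineSpan ℝ _ hy)
  simpa using h3

include hT in
/-- The normal of a facet points away from the opposite vertex. -/
lemma inner_normalDir_pos (hv : v ∈ T) (hy : y ∈ T.erase v) :
    0 < ⟪y - v, normalDir T (T.erase v)⟫ := by
  set F := T.erase v with hF
  set W := vectorSpan ℝ (F : Set (E (n + 1))) with hW
  have hxy : ∀ x ∈ F, x - y ∈ W := fun x hx => vsub_mem_vectorSpan ℝ hx hy
  have h1 : F.centroid ℝ id - y ∈ W := by
    rw [centroid_sub_eq ⟨y, hy⟩]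
    exact W.smul_mem _ (W.sum_mem hxy)
  have h2 : F.centroid ℝ id - T.centroid ℝ id - (T.card : ℝ)⁻¹ • (y - v) ∈ W := by
    have e : F.centroid ℝ id - T.centroid ℝ id - (T.card : ℝ)⁻¹ • (y - v) =
        (F.centroid ℝ id - y) - (T.card : ℝ)⁻¹ • ∑ x ∈ F, (x - y) := by
      have := centroid_sub_eq (S := T) ⟨v, hv⟩ y
      rw [← Finset.add_sum_erase T _ hv, ← hF, smul_add] at this
      have h' : T.centroid ℝ id = y + ((T.card : ℝ)⁻¹ • (v - y) +
        (T.card : ℝ)⁻¹ • ∑ x ∈ F, (x - y)) := by rw [← this]; abel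
      rw [h']
      module
    rw [e]
    exact W.sub_mem h1 (W.smul_mem _ (W.sum_mem hxy))
  have h3 : normalDir T F = (T.card : ℝ)⁻¹ • Wᗮ.starProjection (y - v) := by
    have : Wᗮ.starProjection (F.centroid ℝ id - T.centroid ℝ id - (T.card : ℝ)⁻¹ • (y - v)) = 0 := by
      rw [Submodule.starProjection_apply_eq_zero_iff]
      rwa [Submodule.orthogonal_orthogonal]
    rw [map_sub, map_smul, sub_eq_zero] at this
    exact this
  have hcard : (0 : ℝ) < T.card := Nat.cast_pos.2 (Finset.card_pos.2 ⟨v, hv⟩)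
  rw [h3, inner_smul_right]
  refine mul_pos (inv_pos.2 hcard) ?_
  have h4 : ⟪y - v, Wᗮ.starProjection (y - v)⟫ = ‖Wᗮ.starProjection (y - v)‖ ^ 2 := by
    rw [← real_inner_self_eq_norm_sq]
    have : ⟪y - v - Wᗮ.starProjection (y - v), Wᗮ.starProjection (y - v)⟫ = 0 :=
      Submodule.inner_left_of_mem_orthogonal (Submodule.starProjection_apply_mem _ _)
        (Submodule.sub_starProjection_mem_orthogonal _)
    rw [inner_sub_left, sub_eq_zero] at this
    exact this
  rw [h4]
  have h5 : Wᗮ.starProjection (y - v) ≠ 0 := by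
    rw [Ne, Submodule.starProjection_apply_eq_zero_iff, Submodule.orthogonal_orthogonal]
    exact sub_notMem_vectorSpan_erase hT hv hy
  exact pow_pos (norm_pos_iff.2 h5) 2

include hT in
lemma norm_normal_erase (hc : T.card = n + 2) (hv : v ∈ T) : ‖normal T (T.erase v)‖ = 1 := by
  obtain ⟨y, hy⟩ : (T.erase v).Nonempty := by
    rw [← Finset.card_pos, Finset.card_erase_of_mem hv]; omega
  have h := inner_normalDir_pos hT hv hy
  have h0 : normalDir T (T.erase v) ≠ 0 := fun h' => by simp [h'] at h
  rw [normal, norm_smul, norm_inv, norm_norm, inv_mul_cancel₀ (norm_ne_zero_iff.2 h0)]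

include hT in
lemma inner_normal_pos (hv : v ∈ T) (hy : y ∈ T.erase v) :
    0 < ⟪y - v, normal T (T.erase v)⟫ := by
  have h := inner_normalDir_pos hT hv hy
  have h0 : normalDir T (T.erase v) ≠ 0 := fun h' => by simp [h'] at h
  rw [normal, inner_smul_right]
  exact mul_pos (inv_pos.2 (norm_pos_iff.2 h0)) h

include hT in
lemma finrank_orthogonal_vectorSpan_erase (hc : T.card = n + 2) (hv : v ∈ T) :
    Module.finrank ℝ (vectorSpan ℝ (T.erase v : Set (E (n + 1))))ᗮ = 1 := by
  have hF : AffineIndependent ℝ ((↑) : T.erase v → E (n + 1)) :=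
    hT.mono (s := T.erase v) (by simp)
  have h1 := hF.finrank_vectorSpan (n := n) (by
    rw [Fintype.card_coe, Finset.card_erase_of_mem hv]; omega)
  rw [Subtype.range_coe_subtype, Finset.setOfPred_mem] at h1
  have := (vectorSpan ℝ (T.erase v : Set (E (n + 1)))).finrank_add_finrank_orthogonal
  rw [h1] at this
  simp only [finrank_euclideanSpace, Fintype.card_fin] at this
  omega

include hT in
lemma vectorSpan_simplex_eq_top (hc : T.card = n + 2) :
    vectorSpan ℝ (T : Set (E (n + 1))) = ⊤ := by
  have h1 := hT.finrank_vectorSpan (n := n + 1) (by rw [Fintype.card_coe]; omega)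
  rw [Subtype.range_coe_subtype, Finset.setOfPred_mem] at h1
  exact Submodule.eq_top_of_finrank_eq (by rw [h1]; simp)

include hT in
lemma cellVol_pos (hc : T.card = n + 2) : 0 < cellVol T := by
  refine ENNReal.toReal_pos ?_ (isCompact_hull T).measure_lt_top.ne
  refine (Measure.measure_pos_of_nonempty_interior _ ?_).ne'
  rw [interior_convexHull_nonempty_iff_affineSpan_eq_top]
  have := hT.affineSpan_eq_top_iff_card_eq_finrank_add_one.2
    (by rw [Fintype.card_coe, hc]; simp)
  rwa [Subtype.range_coe_subtype, Finset.setOfPred_mem] at this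

/-- A simplex can be enumerated so that two prescribed vertices come first and last. -/
lemma exists_enumeration (hc : T.card = n + 2) {a b : E (n + 1)} (ha : a ∈ T) (hb : b ∈ T)
    (hab : a ≠ b) : ∃ u : Fin n → E (n + 1), Function.Injective u ∧
      Set.range u = ((T.erase a).erase b : Set (E (n + 1))) := by
  have hcard : ((T.erase a).erase b).card = n := by
    rw [Finset.card_erase_of_mem (Finset.mem_erase.2 ⟨hab.symm, hb⟩),
      Finset.card_erase_of_mem ha]
    omega
  let e := ((T.erase a).erase b).equivFinOfCardEq hcard
  refine ⟨fun i => e.symm i, Subtype.val_injective.comp e.symm.injective, ?_⟩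
  change Set.range (Subtype.val ∘ e.symm) = _
  rw [e.symm.surjective.range_comp, Subtype.range_coe_subtype]
  exact Finset.setOfPred_mem

include hT in
lemma affineIndependent_snoc_cons {a b : E (n + 1)} (ha : a ∈ T)
    (hb : b ∈ T) (hab : a ≠ b) {u : Fin n → E (n + 1)} (hu : Function.Injective u)
    (hr : Set.range u = ((T.erase a).erase b : Set (E (n + 1)))) :
    AffineIndependent ℝ (Fin.snoc (Fin.cons a u) b : Fin (n + 2) → E (n + 1)) := by
  have hmem : ∀ i, u i ∈ (T.erase a).erase b := fun i => by
    rw [← Finset.mem_coe, ← hr]; exact ⟨i, rfl⟩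
  have hinj : Function.Injective (Fin.snoc (Fin.cons a u) b : Fin (n + 2) → E (n + 1)) := by
    rw [Fin.snoc_injective_iff, Fin.cons_injective_iff, Fin.range_cons, hr]
    refine ⟨⟨?_, hu⟩, ?_⟩
    · simp
    · simp [hab.symm]
  refine AffineIndependent.of_set_of_injective ?_ hinj
  refine hT.mono (s := Set.range _) (t := (T : Set (E (n + 1)))) ?_
  rw [Fin.range_snoc, Fin.range_cons, hr]
  intro x hx
  simp only [Set.mem_insert_iff] at hx
  rcases hx with rfl | rfl | hx
  · exact hb
  · exact ha
  · exact Finset.mem_of_mem_erase (Finset.mem_of_mem_erase hx)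

include hT in
lemma edge_divergence_cell (hc : T.card = n + 2) {a b : E (n + 1)} (ha : a ∈ T) (hb : b ∈ T)
    (q : MvPolynomial (Fin (n + 1)) ℝ) :
    cellInt T (fun x => ∑ i, (b - a) i * pev (MvPolynomial.pderiv i q) x) =
      ∑ v ∈ T, ⟪b - a, normal T (T.erase v)⟫ * facetInt (T.erase v) (pev q) := by
  by_cases hab : a = b
  · subst hab
    simp [cellInt]
  obtain ⟨u, hu, hr⟩ := exists_enumeration hc ha hb hab
  have hr' : Set.range u = ((T.erase b).erase a : Set (E (n + 1))) := by
    rw [hr, Finset.erase_right_comm]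
  have hmem : ∀ i, u i ∈ T ∧ u i ≠ a ∧ u i ≠ b := fun i => by
    have : u i ∈ (T.erase a).erase b := by
      rw [← Finset.mem_coe, ← hr]; exact ⟨i, rfl⟩
    simp only [Finset.mem_erase] at this
    tauto
  have haE : a ∈ T.erase b := Finset.mem_erase.2 ⟨hab, ha⟩
  have hbE : b ∈ T.erase a := Finset.mem_erase.2 ⟨Ne.symm hab, hb⟩
  have p1 := inner_normal_pos hT hb haE
  have p2 := inner_normal_pos hT ha hbE
  rw [← neg_sub, inner_neg_left] at p1
  have hFb : Set.range (Fin.cons a u : Fin (n + 1) → E (n + 1)) = (T.erase b : Set _) := by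
    rw [Fin.range_cons, hr', ← Finset.coe_insert, Finset.insert_erase haE]
  have himg : (Fin.cons a u : Fin (n + 1) → E (n + 1)) '' {0}ᶜ = Set.range u := by
    ext x
    constructor
    · rintro ⟨i, hi, rfl⟩
      obtain ⟨j, rfl⟩ := Fin.exists_succ_eq.2 hi
      exact ⟨j, rfl⟩
    · rintro ⟨j, rfl⟩
      exact ⟨j.succ, Fin.succ_ne_zero j, rfl⟩
  have hFa : insert b ((Fin.cons a u : Fin (n + 1) → E (n + 1)) '' {0}ᶜ) = (T.erase a : Set _) := by
    rw [himg, hr, ← Finset.coe_insert, Finset.insert_erase hbE]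
  have hTT : insert b (Set.range (Fin.cons a u : Fin (n + 1) → E (n + 1))) = (T : Set _) := by
    rw [hFb, ← Finset.coe_insert, Finset.insert_erase hb]
  have key := edge_divergence (w := Fin.cons a u) (b := b) (ν := normal T (T.erase b))
    (ν' := normal T (T.erase a)) (affineIndependent_snoc_cons hT ha hb hab hu hr)
    (affineIndependent_snoc_cons hT hb ha (Ne.symm hab) hu hr') (norm_normal_erase hT hc hb)
    (norm_normal_erase hT hc ha)
    (fun j => inner_normal_eq_zero (vsub_mem_vectorSpan ℝ
      (Finset.mem_erase.2 ⟨(hmem j).2.2, (hmem j).1⟩) haE))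
    (fun j => inner_normal_eq_zero (vsub_mem_vectorSpan ℝ
      (Finset.mem_erase.2 ⟨(hmem j).2.1, (hmem j).1⟩) hbE))
    (by simp only [Fin.cons_zero]; linarith) (by simp only [Fin.cons_zero]; linarith) q
  simp only [Fin.cons_zero] at key
  rw [hTT, hFa, hFb, abs_of_pos p2, abs_of_neg (by linarith)] at key
  rw [cellInt, hull, key]
  rw [← Finset.add_sum_erase T _ ha, ← Finset.add_sum_erase _ _ hbE, Finset.sum_eq_zero]
  · simp only [facetInt, hull]
    change _ * (∫ x in _, pev q x ∂μHE[n]) - _ * (∫ x in _, pev q x ∂μHE[n]) =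
      _ * (∫ x in _, pev q x ∂μHE[n]) + (_ * (∫ x in _, pev q x ∂μHE[n]) + 0)
    ring
  · intro v hv
    simp only [Finset.mem_erase] at hv
    rw [inner_normal_eq_zero, zero_mul]
    exact vsub_mem_vectorSpan ℝ (Finset.mem_erase.2 ⟨hv.1.symm, hb⟩)
      (Finset.mem_erase.2 ⟨hv.2.1.symm, ha⟩)

lemma integrableOn_hull_of_continuous (S : Finset (E n)) {f : E n → ℝ} (hf : Continuous f) :
    IntegrableOn f (hull S) := hf.continuousOn.integrableOn_compact (isCompact_hull S)

include hT in
/-- The divergence theorem on a simplex, for polynomials. -/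
theorem cellInt_pderiv (hc : T.card = n + 2) (i : Fin (n + 1))
    (q : MvPolynomial (Fin (n + 1)) ℝ) :
    cellInt T (pev (MvPolynomial.pderiv i q)) =
      ∑ v ∈ T, normal T (T.erase v) i * facetInt (T.erase v) (pev q) := by
  have hlin : ∀ ξ : E (n + 1), cellInt T (fun x => ∑ i, ξ i * pev (MvPolynomial.pderiv i q) x) =
      ∑ i, ξ i * cellInt T (pev (MvPolynomial.pderiv i q)) := fun ξ => by
    simp only [cellInt]
    rw [integral_finsetSum (f := fun i x => ξ i * pev (MvPolynomial.pderiv i q) x) _ fun i _ =>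
      integrableOn_hull_of_continuous T (continuous_const.mul (continuous_pev _))]
    exact Finset.sum_congr rfl fun i _ => integral_const_mul _ _
  obtain ⟨a, ha⟩ : T.Nonempty := by rw [← Finset.card_pos]; omega
  -- the identity is linear in the direction, and the edges at one vertex span the whole space
  have key : ∀ ξ : E (n + 1), ∑ i, ξ i * cellInt T (pev (MvPolynomial.pderiv i q)) =
      ∑ v ∈ T, ⟪ξ, normal T (T.erase v)⟫ * facetInt (T.erase v) (pev q) := by
    intro ξ
    have hξ : ξ ∈ Submodule.span ℝ ((fun b => b - a) '' (T : Set (E (n + 1)))) := by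
      have := vectorSpan_eq_span_vsub_set_right ℝ (s := (T : Set (E (n + 1)))) ha
      simp only [vsub_eq_sub] at this
      rw [← this, vectorSpan_simplex_eq_top hT hc]
      trivial
    induction hξ using Submodule.span_induction with
    | mem x hx =>
      obtain ⟨b, hb, rfl⟩ := hx
      rw [← hlin]
      exact edge_divergence_cell hT hc ha hb q
    | zero => simp
    | add x y _ _ hx hy =>
      simp only [PiLp.add_apply, add_mul, Finset.sum_add_distrib, inner_add_left, hx, hy]
    | smul c x _ hx =>
      simp only [PiLp.smul_apply, smul_eq_mul, inner_smul_left, mul_assoc, ← Finset.mul_sum, hx]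
      simp
  have := key (EuclideanSpace.single i 1)
  simp only [EuclideanSpace.inner_single_left] at this
  simpa [Pi.single_apply] using this

end Simplex

variable {Ω : Set (E (n + 1))}

/-! ### Cells and facets of a mesh -/

lemma add_smul_sum_mem_hull {m : ℕ} {S : Finset (E m)} {y : E m} (hy : y ∈ S) {c : E m → ℝ}
    (hc : ∀ x ∈ S, 0 ≤ c x) {ε : ℝ} (hε : 0 ≤ ε) (h1 : ε * ∑ x ∈ S, c x ≤ 1) :
    y + ε • ∑ x ∈ S, c x • (x - y) ∈ hull S := by
  classical
  have e : y + ε • ∑ x ∈ S, c x • (x - y) =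
      ∑ x ∈ S, (ε * c x + if x = y then 1 - ε * ∑ z ∈ S, c z else 0) • x := by
    simp only [add_smul, Finset.sum_add_distrib, ite_smul, zero_smul, Finset.sum_ite_eq', hy,
      if_true, smul_sub, Finset.sum_sub_distrib, mul_smul, ← Finset.smul_sum, ← Finset.sum_smul]
    module
  rw [e]
  refine (convex_convexHull ℝ _).sum_mem (fun x hx => ?_) ?_ fun x hx => subset_convexHull ℝ _ hx
  · refine add_nonneg (mul_nonneg hε (hc x hx)) ?_
    split_ifs
    · linarith
    · exact le_rfl
  · simp [Finset.sum_add_distrib, hy, ← Finset.mul_sum]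

lemma mem_facetsOf {𝒯 : Mesh Ω} {T : 𝒯.Cell} {F : 𝒯.Facet} :
    F ∈ 𝒯.facetsOf T ↔ F.1 ⊆ T.1 := by simp [Mesh.facetsOf]

open Classical in
/-- The facet of a cell that is opposite to a vertex. -/
def oppositeFacet {𝒯 : Mesh Ω} (T : 𝒯.Cell) (v : T.1) : 𝒯.Facet :=
  ⟨T.1.erase v, by
    have hc : (T.1.erase v).card = n + 1 := by
      rw [Finset.card_erase_of_mem v.2, T.2.2]; rfl
    refine ⟨?_, hc⟩
    have := (𝒯.K.isRelLowerSet_faces T.2.1).2 (Finset.erase_subset v.1 T.1)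
    exact this (Finset.card_pos.1 (by omega))⟩

open Classical in
lemma exists_eq_erase {𝒯 : Mesh Ω} {T : 𝒯.Cell} {F : 𝒯.Facet} (h : F ∈ 𝒯.facetsOf T) :
    ∃ v ∈ T.1, F.1 = T.1.erase v := by
  rw [mem_facetsOf] at h
  have h1 : (T.1 \ F.1).card = 1 := by
    rw [Finset.card_sdiff_of_subset h, T.2.2, F.2.2]; omega
  obtain ⟨v, hv⟩ := Finset.card_eq_one.1 h1
  have hvm : v ∈ T.1 \ F.1 := by rw [hv]; exact Finset.mem_singleton_self v
  refine ⟨v, (Finset.mem_sdiff.1 hvm).1, ?_⟩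
  rw [← Finset.sdiff_singleton_eq_erase, ← hv, Finset.sdiff_sdiff_eq_self h]

open Classical in
lemma facetsOf_eq_image {𝒯 : Mesh Ω} (T : 𝒯.Cell) :
    𝒯.facetsOf T = Finset.univ.image (oppositeFacet T) := by
  ext F
  rw [Finset.mem_image]
  constructor
  · intro h
    obtain ⟨v, hv, e⟩ := exists_eq_erase h
    exact ⟨⟨v, hv⟩, Finset.mem_univ _, Subtype.ext e.symm⟩
  · rintro ⟨v, _, rfl⟩
    exact mem_facetsOf.2 (Finset.erase_subset _ _)

lemma oppositeFacet_injective {𝒯 : Mesh Ω} (T : 𝒯.Cell) : Function.Injective (oppositeFacet T) := by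
  classical
  intro v w h
  have h1 : T.1.erase v.1 = T.1.erase w.1 := congrArg Subtype.val h
  exact Subtype.ext (Finset.erase_injOn T.1 v.2 w.2 h1)

lemma card_facetsOf {𝒯 : Mesh Ω} (T : 𝒯.Cell) : (𝒯.facetsOf T).card = n + 2 := by
  classical
  rw [facetsOf_eq_image, Finset.card_image_of_injective _ (oppositeFacet_injective T),
    Finset.card_univ, Fintype.card_coe, T.2.2]

open Classical in
lemma sum_facetsOf {𝒯 : Mesh Ω} (T : 𝒯.Cell) (f : Finset (E (n + 1)) → ℝ) :
    ∑ F ∈ 𝒯.facetsOf T, f F.1 = ∑ v ∈ T.1, f (T.1.erase v) := by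
  rw [facetsOf_eq_image, Finset.sum_image fun v _ w _ h => oppositeFacet_injective T h]
  exact Finset.sum_coe_sort T.1 fun v => f (T.1.erase v)

lemma facetsOf_nonempty {𝒯 : Mesh Ω} (T : 𝒯.Cell) : (𝒯.facetsOf T).Nonempty := by
  rw [← Finset.card_pos, card_facetsOf]; omega

lemma exists_cell {𝒯 : Mesh Ω} (F : 𝒯.Facet) : ∃ T : 𝒯.Cell, F ∈ 𝒯.facetsOf T := by
  obtain ⟨T, hT, hF, hc⟩ := 𝒯.pure F.1 F.2.1
  exact ⟨⟨T, hT, hc⟩, mem_facetsOf.2 hF⟩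

lemma vertices_nonempty {𝒯 : Mesh Ω} (F : 𝒯.Facet) : F.1.Nonempty := by
  rw [← Finset.card_pos, F.2.2]; omega

lemma norm_normal {𝒯 : Mesh Ω} {T : 𝒯.Cell} {F : 𝒯.Facet} (h : F ∈ 𝒯.facetsOf T) :
    ‖normal T.1 F.1‖ = 1 := by
  obtain ⟨v, hv, e⟩ := exists_eq_erase h
  rw [e]
  exact norm_normal_erase (𝒯.K.indep T.2.1) T.2.2 hv

/-- The divergence theorem on a cell, for polynomials. -/
theorem cellInt_pderiv_eq_sum_facetsOf {𝒯 : Mesh Ω} (T : 𝒯.Cell) (i : Fin (n + 1))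
    (q : MvPolynomial (Fin (n + 1)) ℝ) :
    cellInt T.1 (pev (MvPolynomial.pderiv i q)) =
      ∑ F ∈ 𝒯.facetsOf T, normal T.1 F.1 i * facetInt F.1 (pev q) := by
  rw [cellInt_pderiv (𝒯.K.indep T.2.1) T.2.2,
    sum_facetsOf T fun F => normal T.1 F i * facetInt F (pev q)]

/-- Two different cells with a common facet lie on different sides of it: otherwise a small
displacement of a point of the facet would lie in both cells. -/
lemma not_same_side {𝒯 : Mesh Ω} {T T' : 𝒯.Cell} (hne : T ≠ T') {F : Finset (E (n + 1))}
    {v v' y ν : E (n + 1)} (hv : v ∉ F) (hv' : v' ∉ F) [DecidableEq (E (n + 1))]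
    (hT : T.1 = insert v F) (hT' : T'.1 = insert v' F) (hy : y ∈ F)
    (hF : ∀ x ∈ F, ⟪x - y, ν⟫ = 0) (h : 0 < ⟪y - v, ν⟫) (h' : 0 < ⟪y - v', ν⟫) : False := by
  have hind' := 𝒯.K.indep T'.2.1
  have hspan : v - y ∈ Submodule.span ℝ ((fun b => b - y) '' (T'.1 : Set (E (n + 1)))) := by
    have := vectorSpan_eq_span_vsub_set_right ℝ (s := (T'.1 : Set (E (n + 1)))) (p := y)
      (by rw [hT']; exact Finset.mem_insert_of_mem hy)
    simp only [vsub_eq_sub] at this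
    rw [← this, vectorSpan_simplex_eq_top hind' T'.2.2]
    trivial
  obtain ⟨c₀, hc₀⟩ := (Submodule.mem_span_image_finset_iff_exists_fun ℝ).1 hspan
  obtain ⟨c, hc⟩ : ∃ c : E (n + 1) → ℝ, ∑ x ∈ T'.1, c x • (x - y) = v - y := by
    refine ⟨fun x => if hx : x ∈ T'.1 then c₀ ⟨x, hx⟩ else 0, ?_⟩
    rw [← hc₀, ← Finset.sum_coe_sort]
    simp
  rw [hT', Finset.sum_insert hv'] at hc
  have hs : 0 < c v' := by
    have := congrArg (fun z => ⟪z, ν⟫) hc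
    simp only [inner_add_left, inner_smul_left, sum_inner] at this
    rw [Finset.sum_eq_zero fun x hx => by rw [hF x hx, mul_zero], ← neg_sub y v', ← neg_sub y v,
      inner_neg_left, inner_neg_left] at this
    simp only [conj_trivial, add_zero] at this
    by_contra hcon
    nlinarith
  -- Moving from `y` by a small multiple of `v - y + B • ∑ x ∈ F, (x - y)` stays in both cells: the
  -- shift by `B` makes the coefficients of this vector with respect to `T'` nonnegative.
  set B := ∑ x ∈ F, |c x| with hB
  have hB0 : 0 ≤ B := Finset.sum_nonneg fun x _ => abs_nonneg _
  have hcB : ∀ x ∈ F, 0 ≤ c x + B := fun x hx => by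
    have := Finset.single_le_sum (f := fun x => |c x|) (fun x _ => abs_nonneg _) hx
    have := neg_abs_le (c x)
    linarith
  let b : E (n + 1) → ℝ := fun x => if x = v then 1 else B
  let b' : E (n + 1) → ℝ := fun x => if x = v' then c v' else c x + B
  have hb : ∀ x ∈ T.1, 0 ≤ b x := fun x _ => by
    simp only [b]; split_ifs <;> linarith
  have hb' : ∀ x ∈ T'.1, 0 ≤ b' x := fun x hx => by
    simp only [b']
    split_ifs with hx'
    · exact hs.le
    · refine hcB x ?_
      rw [hT', Finset.mem_insert] at hx
      exact hx.resolve_left hx'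
  set ε : ℝ := (1 + ∑ x ∈ T.1, b x + ∑ x ∈ T'.1, b' x)⁻¹ with hε
  have hsb := Finset.sum_nonneg hb
  have hsb' := Finset.sum_nonneg hb'
  have hεpos : 0 < ε := inv_pos.2 (by linarith)
  have m1 := add_smul_sum_mem_hull (S := T.1) (y := y) (by rw [hT]; exact Finset.mem_insert_of_mem hy)
    hb hεpos.le (by rw [hε, inv_mul_le_iff₀ (by linarith)]; linarith)
  have m2 := add_smul_sum_mem_hull (S := T'.1) (y := y)
    (by rw [hT']; exact Finset.mem_insert_of_mem hy)
    hb' hεpos.le (by rw [hε, inv_mul_le_iff₀ (by linarith)]; linarith)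
  have e1 : ∑ x ∈ T.1, b x • (x - y) = (v - y) + B • ∑ x ∈ F, (x - y) := by
    rw [hT, Finset.sum_insert hv, Finset.smul_sum]
    congr 1
    · simp [b]
    · refine Finset.sum_congr rfl fun x hx => ?_
      have : x ≠ v := fun h => hv (h ▸ hx)
      simp [b, this]
  have e2 : ∑ x ∈ T'.1, b' x • (x - y) = (v - y) + B • ∑ x ∈ F, (x - y) := by
    rw [hT', Finset.sum_insert hv', Finset.smul_sum, ← hc, add_assoc, ← Finset.sum_add_distrib]
    congr 1
    · simp [b']
    · refine Finset.sum_congr rfl fun x hx => ?_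
      have : x ≠ v' := fun h => hv' (h ▸ hx)
      simp [b', this, add_smul]
  rw [e1] at m1
  rw [e2] at m2
  have m3 := 𝒯.K.inter_subset_convexHull T.2.1 T'.2.1 ⟨m1, m2⟩
  have hvv : v ≠ v' := by
    rintro rfl
    exact hne (Subtype.ext (hT.trans hT'.symm))
  have hsub : (T.1 : Set (E (n + 1))) ∩ T'.1 ⊆ {p | ⟪p - y, ν⟫ = 0} := by
    rintro x ⟨hx, hx'⟩
    rw [hT, Finset.coe_insert] at hx
    rw [hT', Finset.coe_insert] at hx'
    rcases hx with rfl | hx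
    · rcases hx' with hx' | hx'
      · exact absurd hx' hvv
      · exact absurd hx' hv
    · exact hF x hx
  have hconv : Convex ℝ {p : E (n + 1) | ⟪p - y, ν⟫ = 0} := by
    rintro x hx z hz s t _ _ hst
    have : s • x + t • z - y = s • (x - y) + t • (z - y) := by
      have : y = (s + t) • y := by rw [hst, one_smul]
      conv_lhs => rw [this]
      module
    simp only [Set.mem_ofPred_eq] at hx hz ⊢
    rw [this, inner_add_left, inner_smul_left, inner_smul_left, hx, hz]
    simp
  have m4 := convexHull_min hsub hconv m3
  simp only [Set.mem_ofPred_eq, add_sub_cancel_left, inner_smul_left, inner_add_left, sum_inner] at m4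
  rw [Finset.sum_eq_zero hF, ← neg_sub, inner_neg_left] at m4
  simp only [conj_trivial, mul_zero, add_zero, mul_neg, neg_eq_zero, mul_eq_zero] at m4
  rcases m4 with m4 | m4
  · exact hεpos.ne' m4
  · exact h.ne' m4

/-- The outward normals of two cells on a common facet are opposite. -/
theorem normal_eq_neg {𝒯 : Mesh Ω} {T T' : 𝒯.Cell} (hne : T ≠ T') {F : 𝒯.Facet}
    (h : F ∈ 𝒯.facetsOf T) (h' : F ∈ 𝒯.facetsOf T') : normal T.1 F.1 = -normal T'.1 F.1 := by
  classical
  have n1 := norm_normal h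
  have n2 := norm_normal h'
  have o1 : normal T.1 F.1 ∈ (vectorSpan ℝ (F.1 : Set (E (n + 1))))ᗮ :=
    (Submodule.mem_orthogonal _ _).2 fun z hz => inner_normal_eq_zero hz
  have o2 : normal T'.1 F.1 ∈ (vectorSpan ℝ (F.1 : Set (E (n + 1))))ᗮ :=
    (Submodule.mem_orthogonal _ _).2 fun z hz => inner_normal_eq_zero hz
  obtain ⟨v, hv, e⟩ := exists_eq_erase h
  obtain ⟨v', hv', e'⟩ := exists_eq_erase h'
  obtain ⟨y, hy⟩ := vertices_nonempty F
  have p1 : 0 < ⟪y - v, normal T.1 F.1⟫ := by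
    rw [e] at hy ⊢
    exact inner_normal_pos (𝒯.K.indep T.2.1) hv hy
  have p2 : 0 < ⟪y - v', normal T'.1 F.1⟫ := by
    rw [e'] at hy ⊢
    exact inner_normal_pos (𝒯.K.indep T'.2.1) hv' hy
  have hfr := finrank_orthogonal_vectorSpan_erase (𝒯.K.indep T.2.1) T.2.2 hv
  rw [← e] at hfr
  have hn0 : (⟨_, o2⟩ : (vectorSpan ℝ (F.1 : Set (E (n + 1))))ᗮ) ≠ 0 := by
    rw [Ne, Submodule.mk_eq_zero]
    intro h0
    simp [h0] at n2
  obtain ⟨c, hc⟩ := (finrank_eq_one_iff_of_nonzero' _ hn0).1 hfr ⟨_, o1⟩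
  have hc' : c • normal T'.1 F.1 = normal T.1 F.1 := congrArg Subtype.val hc
  have hcabs : |c| = 1 := by
    rw [← hc', norm_smul, n2, mul_one] at n1
    exact n1
  rcases (abs_eq zero_le_one).1 hcabs with rfl | rfl
  · exfalso
    rw [one_smul] at hc'
    rw [hc'] at p2
    refine not_same_side hne (F := F.1) (v := v) (v' := v') (y := y) (ν := normal T.1 F.1)
      (by rw [e]; exact Finset.notMem_erase _ _) (by rw [e']; exact Finset.notMem_erase _ _)
      (by rw [e, Finset.insert_erase hv]) (by rw [e', Finset.insert_erase hv']) hy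
      (fun x hx => inner_normal_eq_zero (vsub_mem_vectorSpan ℝ hx hy)) p1 p2
  · rw [← hc']; simp

/-- A facet belongs to at most two cells. -/
theorem eq_or_eq_of_facet {𝒯 : Mesh Ω} {T T' T'' : 𝒯.Cell} {F : 𝒯.Facet} (hne : T ≠ T')
    (h : F ∈ 𝒯.facetsOf T) (h' : F ∈ 𝒯.facetsOf T') (h'' : F ∈ 𝒯.facetsOf T'') :
    T'' = T ∨ T'' = T' := by
  by_contra! hcon
  have e1 := normal_eq_neg hne h h'
  have e2 := normal_eq_neg hcon.1 h'' h
  have e3 := normal_eq_neg hcon.2 h'' h'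
  have hn := norm_normal h''
  have : normal T''.1 F.1 = 0 := by
    have h4 : normal T''.1 F.1 = -normal T''.1 F.1 := by
      rw [e1, neg_neg, ← neg_neg (normal T'.1 F.1), ← e3] at e2
      exact e2
    have h5 : (2 : ℝ) • normal T''.1 F.1 = 0 := by
      rw [two_smul]
      nth_rewrite 1 [h4]
      exact neg_add_cancel _
    exact (smul_eq_zero.1 h5).resolve_left two_ne_zero
  rw [this] at hn
  simp at hn

/-- A facet that is not a Dirichlet facet belongs to exactly two cells, with opposite normals. -/
lemma sum_normal_eq_zero {𝒯 : Mesh Ω} {F : 𝒯.Facet} (hF : ¬ 𝒯.IsDirichlet F)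
    [DecidablePred fun T : 𝒯.Cell => F ∈ 𝒯.facetsOf T] (i : Fin (n + 1)) :
    ∑ T : 𝒯.Cell with F ∈ 𝒯.facetsOf T, normal T.1 F.1 i = 0 := by
  classical
  obtain ⟨T, hT⟩ := exists_cell F
  obtain ⟨T', hT'K, hT'c, hne, hFT'⟩ :=
    (𝒯.regular T.1 T.2.1 T.2.2 F.1 (mem_facetsOf.1 hT) F.2.2).resolve_right hF
  let T₂ : 𝒯.Cell := ⟨T', hT'K, hT'c⟩
  have hT₂ : F ∈ 𝒯.facetsOf T₂ := mem_facetsOf.2 hFT'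
  have hne' : T ≠ T₂ := fun h => hne (congrArg Subtype.val h).symm
  have hset : (Finset.univ.filter fun T : 𝒯.Cell => F ∈ 𝒯.facetsOf T) = {T, T₂} := by
    ext S
    simp only [Finset.mem_filter, Finset.mem_univ, true_and, Finset.mem_insert,
      Finset.mem_singleton]
    constructor
    · exact fun hS => eq_or_eq_of_facet hne' hT hT₂ hS
    · rintro (rfl | rfl)
      · exact hT
      · exact hT₂
  rw [hset, Finset.sum_pair hne', normal_eq_neg hne' hT hT₂]
  simp

/-! ### Integrals of polynomials over cells and facets -/

@[simp] lemma pev_add {m : ℕ} (q r : MvPolynomial (Fin m) ℝ) (x : E m) :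
    pev (q + r) x = pev q x + pev r x := map_add _ _ _
@[simp] lemma pev_sub {m : ℕ} (q r : MvPolynomial (Fin m) ℝ) (x : E m) :
    pev (q - r) x = pev q x - pev r x := map_sub _ _ _
@[simp] lemma pev_mul {m : ℕ} (q r : MvPolynomial (Fin m) ℝ) (x : E m) :
    pev (q * r) x = pev q x * pev r x := map_mul _ _ _
@[simp] lemma pev_smul {m : ℕ} (c : ℝ) (q : MvPolynomial (Fin m) ℝ) (x : E m) :
    pev (c • q) x = c * pev q x := MvPolynomial.smul_eval _ _ _
@[simp] lemma pev_C {m : ℕ} (c : ℝ) (x : E m) : pev (MvPolynomial.C c) x = c :=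
  MvPolynomial.eval_C _
@[simp] lemma pev_zero {m : ℕ} (x : E m) : pev 0 x = 0 := map_zero _
@[simp] lemma pev_sum {m : ℕ} {κ : Type*} (s : Finset κ) (q : κ → MvPolynomial (Fin m) ℝ)
    (x : E m) : pev (∑ i ∈ s, q i) x = ∑ i ∈ s, pev (q i) x := map_sum _ _ _

/-- Integration of polynomials over a simplex. -/
def cellL {m : ℕ} (T : Finset (E m)) : MvPolynomial (Fin m) ℝ →ₗ[ℝ] ℝ where
  toFun q := cellInt T (pev q)
  map_add' q r := by
    simp only [cellInt, pev_add]
    exact integral_add ((continuous_pev q).continuousOn.integrableOn_compact (isCompact_hull T))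
      ((continuous_pev r).continuousOn.integrableOn_compact (isCompact_hull T))
  map_smul' c q := by
    simp only [cellInt, pev_smul, RingHom.id_apply, smul_eq_mul]
    exact integral_const_mul _ _

lemma integrableOn_facet {𝒯 : Mesh Ω} (F : 𝒯.Facet) {f : E (n + 1) → ℝ} (hf : Continuous f) :
    IntegrableOn f (hull F.1) μHE[n + 1 - 1] := by
  obtain ⟨C, hC⟩ := (isCompact_hull F.1).exists_bound_of_continuousOn hf.continuousOn
  refine IntegrableOn.of_bound (facet_measure_lt_top F) hf.aestronglyMeasurable C ?_
  exact (ae_restrict_iff' (isCompact_hull F.1).measurableSet).2 (ae_of_all _ hC)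

/-- Integration of polynomials over a facet of a mesh. -/
def facetL {𝒯 : Mesh Ω} (F : 𝒯.Facet) : MvPolynomial (Fin (n + 1)) ℝ →ₗ[ℝ] ℝ where
  toFun q := facetInt F.1 (pev q)
  map_add' q r := by
    simp only [facetInt, pev_add]
    exact integral_add (integrableOn_facet F (continuous_pev q))
      (integrableOn_facet F (continuous_pev r))
  map_smul' c q := by
    simp only [facetInt, pev_smul, RingHom.id_apply, smul_eq_mul]
    exact integral_const_mul _ _

lemma facetInt_congr {F : Finset (E n)} {f g : E n → ℝ} (h : Set.EqOn f g (hull F)) :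
    facetInt F f = facetInt F g :=
  setIntegral_congr_fun (isCompact_hull F).measurableSet h

lemma facetInt_eq_facetL {𝒯 : Mesh Ω} {F : 𝒯.Facet} {f : E (n + 1) → ℝ}
    {q : MvPolynomial (Fin (n + 1)) ℝ} (h : Set.EqOn f (pev q) (hull F.1)) :
    facetInt F.1 f = facetL F q := facetInt_congr h

lemma facetL_congr {𝒯 : Mesh Ω} {F : 𝒯.Facet} {q r : MvPolynomial (Fin (n + 1)) ℝ}
    (h : Set.EqOn (pev q) (pev r) (hull F.1)) : facetL F q = facetL F r := facetInt_congr h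

lemma cellInt_eq_cellL {m : ℕ} {T : Finset (E m)} {f : E m → ℝ}
    {q : MvPolynomial (Fin m) ℝ} (h : ∀ x, f x = pev q x) :
    cellInt T f = cellL T q := by
  have : f = pev q := funext h
  rw [this]; rfl

/-- Change of variables from a facet to the reference simplex. -/
theorem exists_facet_jacobian {𝒯 : Mesh Ω} (F : 𝒯.Facet) {w : Fin (n + 1) → E (n + 1)}
    (hw : Function.Injective w) (hr : Set.range w = (F.1 : Set (E (n + 1)))) :
    ∃ J : ℝ, 0 < J ∧ ∀ g : E (n + 1) → ℝ,
      facetInt F.1 g = J * ∫ y in refSimplex n, g (simplexMap w y) := by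
  obtain ⟨T, hT⟩ := exists_cell F
  have hind : AffineIndependent ℝ w := by
    refine AffineIndependent.of_set_of_injective ?_ hw
    rw [hr]
    exact 𝒯.K.indep F.2.1
  have hmem : ∀ i, w i ∈ (F.1 : Set (E (n + 1))) := fun i => hr ▸ ⟨i, rfl⟩
  obtain ⟨J, hJ, h, -⟩ := exists_hyperplane_jacobian (simplexLin w) (simplexLin_injective hind)
    (norm_normal hT) (inner_simplexLin fun j => inner_normal_eq_zero
      (vsub_mem_vectorSpan ℝ (hmem _) (hmem _))) (w 0)
  refine ⟨J, hJ, fun g => ?_⟩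
  have := h (refSimplex n) g
  change ∫ x in simplexMap w '' refSimplex n, _ ∂_ = _ at this
  rw [image_simplexMap, hr] at this
  exact this

lemma exists_vertex_enumeration {𝒯 : Mesh Ω} (F : 𝒯.Facet) : ∃ w : Fin (n + 1) → E (n + 1),
    Function.Injective w ∧ Set.range w = (F.1 : Set (E (n + 1))) := by
  let e := F.1.equivFinOfCardEq F.2.2
  refine ⟨fun i => e.symm i, Subtype.val_injective.comp e.symm.injective, ?_⟩
  change Set.range (Subtype.val ∘ e.symm) = _
  rw [e.symm.surjective.range_comp, Subtype.range_coe_subtype]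
  exact Finset.setOfPred_mem

lemma continuous_simplexMap {m k : ℕ} (w : Fin (m + 1) → E k) : Continuous (simplexMap w) := by
  have := (simplexLin w).continuous_of_finiteDimensional
  unfold simplexMap
  fun_prop

lemma eq_zero_on_refSimplex {m : ℕ} {f : (Fin m → ℝ) → ℝ} (hf : Continuous f)
    (h0 : ∀ y ∈ refSimplex m, 0 ≤ f y) (h : ∫ y in refSimplex m, f y = 0) :
    ∀ y ∈ refSimplex m, f y = 0 := by
  have h1 : f =ᵐ[volume.restrict (refSimplex m)] 0 :=
    (setIntegral_eq_zero_iff_of_nonneg_ae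
      ((ae_restrict_iff' (isCompact_refSimplex m).measurableSet).2 (ae_of_all _ h0))
      (hf.continuousOn.integrableOn_compact (isCompact_refSimplex m))).1 h
  exact Measure.eqOn_of_ae_eq h1 hf.continuousOn continuousOn_const
    (refSimplex_subset_closure_interior m)

lemma facetL_nonneg {𝒯 : Mesh Ω} (F : 𝒯.Facet) {q : MvPolynomial (Fin (n + 1)) ℝ}
    (h : ∀ x, 0 ≤ pev q x) : 0 ≤ facetL F q :=
  setIntegral_nonneg (isCompact_hull F.1).measurableSet fun x _ => h x

lemma eqOn_of_facetL_eq_zero {𝒯 : Mesh Ω} (F : 𝒯.Facet) {q : MvPolynomial (Fin (n + 1)) ℝ}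
    (h : ∀ x, 0 ≤ pev q x) (h0 : facetL F q = 0) : ∀ x ∈ hull F.1, pev q x = 0 := by
  obtain ⟨w, hw, hr⟩ := exists_vertex_enumeration F
  obtain ⟨J, hJ, e⟩ := exists_facet_jacobian F hw hr
  have h1 : ∫ y in refSimplex n, pev q (simplexMap w y) = 0 := by
    have : facetInt F.1 (pev q) = 0 := h0
    rw [e] at this
    exact (mul_eq_zero.1 this).resolve_left hJ.ne'
  have h2 := eq_zero_on_refSimplex ((continuous_pev q).comp (continuous_simplexMap w))
    (fun y _ => h _) h1
  rw [hull, ← hr, ← image_simplexMap]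
  rintro _ ⟨y, hy, rfl⟩
  exact h2 y hy

lemma surfaceArea_pos {𝒯 : Mesh Ω} (T : 𝒯.Cell) : 0 < surfaceArea 𝒯 T := by
  refine Finset.sum_pos (fun F _ => ?_) (facetsOf_nonempty T)
  obtain ⟨w, hw, hr⟩ := exists_vertex_enumeration F
  obtain ⟨J, hJ, e⟩ := exists_facet_jacobian F hw hr
  have h := e fun _ => 1
  simp only [facetInt, integral_const, smul_eq_mul, mul_one, measureReal_restrict_apply_univ] at h
  rw [h]
  exact mul_pos hJ (ENNReal.toReal_pos
    (Measure.measure_pos_of_nonempty_interior _ (interior_refSimplex_nonempty n)).ne'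
    (isCompact_refSimplex n).measure_lt_top.ne)

lemma cellVol_div_surfaceArea_pos {𝒯 : Mesh Ω} (T : 𝒯.Cell) :
    0 < cellVol T.1 / surfaceArea 𝒯 T :=
  div_pos (cellVol_pos (𝒯.K.indep T.2.1) T.2.2) (surfaceArea_pos T)

lemma eq_zero_of_eqOn_open {m : ℕ} {U : Set (E m)} (hU : IsOpen U) (hne : U.Nonempty)
    {q : MvPolynomial (Fin m) ℝ} (h : ∀ x ∈ U, pev q x = 0) : q = 0 := by
  obtain ⟨x, hx⟩ := hne
  have hU' : IsOpen ((WithLp.toLp 2 : (Fin m → ℝ) → E m) ⁻¹' U) :=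
    hU.preimage (PiLp.continuous_toLp 2 _)
  obtain ⟨ε, hε, hball⟩ := Metric.isOpen_iff.1 hU' x.ofLp hx
  have hinf : ∀ i, (Metric.ball (x.ofLp i) ε).Infinite := fun i => by
    rw [Real.ball_eq_Ioo]
    exact Set.Ioo_infinite (by linarith)
  refine MvPolynomial.funext_set (fun i => Metric.ball (x.ofLp i) ε) hinf fun y hy => ?_
  rw [map_zero]
  rw [← ball_pi _ hε] at hy
  exact h _ (hball hy)

lemma cellL_nonneg {m : ℕ} (T : Finset (E m)) {q : MvPolynomial (Fin m) ℝ}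
    (h : ∀ x, 0 ≤ pev q x) : 0 ≤ cellL T q :=
  setIntegral_nonneg (isCompact_hull T).measurableSet fun x _ => h x

lemma eq_zero_of_cellL_eq_zero {𝒯 : Mesh Ω} (T : 𝒯.Cell) {q : MvPolynomial (Fin (n + 1)) ℝ}
    (h : ∀ x, 0 ≤ pev q x) (h0 : cellL T.1 q = 0) : q = 0 := by
  have hne : (interior (hull T.1)).Nonempty := by
    rw [interior_convexHull_nonempty_iff_affineSpan_eq_top]
    have := (𝒯.K.indep T.2.1).affineSpan_eq_top_iff_card_eq_finrank_add_one.2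
      (by rw [Fintype.card_coe, T.2.2]; simp)
    rwa [Subtype.range_coe_subtype, Finset.setOfPred_mem] at this
  have h1 : pev q =ᵐ[volume.restrict (interior (hull T.1))] 0 :=
    ae_restrict_of_ae_restrict_of_subset interior_subset
      ((setIntegral_eq_zero_iff_of_nonneg_ae (ae_of_all _ h)
        (integrableOn_hull_of_continuous T.1 (continuous_pev q))).1 h0)
  exact eq_zero_of_eqOn_open isOpen_interior hne (Measure.eqOn_open_of_ae_eq h1 isOpen_interior
    (continuous_pev q).continuousOn continuousOn_const)

lemma eq_zero_of_cellL_sq_eq_zero {𝒯 : Mesh Ω} (T : 𝒯.Cell) {κ : Type*} [Fintype κ]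
    {q : κ → MvPolynomial (Fin (n + 1)) ℝ} (h0 : cellL T.1 (∑ i, q i * q i) = 0) (i : κ) :
    q i = 0 := by
  rw [map_sum] at h0
  have h1 := (Finset.sum_eq_zero_iff_of_nonneg fun i _ => cellL_nonneg T.1 fun x => by
    rw [pev_mul]; exact mul_self_nonneg _).1 h0 i (Finset.mem_univ i)
  exact mul_self_eq_zero.1 (eq_zero_of_cellL_eq_zero T (fun x => by
    rw [pev_mul]; exact mul_self_nonneg _) h1)

lemma cellL_pderiv {𝒯 : Mesh Ω} (T : 𝒯.Cell) (i : Fin (n + 1))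
    (q : MvPolynomial (Fin (n + 1)) ℝ) :
    cellL T.1 (MvPolynomial.pderiv i q) =
      ∑ F ∈ 𝒯.facetsOf T, normal T.1 F.1 i * facetL F q :=
  cellInt_pderiv_eq_sum_facetsOf T i q

/-- Integration by parts on a cell. -/
lemma cellL_mul_div {𝒯 : Mesh Ω} (T : 𝒯.Cell) (u : MvPolynomial (Fin (n + 1)) ℝ)
    (r : Fin (n + 1) → MvPolynomial (Fin (n + 1)) ℝ) :
    cellL T.1 (u * ∑ i, MvPolynomial.pderiv i (r i)) +
      cellL T.1 (∑ i, r i * MvPolynomial.pderiv i u) =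
      ∑ F ∈ 𝒯.facetsOf T, facetL F (u * ∑ i, MvPolynomial.C (normal T.1 F.1 i) * r i) := by
  rw [← map_add]
  have e : u * ∑ i, MvPolynomial.pderiv i (r i) + ∑ i, r i * MvPolynomial.pderiv i u =
      ∑ i, MvPolynomial.pderiv i (u * r i) := by
    simp only [Derivation.leibniz, smul_eq_mul, Finset.sum_add_distrib, Finset.mul_sum]
  rw [e, map_sum, Finset.sum_congr rfl fun i _ => cellL_pderiv T i _, Finset.sum_comm]
  refine Finset.sum_congr rfl fun F _ => ?_
  rw [Finset.mul_sum, map_sum]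
  refine Finset.sum_congr rfl fun i _ => ?_
  rw [mul_left_comm, ← MvPolynomial.smul_eq_C_mul, map_smul, smul_eq_mul]

/-- The square integral of a locally constant polynomial is a boundary integral. -/
lemma cellL_sq_of_pderiv_eq_zero {𝒯 : Mesh Ω} (T : 𝒯.Cell) {u : MvPolynomial (Fin (n + 1)) ℝ}
    (hu : ∀ i, MvPolynomial.pderiv i u = 0) :
    cellL T.1 (u * u) =
      ∑ F ∈ 𝒯.facetsOf T, normal T.1 F.1 0 * facetL F (u * u * MvPolynomial.X 0) := by
  rw [← cellL_pderiv]
  congr 1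
  simp [Derivation.leibniz, hu]

variable {p : ℕ}

/-! ### The local problem -/

/-- The sum of the left-hand sides of the two equations of the local problem, as a bilinear form
in the solution `w = (u, q)` and the test function `z = (v, r)`. -/
def localForm (𝒯 : Mesh Ω) (p : ℕ) (τ : ℝ) (T : 𝒯.Cell) :
    LocalSpace (n + 1) p →ₗ[ℝ] LocalSpace (n + 1) p →ₗ[ℝ] ℝ :=
  LinearMap.mk₂ ℝ (fun w z =>
    cellL T.1 (∑ i, (w.2 i).1 * (z.2 i).1)
      - cellL T.1 (w.1.1 * ∑ i, MvPolynomial.pderiv i (z.2 i).1)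
      - cellL T.1 (∑ i, (w.2 i).1 * MvPolynomial.pderiv i z.1.1)
      + ∑ F ∈ 𝒯.facetsOf T, facetL F
        (((∑ i, MvPolynomial.C (normal T.1 F.1 i) * (w.2 i).1) + τ • w.1.1) * z.1.1))
    (fun w w' z => by
      simp only [Prod.fst_add, Prod.snd_add, Pi.add_apply, Submodule.coe_add, add_mul, mul_add,
        Finset.sum_add_distrib, map_add, smul_add]
      ring)
    (fun c w z => by
      simp only [Prod.smul_fst, Prod.smul_snd, Pi.smul_apply, Submodule.coe_smul, smul_mul_assoc,
        mul_smul_comm, ← Finset.smul_sum, map_smul, smul_comm τ c, ← smul_add]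
      simp only [smul_eq_mul]
      ring)
    (fun w z z' => by
      simp only [Prod.fst_add, Prod.snd_add, Pi.add_apply, Submodule.coe_add, mul_add,
        Finset.sum_add_distrib, map_add]
      ring)
    (fun c w z => by
      simp only [Prod.smul_fst, Prod.smul_snd, Pi.smul_apply, Submodule.coe_smul,
        mul_smul_comm, ← Finset.smul_sum, map_smul, Derivation.map_smul]
      simp only [smul_eq_mul]
      ring)

/-- The sum of the right-hand sides of the two equations of the local problem, for a datum that
is given by the polynomials `Λ F` on the facets. -/
def localRhs (𝒯 : Mesh Ω) (p : ℕ) (τ : ℝ) (T : 𝒯.Cell) :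
    (𝒯.Facet → MvPolynomial (Fin (n + 1)) ℝ) →ₗ[ℝ] LocalSpace (n + 1) p →ₗ[ℝ] ℝ :=
  LinearMap.mk₂ ℝ (fun Λ z =>
    - ∑ F ∈ 𝒯.facetsOf T, facetL F (Λ F * ∑ i, MvPolynomial.C (normal T.1 F.1 i) * (z.2 i).1)
      + τ * ∑ F ∈ 𝒯.facetsOf T, facetL F (Λ F * z.1.1))
    (fun w w' z => by
      simp only [Pi.add_apply, add_mul, Finset.sum_add_distrib, map_add]
      ring)
    (fun c w z => by
      simp only [Pi.smul_apply, smul_mul_assoc, map_smul]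
      simp only [smul_eq_mul, ← Finset.mul_sum]
      ring)
    (fun w z z' => by
      simp only [Prod.fst_add, Prod.snd_add, Pi.add_apply, Submodule.coe_add, mul_add,
        Finset.sum_add_distrib, map_add]
      ring)
    (fun c w z => by
      simp only [Prod.smul_fst, Prod.smul_snd, Pi.smul_apply, Submodule.coe_smul,
        mul_smul_comm, ← Finset.smul_sum, map_smul]
      simp only [smul_eq_mul]
      ring)

lemma localForm_apply (𝒯 : Mesh Ω) (p : ℕ) (τ : ℝ) (T : 𝒯.Cell) (w z : LocalSpace (n + 1) p) :
    localForm 𝒯 p τ T w z = cellL T.1 (∑ i, (w.2 i).1 * (z.2 i).1)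
      - cellL T.1 (w.1.1 * ∑ i, MvPolynomial.pderiv i (z.2 i).1)
      - cellL T.1 (∑ i, (w.2 i).1 * MvPolynomial.pderiv i z.1.1)
      + ∑ F ∈ 𝒯.facetsOf T, facetL F
        (((∑ i, MvPolynomial.C (normal T.1 F.1 i) * (w.2 i).1) + τ • w.1.1) * z.1.1) := rfl

lemma localRhs_apply (𝒯 : Mesh Ω) (p : ℕ) (τ : ℝ) (T : 𝒯.Cell)
    (Λ : 𝒯.Facet → MvPolynomial (Fin (n + 1)) ℝ) (z : LocalSpace (n + 1) p) :
    localRhs 𝒯 p τ T Λ z =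
      - ∑ F ∈ 𝒯.facetsOf T, facetL F (Λ F * ∑ i, MvPolynomial.C (normal T.1 F.1 i) * (z.2 i).1)
      + τ * ∑ F ∈ 𝒯.facetsOf T, facetL F (Λ F * z.1.1) := rfl

/-- The function `lam` on the skeleton is given on the boundary of `T` by the polynomials `Λ`. -/
def IsGivenBy (𝒯 : Mesh Ω) (T : 𝒯.Cell) (lam : 𝒯.Facet → E (n + 1) → ℝ)
    (Λ : 𝒯.Facet → MvPolynomial (Fin (n + 1)) ℝ) : Prop :=
  ∀ F ∈ 𝒯.facetsOf T, Set.EqOn (lam F) (pev (Λ F)) (hull F.1)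

lemma isLocalSolution_iff {𝒯 : Mesh Ω} {τ : ℝ} {T : 𝒯.Cell}
    {lam : 𝒯.Facet → E (n + 1) → ℝ} {Λ : 𝒯.Facet → MvPolynomial (Fin (n + 1)) ℝ}
    (h : IsGivenBy 𝒯 T lam Λ) {w : LocalSpace (n + 1) p} :
    IsLocalSolution 𝒯 p τ T lam w ↔ localForm 𝒯 p τ T w = localRhs 𝒯 p τ T Λ := by
  have e1 : ∀ r : Fin (n + 1) → MvPolynomial.restrictTotalDegree (Fin (n + 1)) ℝ p,
      (cellInt T.1 (fun x => ∑ i, pev (w.2 i) x * pev (r i) x)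
      - cellInt T.1 (fun x => pev w.1 x * ∑ i, pev (MvPolynomial.pderiv i (r i).1) x)
      = - ∑ F ∈ 𝒯.facetsOf T,
          facetInt F.1 fun x => lam F x * ∑ i, pev (r i) x * normal T.1 F.1 i) ↔
      localForm 𝒯 p τ T w (0, r) = localRhs 𝒯 p τ T Λ (0, r) := by
    intro r
    have h1 : ∀ F ∈ 𝒯.facetsOf T,
        facetInt F.1 (fun x => lam F x * ∑ i, pev (r i) x * normal T.1 F.1 i) =
          facetL F (Λ F * ∑ i, MvPolynomial.C (normal T.1 F.1 i) * (r i).1) :=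
      fun F hF => facetInt_eq_facetL fun x hx => by
        simp only [h F hF hx, pev_mul, pev_sum, pev_C, mul_comm (normal T.1 F.1 _)]
    rw [localForm_apply, localRhs_apply, cellInt_eq_cellL (q := ∑ i, (w.2 i).1 * (r i).1)
      (by simp), cellInt_eq_cellL (q := w.1.1 * ∑ i, MvPolynomial.pderiv i (r i).1) (by simp),
      Finset.sum_congr rfl h1]
    simp
  have e2 : ∀ v : MvPolynomial.restrictTotalDegree (Fin (n + 1)) ℝ p,
      (- cellInt T.1 (fun x => ∑ i, pev (w.2 i) x * pev (MvPolynomial.pderiv i v.1) x)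
      + ∑ F ∈ 𝒯.facetsOf T, facetInt F.1 (fun x =>
          ((∑ i, pev (w.2 i) x * normal T.1 F.1 i) + τ * pev w.1 x) * pev v x)
      = τ * ∑ F ∈ 𝒯.facetsOf T, facetInt F.1 fun x => lam F x * pev v x) ↔
      localForm 𝒯 p τ T w (v, 0) = localRhs 𝒯 p τ T Λ (v, 0) := by
    intro v
    have h1 : ∀ F ∈ 𝒯.facetsOf T, facetInt F.1 (fun x =>
        ((∑ i, pev (w.2 i) x * normal T.1 F.1 i) + τ * pev w.1 x) * pev v x) = facetL F
        (((∑ i, MvPolynomial.C (normal T.1 F.1 i) * (w.2 i).1) + τ • w.1.1) * v.1) :=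
      fun F _ => facetInt_eq_facetL fun x _ => by
        simp only [pev_mul, pev_sum, pev_C, pev_add, pev_smul, mul_comm (normal T.1 F.1 _)]
    have h2 : ∀ F ∈ 𝒯.facetsOf T, facetInt F.1 (fun x => lam F x * pev v x) =
        facetL F (Λ F * v.1) :=
      fun F hF => facetInt_eq_facetL fun x hx => by simp only [h F hF hx, pev_mul]
    rw [localForm_apply, localRhs_apply,
      cellInt_eq_cellL (q := ∑ i, (w.2 i).1 * MvPolynomial.pderiv i v.1) (by simp),
      Finset.sum_congr rfl h1, Finset.sum_congr rfl h2]
    simp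
  constructor
  · rintro ⟨h1, h2⟩
    refine LinearMap.ext fun z => ?_
    have hz : z = (z.1, 0) + (0, z.2) := by simp
    rw [hz, map_add, map_add, (e2 z.1).1 (h2 z.1), (e1 z.2).1 (h1 z.2)]
  · intro h'
    exact ⟨fun r => (e1 r).2 (by rw [h']), fun v => (e2 v).2 (by rw [h'])⟩

lemma totalDegree_pderiv_le {m : ℕ} (i : Fin m) (q : MvPolynomial (Fin m) ℝ) :
    (MvPolynomial.pderiv i q).totalDegree ≤ q.totalDegree := by
  conv_lhs => rw [← MvPolynomial.support_sum_monomial_coeff q, map_sum]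
  refine MvPolynomial.totalDegree_finsetSum_le fun s hs => ?_
  rw [MvPolynomial.pderiv_monomial]
  refine (MvPolynomial.totalDegree_monomial_le _ _).trans ?_
  refine le_trans ?_ (MvPolynomial.le_totalDegree hs)
  rw [Finsupp.sum_fintype _ _ (by simp), Finsupp.sum_fintype _ _ (by simp)]
  exact Finset.sum_le_sum fun j _ => by simp

lemma pderiv_mem {m : ℕ} (i : Fin m) (v : MvPolynomial.restrictTotalDegree (Fin m) ℝ p) :
    MvPolynomial.pderiv i v.1 ∈ MvPolynomial.restrictTotalDegree (Fin m) ℝ p := by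
  rw [MvPolynomial.mem_restrictTotalDegree]
  have := (MvPolynomial.mem_restrictTotalDegree _ _ _).1 v.2
  exact (totalDegree_pderiv_le i v.1).trans this

/-- If the gradient of `u`, tested with polynomial vector fields, is a boundary term of `u`, then
`u` is constant. -/
lemma pderiv_eq_zero_of_forall {𝒯 : Mesh Ω} {T : 𝒯.Cell}
    {u : MvPolynomial.restrictTotalDegree (Fin (n + 1)) ℝ p}
    (h : ∀ r : Fin (n + 1) → MvPolynomial.restrictTotalDegree (Fin (n + 1)) ℝ p,
      cellL T.1 (u.1 * ∑ i, MvPolynomial.pderiv i (r i).1) =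
        ∑ F ∈ 𝒯.facetsOf T, facetL F (u.1 * ∑ i, MvPolynomial.C (normal T.1 F.1 i) * (r i).1))
    (i : Fin (n + 1)) : MvPolynomial.pderiv i u.1 = 0 := by
  have h1 := h fun i => ⟨_, pderiv_mem i u⟩
  have h2 := cellL_mul_div T u.1 fun i => MvPolynomial.pderiv i u.1
  rw [← h1] at h2
  exact eq_zero_of_cellL_sq_eq_zero T (q := fun i => MvPolynomial.pderiv i u.1)
    (by linarith) i

/-- The energy identity of the local problem. -/
lemma localForm_self (𝒯 : Mesh Ω) (p : ℕ) (τ : ℝ) (T : 𝒯.Cell) (w : LocalSpace (n + 1) p) :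
    localForm 𝒯 p τ T w w = cellL T.1 (∑ i, (w.2 i).1 * (w.2 i).1) +
      τ * ∑ F ∈ 𝒯.facetsOf T, facetL F (w.1.1 * w.1.1) := by
  have h := cellL_mul_div T w.1.1 fun i => (w.2 i).1
  rw [localForm_apply]
  simp only [add_mul, map_add, Finset.sum_add_distrib, smul_mul_assoc, map_smul, smul_eq_mul,
    ← Finset.mul_sum]
  simp only [mul_comm w.1.1 (∑ i, MvPolynomial.C _ * _)] at h
  linarith

lemma localForm_injective (𝒯 : Mesh Ω) (p : ℕ) {τ : ℝ} (hτ : 0 < τ) (T : 𝒯.Cell) :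
    Function.Injective (localForm 𝒯 p τ T) := by
  rw [← LinearMap.ker_eq_bot, LinearMap.ker_eq_bot']
  intro w hw
  have h0 : localForm 𝒯 p τ T w w = 0 := by rw [hw]; rfl
  rw [localForm_self] at h0
  have hsq : ∀ (q : MvPolynomial (Fin (n + 1)) ℝ) (x : E (n + 1)), 0 ≤ pev (q * q) x :=
    fun q x => by rw [pev_mul]; exact mul_self_nonneg _
  have hq0 : 0 ≤ cellL T.1 (∑ i, (w.2 i).1 * (w.2 i).1) := cellL_nonneg _ fun x => by
    rw [pev_sum]; exact Finset.sum_nonneg fun i _ => hsq _ _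
  have hF0 : ∀ F ∈ 𝒯.facetsOf T, 0 ≤ facetL F (w.1.1 * w.1.1) := fun F _ =>
    facetL_nonneg F (hsq _)
  have hs := mul_nonneg hτ.le (Finset.sum_nonneg hF0)
  have hq : ∀ i, (w.2 i).1 = 0 := fun i =>
    eq_zero_of_cellL_sq_eq_zero T (q := fun i => (w.2 i).1) (by linarith) i
  have hu : ∀ F ∈ 𝒯.facetsOf T, ∀ x ∈ hull F.1, pev w.1.1 x = 0 := by
    intro F hF x hx
    have h1 : ∑ F ∈ 𝒯.facetsOf T, facetL F (w.1.1 * w.1.1) = 0 :=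
      (mul_eq_zero.1 (by linarith : τ * _ = (0 : ℝ))).resolve_left hτ.ne'
    have h2 := eqOn_of_facetL_eq_zero F (hsq _)
      ((Finset.sum_eq_zero_iff_of_nonneg hF0).1 h1 F hF) x hx
    rw [pev_mul] at h2
    exact mul_self_eq_zero.1 h2
  have huF : ∀ F ∈ 𝒯.facetsOf T, ∀ r, facetL F (w.1.1 * r) = 0 := by
    intro F hF r
    rw [← map_zero (facetL F)]
    exact facetL_congr fun x hx => by simp [hu F hF x hx]
  have hgrad : ∀ i, MvPolynomial.pderiv i w.1.1 = 0 := by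
    refine pderiv_eq_zero_of_forall (T := T) fun r => ?_
    rw [Finset.sum_eq_zero fun F hF => huF F hF _]
    have h1 : localForm 𝒯 p τ T w (0, r) = 0 := by rw [hw]; rfl
    rw [localForm_apply] at h1
    simpa [hq] using h1
  have hu0 : w.1.1 = 0 := by
    have h1 := cellL_sq_of_pderiv_eq_zero T hgrad
    rw [Finset.sum_eq_zero fun F hF => by rw [mul_assoc, huF F hF, mul_zero]] at h1
    exact mul_self_eq_zero.1 (eq_zero_of_cellL_eq_zero T (hsq _) h1)
  refine Prod.ext (Subtype.ext hu0) (funext fun i => Subtype.ext (hq i))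

/-- The local problem is uniquely solvable. -/
theorem existsUnique_localForm_eq (𝒯 : Mesh Ω) (p : ℕ) {τ : ℝ} (hτ : 0 < τ) (T : 𝒯.Cell)
    (f : LocalSpace (n + 1) p →ₗ[ℝ] ℝ) : ∃! w, localForm 𝒯 p τ T w = f := by
  have hinj := localForm_injective 𝒯 p hτ T
  have hsurj : Function.Surjective (localForm 𝒯 p τ T) :=
    (LinearMap.injective_iff_surjective_of_finrank_eq_finrank
      (Subspace.dual_finrank_eq (K := ℝ) (V := LocalSpace (n + 1) p)).symm).1 hinj
  obtain ⟨w, hw⟩ := hsurj f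
  exact ⟨w, hw, fun w' hw' => hinj (hw'.trans hw.symm)⟩

/-! ### The inner product and the condensed form -/

/-- Polynomials whose restrictions to the facets are a given element of the skeletal space. -/
def skeletalPoly {𝒯 : Mesh Ω} (lam : skeletal 𝒯 p) (F : 𝒯.Facet) :
    MvPolynomial (Fin (n + 1)) ℝ := (lam.2.1 F).choose

lemma eqOn_skeletalPoly {𝒯 : Mesh Ω} (lam : skeletal 𝒯 p) (F : 𝒯.Facet) :
    Set.EqOn (lam.1 F) (pev (skeletalPoly lam F)) (hull F.1) := fun x hx => by
  rw [(lam.2.1 F).choose_spec.2, Set.indicator_of_mem hx]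
  rfl

lemma isGivenBy_skeletalPoly {𝒯 : Mesh Ω} (T : 𝒯.Cell) (lam : skeletal 𝒯 p) :
    IsGivenBy 𝒯 T lam.1 (skeletalPoly lam) := fun F _ => eqOn_skeletalPoly lam F

lemma skeletal_ext {𝒯 : Mesh Ω} {lam mu : skeletal 𝒯 p}
    (h : ∀ F : 𝒯.Facet, ∀ x ∈ hull F.1, lam.1 F x = mu.1 F x) : lam = mu := by
  refine Subtype.ext (funext fun F => funext fun x => ?_)
  by_cases hx : x ∈ hull F.1
  · exact h F x hx
  · obtain ⟨q, -, hq⟩ := lam.2.1 F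
    obtain ⟨r, -, hr⟩ := mu.2.1 F
    rw [hq, hr, Set.indicator_of_notMem hx, Set.indicator_of_notMem hx]

lemma isGivenBy_add {𝒯 : Mesh Ω} (T : 𝒯.Cell) (lam mu : skeletal 𝒯 p) :
    IsGivenBy 𝒯 T (lam + mu : skeletal 𝒯 p).1 (skeletalPoly lam + skeletalPoly mu) :=
  fun F _ x hx => by
    simp [eqOn_skeletalPoly lam F hx, eqOn_skeletalPoly mu F hx]

lemma isGivenBy_smul {𝒯 : Mesh Ω} (T : 𝒯.Cell) (c : ℝ) (lam : skeletal 𝒯 p) :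
    IsGivenBy 𝒯 T (c • lam : skeletal 𝒯 p).1 (c • skeletalPoly lam) :=
  fun F _ x hx => by
    simp [eqOn_skeletalPoly lam F hx]

theorem existsUnique_isLocalSolution {𝒯 : Mesh Ω} {τ : ℝ} (hτ : 0 < τ) (T : 𝒯.Cell)
    (lam : skeletal 𝒯 p) :
    ∃! w : LocalSpace (n + 1) p, IsLocalSolution 𝒯 p τ T lam w := by
  simp only [isLocalSolution_iff (isGivenBy_skeletalPoly T lam)]
  exact existsUnique_localForm_eq 𝒯 p hτ T _

lemma localForm_localSol {𝒯 : Mesh Ω} {τ : ℝ} (hτ : 0 < τ) {T : 𝒯.Cell} (lam : skeletal 𝒯 p)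
    {Λ : 𝒯.Facet → MvPolynomial (Fin (n + 1)) ℝ} (h : IsGivenBy 𝒯 T lam.1 Λ) :
    localForm 𝒯 p τ T (localSol 𝒯 p τ T lam) = localRhs 𝒯 p τ T Λ :=
  (isLocalSolution_iff h).1 (Classical.epsilon_spec (existsUnique_isLocalSolution hτ T lam).exists)

lemma localSol_add {𝒯 : Mesh Ω} {τ : ℝ} (hτ : 0 < τ) (T : 𝒯.Cell) (lam mu : skeletal 𝒯 p) :
    localSol 𝒯 p τ T (lam + mu : skeletal 𝒯 p) =
      localSol 𝒯 p τ T lam + localSol 𝒯 p τ T mu := by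
  apply localForm_injective 𝒯 p hτ T
  rw [localForm_localSol hτ _ (isGivenBy_add T lam mu), map_add, map_add,
    localForm_localSol hτ _ (isGivenBy_skeletalPoly T lam),
    localForm_localSol hτ _ (isGivenBy_skeletalPoly T mu)]

lemma localSol_smul {𝒯 : Mesh Ω} {τ : ℝ} (hτ : 0 < τ) (T : 𝒯.Cell) (c : ℝ) (lam : skeletal 𝒯 p) :
    localSol 𝒯 p τ T (c • lam : skeletal 𝒯 p) = c • localSol 𝒯 p τ T lam := by
  apply localForm_injective 𝒯 p hτ T
  rw [localForm_localSol hτ _ (isGivenBy_smul T c lam), map_smul, map_smul,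
    localForm_localSol hτ _ (isGivenBy_skeletalPoly T lam)]

lemma localSol_eq_zero {𝒯 : Mesh Ω} {τ : ℝ} (hτ : 0 < τ) (T : 𝒯.Cell) (lam : skeletal 𝒯 p)
    (h : ∀ F ∈ 𝒯.facetsOf T, lam.1 F = 0) : localSol 𝒯 p τ T lam = 0 := by
  apply localForm_injective 𝒯 p hτ T
  rw [localForm_localSol hτ lam (Λ := 0) fun F hF x _ => by simp [h F hF], map_zero, map_zero]

/-- The condensed form in terms of integrals of polynomials. -/
lemma form_eq {𝒯 : Mesh Ω} (τ : ℝ) (lam mu : 𝒯.Facet → E (n + 1) → ℝ)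
    {Λ M : 𝒯.Facet → MvPolynomial (Fin (n + 1)) ℝ} (hΛ : ∀ T, IsGivenBy 𝒯 T lam Λ)
    (hM : ∀ T, IsGivenBy 𝒯 T mu M) :
    form 𝒯 p τ lam mu = ∑ T : 𝒯.Cell,
      (cellL T.1 (∑ i, ((localSol 𝒯 p τ T lam).2 i).1 * ((localSol 𝒯 p τ T mu).2 i).1) +
        τ * ∑ F ∈ 𝒯.facetsOf T, facetL F
          (((localSol 𝒯 p τ T lam).1.1 - Λ F) * ((localSol 𝒯 p τ T mu).1.1 - M F))) := by
  rw [form, ← Finset.sum_add_distrib]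
  refine Finset.sum_congr rfl fun T _ => ?_
  congr 1
  · exact cellInt_eq_cellL fun x => by simp [locQ]
  · rw [Finset.mul_sum]
    refine Finset.sum_congr rfl fun F hF => ?_
    rw [← smul_eq_mul, ← map_smul]
    refine facetInt_eq_facetL fun x hx => ?_
    simp [locU, hΛ T F hF hx, hM T F hF hx, mul_assoc]

lemma form_comm {𝒯 : Mesh Ω} (τ : ℝ) (lam mu : 𝒯.Facet → E (n + 1) → ℝ) :
    form 𝒯 p τ lam mu = form 𝒯 p τ mu lam := by
  simp only [form, mul_comm (locQ _ _ _ lam _ _ _), mul_assoc,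
    mul_comm (locU _ _ _ lam _ _ - lam _ _)]

lemma ip_comm {𝒯 : Mesh Ω} (lam mu : 𝒯.Facet → E (n + 1) → ℝ) : ip 𝒯 lam mu = ip 𝒯 mu lam := by
  simp only [ip, mul_comm (lam _ _)]

lemma form_add_left {𝒯 : Mesh Ω} {τ : ℝ} (hτ : 0 < τ) (l l' m : skeletal 𝒯 p) :
    form 𝒯 p τ (l + l' : skeletal 𝒯 p) m = form 𝒯 p τ l m + form 𝒯 p τ l' m := by
  rw [form_eq τ _ _ (fun T => isGivenBy_add T l l') (fun T => isGivenBy_skeletalPoly T m),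
    form_eq τ _ _ (fun T => isGivenBy_skeletalPoly T l) (fun T => isGivenBy_skeletalPoly T m),
    form_eq τ _ _ (fun T => isGivenBy_skeletalPoly T l') (fun T => isGivenBy_skeletalPoly T m),
    ← Finset.sum_add_distrib]
  refine Finset.sum_congr rfl fun T _ => ?_
  rw [localSol_add hτ]
  simp only [Prod.fst_add, Prod.snd_add, Pi.add_apply, Submodule.coe_add, add_mul,
    Finset.sum_add_distrib, map_add, add_sub_add_comm]
  ring

lemma form_smul_left {𝒯 : Mesh Ω} {τ : ℝ} (hτ : 0 < τ) (c : ℝ) (l m : skeletal 𝒯 p) :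
    form 𝒯 p τ (c • l : skeletal 𝒯 p) m = c * form 𝒯 p τ l m := by
  rw [form_eq τ _ _ (fun T => isGivenBy_smul T c l) (fun T => isGivenBy_skeletalPoly T m),
    form_eq τ _ _ (fun T => isGivenBy_skeletalPoly T l) (fun T => isGivenBy_skeletalPoly T m),
    Finset.mul_sum]
  refine Finset.sum_congr rfl fun T _ => ?_
  rw [localSol_smul hτ]
  simp only [Prod.smul_fst, Prod.smul_snd, Pi.smul_apply, Submodule.coe_smul, ← smul_sub,
    smul_mul_assoc, ← Finset.smul_sum, map_smul]
  simp only [smul_eq_mul]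
  ring

/-- The inner product `⟨·,·⟩_ℓ` as a bilinear form. -/
def ipForm (𝒯 : Mesh Ω) (p : ℕ) : LinearMap.BilinForm ℝ (skeletal 𝒯 p) :=
  LinearMap.mk₂ ℝ (fun l m => ip 𝒯 l m) ip_add_left ip_smul_left
    (fun l m m' => by simp only [ip_comm l.1, ip_add_left])
    (fun c l m => by simp only [ip_comm l.1, ip_smul_left, smul_eq_mul])

/-- The condensed form as a bilinear form. -/
def condensedForm (𝒯 : Mesh Ω) (p : ℕ) {τ : ℝ} (hτ : 0 < τ) :
    LinearMap.BilinForm ℝ (skeletal 𝒯 p) :=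
  LinearMap.mk₂ ℝ (fun l m => form 𝒯 p τ l m) (form_add_left hτ) (form_smul_left hτ)
    (fun l m m' => by simp only [form_comm τ l.1, form_add_left hτ])
    (fun c l m => by simp only [form_comm τ l.1, form_smul_left hτ, smul_eq_mul])

lemma ip_eq {𝒯 : Mesh Ω} (lam mu : skeletal 𝒯 p) :
    ip 𝒯 lam mu = ∑ T : 𝒯.Cell, cellVol T.1 / surfaceArea 𝒯 T *
      ∑ F ∈ 𝒯.facetsOf T, facetL F (skeletalPoly lam F * skeletalPoly mu F) := by
  refine Finset.sum_congr rfl fun T _ => ?_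
  congr 1
  refine Finset.sum_congr rfl fun F _ => facetInt_eq_facetL fun x hx => ?_
  simp [eqOn_skeletalPoly lam F hx, eqOn_skeletalPoly mu F hx]

lemma pev_mul_self_nonneg {m : ℕ} (q : MvPolynomial (Fin m) ℝ) (x : E m) : 0 ≤ pev (q * q) x := by
  rw [pev_mul]; exact mul_self_nonneg _

lemma ip_self_nonneg {𝒯 : Mesh Ω} (lam : skeletal 𝒯 p) : 0 ≤ ip 𝒯 lam lam := by
  rw [ip_eq]
  exact Finset.sum_nonneg fun T _ => mul_nonneg (cellVol_div_surfaceArea_pos T).le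
    (Finset.sum_nonneg fun F _ => facetL_nonneg F (pev_mul_self_nonneg _))

lemma eq_zero_of_ip_self {𝒯 : Mesh Ω} {lam : skeletal 𝒯 p} (h : ip 𝒯 lam lam = 0) : lam = 0 := by
  rw [ip_eq] at h
  have h0 : ∀ F : 𝒯.Facet, 0 ≤ facetL F (skeletalPoly lam F * skeletalPoly lam F) := fun F =>
    facetL_nonneg F (pev_mul_self_nonneg _)
  refine skeletal_ext fun F x hx => ?_
  obtain ⟨T, hT⟩ := exists_cell F
  have h1 := (Finset.sum_eq_zero_iff_of_nonneg fun T _ =>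
    mul_nonneg (cellVol_div_surfaceArea_pos T).le (Finset.sum_nonneg fun F _ => h0 F)).1 h T
    (Finset.mem_univ T)
  have h2 := (mul_eq_zero.1 h1).resolve_left (cellVol_div_surfaceArea_pos T).ne'
  have h3 := (Finset.sum_eq_zero_iff_of_nonneg fun F _ => h0 F).1 h2 F hT
  have h4 := eqOn_of_facetL_eq_zero F (pev_mul_self_nonneg _) h3 x hx
  rw [pev_mul, ← eqOn_skeletalPoly lam F hx] at h4
  exact mul_self_eq_zero.1 h4

lemma form_self_term_nonneg {𝒯 : Mesh Ω} {τ : ℝ} (hτ : 0 < τ) (lam : skeletal 𝒯 p) (T : 𝒯.Cell) :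
    0 ≤ cellL T.1 (∑ i, ((localSol 𝒯 p τ T lam).2 i).1 * ((localSol 𝒯 p τ T lam).2 i).1) ∧
    0 ≤ τ * ∑ F ∈ 𝒯.facetsOf T, facetL F (((localSol 𝒯 p τ T lam).1.1 - skeletalPoly lam F) *
      ((localSol 𝒯 p τ T lam).1.1 - skeletalPoly lam F)) := by
  refine ⟨cellL_nonneg _ fun x => ?_, mul_nonneg hτ.le
    (Finset.sum_nonneg fun F _ => facetL_nonneg F (pev_mul_self_nonneg _))⟩
  rw [pev_sum]
  exact Finset.sum_nonneg fun i _ => pev_mul_self_nonneg _ _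

lemma form_self_nonneg {𝒯 : Mesh Ω} {τ : ℝ} (hτ : 0 < τ) (lam : skeletal 𝒯 p) :
    0 ≤ form 𝒯 p τ lam lam := by
  rw [form_eq τ _ _ (fun T => isGivenBy_skeletalPoly T lam)
    (fun T => isGivenBy_skeletalPoly T lam)]
  exact Finset.sum_nonneg fun T _ => add_nonneg (form_self_term_nonneg hτ lam T).1
    (form_self_term_nonneg hτ lam T).2

/-- If the energy of `lam` vanishes, then `U lam` is constant on each cell and agrees with `lam`
on its boundary. Summing the divergence theorem for the fields `(U lam)² x₀ e₀` over the cells,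
all facet integrals cancel, because the two normals of a free facet are opposite and `lam` vanishes
on the other facets. -/
theorem eq_zero_of_form_self {𝒯 : Mesh Ω} {τ : ℝ} (hτ : 0 < τ) {lam : skeletal 𝒯 p}
    (h : form 𝒯 p τ lam lam = 0) : lam = 0 := by
  classical
  rw [form_eq τ _ _ (fun T => isGivenBy_skeletalPoly T lam)
    (fun T => isGivenBy_skeletalPoly T lam)] at h
  set Λ := skeletalPoly lam with hΛ
  let w : 𝒯.Cell → LocalSpace (n + 1) p := fun T => localSol 𝒯 p τ T lam
  have hterm := fun T => (Finset.sum_eq_zero_iff_of_nonneg fun T _ => add_nonneg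
    (form_self_term_nonneg hτ lam T).1 (form_self_term_nonneg hτ lam T).2).1 h T (Finset.mem_univ T)
  have hq : ∀ T i, ((w T).2 i).1 = 0 := fun T i => by
    have h1 := form_self_term_nonneg hτ lam T
    exact eq_zero_of_cellL_sq_eq_zero T (q := fun i => ((w T).2 i).1)
      (by linarith [hterm T, h1.1, h1.2]) i
  have hu : ∀ T, ∀ F ∈ 𝒯.facetsOf T, ∀ x ∈ hull F.1, pev (w T).1.1 x = pev (Λ F) x := by
    intro T F hF x hx
    have h1 := form_self_term_nonneg hτ lam T
    have h2 : ∑ F ∈ 𝒯.facetsOf T, facetL F (((w T).1.1 - Λ F) * ((w T).1.1 - Λ F)) = 0 :=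
      (mul_eq_zero.1 (by linarith [hterm T, h1.1, h1.2] : τ * _ = (0 : ℝ))).resolve_left hτ.ne'
    have h3 := (Finset.sum_eq_zero_iff_of_nonneg fun F _ =>
      facetL_nonneg F (pev_mul_self_nonneg _)).1 h2 F hF
    have h4 := eqOn_of_facetL_eq_zero F (pev_mul_self_nonneg _) h3 x hx
    rw [pev_mul, pev_sub] at h4
    exact sub_eq_zero.1 (mul_self_eq_zero.1 h4)
  have hgrad : ∀ T i, MvPolynomial.pderiv i (w T).1.1 = 0 := by
    intro T
    refine pderiv_eq_zero_of_forall (T := T) fun r => ?_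
    have h1 : localForm 𝒯 p τ T (w T) (0, r) = localRhs 𝒯 p τ T Λ (0, r) := by
      rw [localForm_localSol hτ lam (isGivenBy_skeletalPoly T lam)]
    rw [localForm_apply, localRhs_apply] at h1
    simp only [hq, zero_mul, Finset.sum_const_zero, map_zero, ZeroMemClass.coe_zero, mul_zero,
      zero_sub, add_zero, sub_zero, neg_inj] at h1
    rw [h1]
    exact Finset.sum_congr rfl fun F hF => facetL_congr fun x hx => by
      simp only [pev_mul, hu T F hF x hx]
  have hsq : ∀ T, cellL T.1 ((w T).1.1 * (w T).1.1) =
      ∑ F ∈ 𝒯.facetsOf T, normal T.1 F.1 0 * facetL F (Λ F * Λ F * MvPolynomial.X 0) := by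
    intro T
    rw [cellL_sq_of_pderiv_eq_zero T (hgrad T)]
    exact Finset.sum_congr rfl fun F hF => congrArg _ (facetL_congr fun x hx => by
      simp only [pev_mul, hu T F hF x hx])
  have hsum : ∑ T : 𝒯.Cell, cellL T.1 ((w T).1.1 * (w T).1.1) = 0 := by
    rw [Finset.sum_congr rfl fun T _ => hsq T]
    have hswap : ∑ T : 𝒯.Cell, ∑ F ∈ 𝒯.facetsOf T,
        normal T.1 F.1 0 * facetL F (Λ F * Λ F * MvPolynomial.X 0) =
        ∑ F : 𝒯.Facet, ∑ T : 𝒯.Cell with F ∈ 𝒯.facetsOf T,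
          normal T.1 F.1 0 * facetL F (Λ F * Λ F * MvPolynomial.X 0) :=
      Finset.sum_comm' fun T F => by simp
    rw [hswap]
    refine Finset.sum_eq_zero fun F _ => ?_
    rw [← Finset.sum_mul]
    by_cases hD : 𝒯.IsDirichlet F
    · have : facetL F (Λ F * Λ F * MvPolynomial.X 0) = 0 := by
        rw [← map_zero (facetL F)]
        exact facetL_congr fun x hx => by
          rw [pev_mul, pev_mul, ← eqOn_skeletalPoly lam F hx, lam.2.2 F hD]; simp
      rw [this, mul_zero]
    · rw [sum_normal_eq_zero hD, zero_mul]
  refine skeletal_ext fun F x hx => ?_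
  obtain ⟨T, hT⟩ := exists_cell F
  have h1 := (Finset.sum_eq_zero_iff_of_nonneg fun T _ => cellL_nonneg _
    (pev_mul_self_nonneg (w T).1.1)).1 hsum T (Finset.mem_univ T)
  have h2 := mul_self_eq_zero.1 (eq_zero_of_cellL_eq_zero T (pev_mul_self_nonneg _) h1)
  rw [eqOn_skeletalPoly lam F hx, ← hu T F hT x hx, h2]
  simp

/-! ### Subspace corrections in a finite-dimensional space -/

section Abstract

open Classical

variable {V : Type*} [AddCommGroup V] [Module ℝ V]

/-- A bilinear form that is an inner product. -/
structure IsInnerForm (g : LinearMap.BilinForm ℝ V) : Prop where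
  symm : ∀ x y, g x y = g y x
  nonneg : ∀ x, 0 ≤ g x x
  eq_zero : ∀ x, g x x = 0 → x = 0

namespace IsInnerForm

variable {g a : LinearMap.BilinForm ℝ V}

lemma pos (hg : IsInnerForm g) {x : V} (hx : x ≠ 0) : 0 < g x x :=
  (hg.nonneg x).lt_of_ne fun h => hx (hg.eq_zero x h.symm)

lemma sq_le (hg : IsInnerForm g) (x y : V) : g x y ^ 2 ≤ g x x * g y y :=
  g.apply_sq_le_of_symm hg.nonneg ⟨fun x y => by simpa using hg.symm x y⟩ x y

lemma ext_left (hg : IsInnerForm g) {x y : V} (h : ∀ z, g x z = g y z) : x = y := by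
  refine sub_eq_zero.1 (hg.eq_zero _ ?_)
  rw [map_sub g, LinearMap.sub_apply, h, sub_self]

variable [FiniteDimensional ℝ V]

lemma exists_dual_eq (hg : IsInnerForm g) (f : V →ₗ[ℝ] ℝ) : ∃ r, g r = f := by
  have hinj : Function.Injective g := fun x y h => hg.ext_left fun z => by rw [h]
  exact (LinearMap.injective_iff_surjective_of_finrank_eq_finrank
    (Subspace.dual_finrank_eq (K := ℝ) (V := V)).symm).1 hinj f

lemma existsUnique_represents (hg : IsInnerForm g) (a : LinearMap.BilinForm ℝ V) :
    ∃! A : Module.End ℝ V, ∀ x y, g (A x) y = a x y := by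
  choose r hr using fun x => hg.exists_dual_eq (a x)
  refine ⟨⟨⟨r, fun x y => hg.ext_left fun z => ?_⟩, fun c x => hg.ext_left fun z => ?_⟩,
    fun x y => LinearMap.congr_fun (hr x) y, fun B hB => LinearMap.ext fun x =>
      hg.ext_left fun z => ?_⟩
  · simp [hr]
  · simp [hr]
  · rw [hB]
    exact (LinearMap.congr_fun (hr x) z).symm

lemma existsUnique_adjoint (hg : IsInnerForm g) (R : Module.End ℝ V) :
    ∃! S : Module.End ℝ V, ∀ x y, g (R x) y = g x (S y) := by
  obtain ⟨S, hS, huniq⟩ := hg.existsUnique_represents (g.compl₁₂ LinearMap.id R)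
  simp only [LinearMap.compl₁₂_apply, LinearMap.id_apply] at hS huniq
  refine ⟨S, fun x y => ?_, fun S' hS' => huniq S' fun x y => ?_⟩
  · rw [hg.symm, hg.symm x, hS]
  · rw [hg.symm, ← hS', hg.symm]

lemma isUnit_of_represents (ha : IsInnerForm a) {A : Module.End ℝ V}
    (hA : ∀ x y, g (A x) y = a x y) : IsUnit A := by
  rw [Module.End.isUnit_iff]
  have hinj : Function.Injective A := by
    rw [← LinearMap.ker_eq_bot, LinearMap.ker_eq_bot']
    intro x hx
    refine ha.eq_zero x ?_
    rw [← hA, hx, map_zero, LinearMap.zero_apply]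
  exact ⟨hinj, LinearMap.injective_iff_surjective.1 hinj⟩

omit [FiniteDimensional ℝ V] in
lemma exists_eigenvalue_of_isSymmetric {H : Type*} [NormedAddCommGroup H] [InnerProductSpace ℝ H]
    [FiniteDimensional ℝ H] [Nontrivial H] {T : H →ₗ[ℝ] H} (hT : T.IsSymmetric) :
    ∃ c : ℝ, Module.End.HasEigenvalue T c ∧ ∀ x, ⟪T x, x⟫ ≤ c * ⟪x, x⟫ := by
  refine ⟨_, hT.hasEigenvalue_iSup_of_finiteDimensional, fun x => ?_⟩
  by_cases hx : x = 0
  · simp [hx]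
  have hbdd : BddAbove (Set.range fun x : {x : H // x ≠ 0} =>
      RCLike.re (inner ℝ (T x) (x : H)) / ‖(x : H)‖ ^ 2) := by
    refine ⟨‖LinearMap.toContinuousLinearMap T‖, ?_⟩
    rintro _ ⟨y, rfl⟩
    have hy : 0 < ‖(y : H)‖ := norm_pos_iff.2 y.2
    simp only [RCLike.re_to_real]
    rw [div_le_iff₀ (by positivity)]
    calc ⟪T y, (y : H)⟫ ≤ ‖T y‖ * ‖(y : H)‖ := real_inner_le_norm _ _
      _ ≤ (‖LinearMap.toContinuousLinearMap T‖ * ‖(y : H)‖) * ‖(y : H)‖ := by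
          gcongr
          exact (LinearMap.toContinuousLinearMap T).le_opNorm _
      _ = _ := by ring
  have h := le_ciSup hbdd ⟨x, hx⟩
  have hx' : 0 < ‖x‖ := norm_pos_iff.2 hx
  simp only [RCLike.re_to_real] at h
  rw [div_le_iff₀ (by positivity)] at h
  rw [real_inner_self_eq_norm_sq]
  exact h

lemma exists_eigenvalue (hg : IsInnerForm g) (ha : IsInnerForm a) [Nontrivial V]
    {A : Module.End ℝ V} (hA : ∀ x y, g (A x) y = a x y) :
    ∃ c : ℝ, Module.End.HasEigenvalue A c ∧ ∀ x, a x x ≤ c * g x x := by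
  let core : InnerProductSpace.Core ℝ V :=
    { inner := fun x y => g x y
      conj_inner_symm := fun x y => by simpa using hg.symm y x
      re_inner_nonneg := fun x => by simpa using hg.nonneg x
      add_left := fun x y z => by simp
      smul_left := fun x y r => by simp
      definite := fun x h => hg.eq_zero x h }
  let _ : NormedAddCommGroup V := core.toNormedAddCommGroup
  let _ : InnerProductSpace ℝ V := InnerProductSpace.ofCore core.toCore
  have hT : LinearMap.IsSymmetric A := fun x y => by
    change g (A x) y = g x (A y)
    rw [hg.symm x, hA, hA, ha.symm]
  obtain ⟨c, hc, h⟩ := exists_eigenvalue_of_isSymmetric hT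
  refine ⟨c, hc, fun x => ?_⟩
  have := h x
  change g (A x) x ≤ c * g x x at this
  rwa [hA] at this

lemma isGreatest_eigenvalues (hg : IsInnerForm g) (ha : IsInnerForm a) [Nontrivial V]
    {A : Module.End ℝ V} (hA : ∀ x y, g (A x) y = a x y) :
    IsGreatest {c | Module.End.HasEigenvalue A c} (sSup {c | Module.End.HasEigenvalue A c}) ∧
      0 < sSup {c | Module.End.HasEigenvalue A c} ∧
      ∀ x, a x x ≤ sSup {c | Module.End.HasEigenvalue A c} * g x x := by
  obtain ⟨c, hc, h⟩ := hg.exists_eigenvalue ha hA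
  have key : ∀ b v, v ≠ 0 → A v = b • v → a v v = b * g v v := fun b v _ hv => by
    rw [← hA, hv, map_smul, LinearMap.smul_apply, smul_eq_mul]
  have hgr : IsGreatest {c | Module.End.HasEigenvalue A c} c := by
    refine ⟨hc, fun b hb => ?_⟩
    obtain ⟨v, hv⟩ := Module.End.HasEigenvalue.exists_hasEigenvector hb
    have h1 := h v
    rw [key b v hv.2 hv.apply_eq_smul] at h1
    exact le_of_mul_le_mul_right h1 (hg.pos hv.2)
  rw [hgr.csSup_eq]
  refine ⟨hgr, ?_, h⟩
  obtain ⟨v, hv⟩ := Module.End.HasEigenvalue.exists_hasEigenvector hc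
  have h1 := ha.pos hv.2
  rw [key c v hv.2 hv.apply_eq_smul] at h1
  exact pos_of_mul_pos_left h1 (hg.nonneg v)

/-- In a finite-dimensional inner product space the splitting of a vector along a basis is
stable. -/
lemma exists_stable_basis_splitting (hg : IsInnerForm g) {ι : Type*} [Fintype ι]
    (b : Module.Basis ι ℝ V) :
    ∃ C : ℝ, 0 < C ∧ ∀ c : ι → ℝ, ∑ i, c i ^ 2 * g (b i) (b i) ≤
      C * g (∑ i, c i • b i) (∑ i, c i • b i) := by
  choose r hr using fun i => hg.exists_dual_eq (b.coord i)
  refine ⟨1 + ∑ i, g (r i) (r i) * g (b i) (b i), add_pos_of_pos_of_nonneg one_pos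
    (Finset.sum_nonneg fun i _ => mul_nonneg (hg.nonneg _) (hg.nonneg _)), fun c => ?_⟩
  set v := ∑ i, c i • b i with hv
  have hc : ∀ i, c i = g (r i) v := fun i => by
    rw [hr, Module.Basis.coord_apply, hv, b.repr_sum_self]
  rw [add_mul, one_mul, Finset.sum_mul]
  refine le_add_of_nonneg_of_le (hg.nonneg v) (Finset.sum_le_sum fun i _ => ?_)
  have h1 := hg.sq_le (r i) v
  rw [← hc] at h1
  calc c i ^ 2 * g (b i) (b i) ≤ g (r i) (r i) * g v v * g (b i) (b i) := by
        gcongr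
        exact hg.nonneg _
    _ = _ := by ring

end IsInnerForm

variable {g a : LinearMap.BilinForm ℝ V} {κ : Type*} [Fintype κ] {φ : κ → V}

lemma sum_sq_div_lower_bound (ha : IsInnerForm a) (hg : IsInnerForm g) (hφ : ∀ i, φ i ≠ 0)
    {Λ C : ℝ} (hΛ : 0 ≤ Λ) (hC : 0 ≤ C) (haΛ : ∀ x, a x x ≤ Λ * g x x) {c : κ → ℝ} {v : V}
    (hv : v = ∑ i, c i • φ i)
    (hc : ∑ i, c i ^ 2 * g (φ i) (φ i) ≤ C * g v v) :
    g v v ≤ Λ * C * ∑ i, g v (φ i) ^ 2 / a (φ i) (φ i) := by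
  set S := ∑ i, g v (φ i) ^ 2 / a (φ i) (φ i) with hS
  have hS0 : 0 ≤ S := Finset.sum_nonneg fun i _ => div_nonneg (sq_nonneg _) (ha.nonneg _)
  have h1 : g v v = ∑ i, c i * g v (φ i) := by
    calc g v v = g v (∑ i, c i • φ i) := congrArg (g v) hv
      _ = _ := by simp [map_sum]
  have h2 : (∑ i, c i * g v (φ i)) ^ 2 ≤ (∑ i, c i ^ 2 * a (φ i) (φ i)) * S := by
    refine Finset.sum_sq_le_sum_mul_sum_of_sq_le_mul _
      (fun i _ => mul_nonneg (sq_nonneg _) (ha.nonneg _))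
      (fun i _ => div_nonneg (sq_nonneg _) (ha.nonneg _)) fun i _ => le_of_eq ?_
    have := (ha.pos (hφ i)).ne'
    field_simp
  have h3 : ∑ i, c i ^ 2 * a (φ i) (φ i) ≤ Λ * (C * g v v) := by
    refine le_trans (Finset.sum_le_sum fun i _ =>
      mul_le_mul_of_nonneg_left (haΛ (φ i)) (sq_nonneg _)) ?_
    calc ∑ i, c i ^ 2 * (Λ * g (φ i) (φ i)) = Λ * ∑ i, c i ^ 2 * g (φ i) (φ i) := by
          rw [Finset.mul_sum]; exact Finset.sum_congr rfl fun i _ => by ring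
      _ ≤ _ := mul_le_mul_of_nonneg_left hc hΛ
  rw [← h1] at h2
  have h4 : g v v * g v v ≤ (Λ * C * S) * g v v := by
    calc g v v * g v v = g v v ^ 2 := by ring
      _ ≤ _ := h2.trans (mul_le_mul_of_nonneg_right h3 hS0)
      _ = _ := by ring
  by_cases hz : v = 0
  · rw [hz] at *
    rw [map_zero]
    exact mul_nonneg (mul_nonneg hΛ hC) hS0
  · exact le_of_mul_le_mul_right h4 (hg.pos hz)

/-- The quadratic form of the symmetrized smoother: with `w = A⁻¹ v` it is the decrease of the
energy of `w` under the adjoint smoothing step. -/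
lemma inner_symmetrized_smoother (hg : IsInnerForm g) (ha : IsInnerForm a) {A R R' : Module.End ℝ V}
    (hA : ∀ x y, g (A x) y = a x y) (hR : ∀ x y, g (R x) y = g x (R' y)) (w : V) :
    g ((1 - (1 - R * A) * (1 - R' * A)) w) (A w) =
      a w w - a (w - R' (A w)) (w - R' (A w)) := by
  set z := w - R' (A w) with hz
  have h1 : (1 - (1 - R * A) * (1 - R' * A)) w = w - (z - R (A z)) := by
    simp [hz]
  have h2 : g (R (A z)) (A w) = a z (w - z) := by
    rw [hR, hA, hz, sub_sub_cancel]
  have h3 : ∀ x, g x (A w) = a x w := fun x => by rw [hg.symm, hA, ha.symm]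
  clear_value z
  rw [h1, map_sub, map_sub, LinearMap.sub_apply, LinearMap.sub_apply, h2, h3, h3, map_sub]
  ring

lemma sum_interaction_le {N : ℝ}
    (hN : ∀ i, (({j | a (φ i) (φ j) ≠ 0} : Set κ).ncard : ℝ) ≤ N) (f : κ → ℝ)
    (hf : ∀ i, 0 ≤ f i) :
    ∑ k, ∑ j with a (φ j) (φ k) ≠ 0, f j ≤ N * ∑ j, f j := by
  have : ∑ k, ∑ j with a (φ j) (φ k) ≠ 0, f j = ∑ j, ∑ k with a (φ j) (φ k) ≠ 0, f j :=
    Finset.sum_comm' fun k j => by simp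
  rw [this, Finset.mul_sum]
  refine Finset.sum_le_sum fun j _ => ?_
  rw [Finset.sum_const, nsmul_eq_mul]
  refine mul_le_mul_of_nonneg_right ?_ (hf j)
  have h := hN j
  rwa [Set.ncard_eq_toFinset_card', Set.toFinset_ofPred] at h

lemma card_interaction_le (ha : IsInnerForm a) {N : ℝ}
    (hN : ∀ i, (({j | a (φ i) (φ j) ≠ 0} : Set κ).ncard : ℝ) ≤ N) (k : κ) :
    ((Finset.univ.filter fun j => a (φ j) (φ k) ≠ 0).card : ℝ) ≤ N := by
  have h := hN k
  rw [Set.ncard_eq_toFinset_card', Set.toFinset_ofPred] at h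
  simpa only [ha.symm _ (φ k)] using h

/-- The lower bound for the damped Jacobi smoother. -/
lemma jacobi_lower_bound (hg : IsInnerForm g) (ha : IsInnerForm a) (hφ : ∀ i, φ i ≠ 0) {N : ℝ}
    (hN : ∀ i, (({j | a (φ i) (φ j) ≠ 0} : Set κ).ncard : ℝ) ≤ N)
    {A R' : Module.End ℝ V} {S : κ → Module.End ℝ V} (hA : ∀ x y, g (A x) y = a x y)
    (hS : ∀ i x, S i x = (g x (φ i) / a (φ i) (φ i)) • φ i) (γ : ℝ)
    (hR : ∀ x y, g ((γ • ∑ i, S i) x) y = g x (R' y)) (w : V) :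
    γ * (2 - γ * N) * ∑ i, g (A w) (φ i) ^ 2 / a (φ i) (φ i) ≤
      g ((1 - (1 - (γ • ∑ i, S i) * A) * (1 - R' * A)) w) (A w) := by
  rw [inner_symmetrized_smoother hg ha hA hR]
  have hsum : ∀ x, (γ • ∑ i, S i) x = γ • ∑ i, (g x (φ i) / a (φ i) (φ i)) • φ i := fun x => by
    simp [LinearMap.sum_apply, hS]
  have hR' : R' (A w) = γ • ∑ i, (g (A w) (φ i) / a (φ i) (φ i)) • φ i := by
    refine hg.ext_left fun z => ?_
    rw [hg.symm, ← hR, hsum]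
    simp only [map_smul, map_sum, LinearMap.smul_apply, LinearMap.sum_apply, smul_eq_mul]
    congr 1
    refine Finset.sum_congr rfl fun i _ => ?_
    rw [hg.symm (φ i) (A w), hg.symm (φ i) z]
    ring
  set s : κ → ℝ := fun i => g (A w) (φ i) / a (φ i) (φ i) with hs
  have hsa : ∀ i, a w (φ i) = s i * a (φ i) (φ i) := fun i => by
    rw [hs, ← hA, div_mul_cancel₀ _ (ha.pos (hφ i)).ne']
  have hsq : ∀ i, g (A w) (φ i) ^ 2 / a (φ i) (φ i) = s i ^ 2 * a (φ i) (φ i) := fun i => by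
    have := (ha.pos (hφ i)).ne'
    simp only [hs]
    field_simp
  set x := ∑ i, s i • φ i with hx
  have h1 : a w x = ∑ i, s i ^ 2 * a (φ i) (φ i) := by
    rw [hx, map_sum]
    refine Finset.sum_congr rfl fun i _ => ?_
    rw [map_smul, hsa, smul_eq_mul]
    ring
  have h2 : a x x ≤ N * ∑ i, s i ^ 2 * a (φ i) (φ i) := by
    have e : a x x = ∑ k, ∑ j with a (φ j) (φ k) ≠ 0, s j * s k * a (φ j) (φ k) := by
      rw [hx, map_sum]
      refine Finset.sum_congr rfl fun k _ => ?_
      rw [map_smul, map_sum, LinearMap.sum_apply, Finset.sum_filter, smul_eq_mul, Finset.mul_sum]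
      refine Finset.sum_congr rfl fun j _ => ?_
      rw [map_smul, LinearMap.smul_apply, smul_eq_mul]
      split_ifs with h
      · ring
      · rw [not_not.1 h]; ring
    have hpair : ∀ j k, s j * s k * a (φ j) (φ k) ≤
        (s j ^ 2 * a (φ j) (φ j)) / 2 + (s k ^ 2 * a (φ k) (φ k)) / 2 := fun j k => by
      have := ha.nonneg (s j • φ j - s k • φ k)
      simp only [map_sub, map_smul, LinearMap.sub_apply, LinearMap.smul_apply, smul_eq_mul,
        ha.symm (φ k) (φ j)] at this
      linarith
    set f : κ → ℝ := fun i => s i ^ 2 * a (φ i) (φ i) with hf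
    have hf0 : ∀ i, 0 ≤ f i := fun i => mul_nonneg (sq_nonneg _) (ha.nonneg _)
    have e1 := sum_interaction_le hN f hf0
    have e2 : ∑ k, ∑ j with a (φ j) (φ k) ≠ 0, f k ≤ N * ∑ j, f j := by
      rw [Finset.mul_sum]
      refine Finset.sum_le_sum fun k _ => ?_
      rw [Finset.sum_const, nsmul_eq_mul]
      exact mul_le_mul_of_nonneg_right (card_interaction_le ha hN k) (hf0 k)
    have e3 : a x x ≤ ∑ k, ∑ j with a (φ j) (φ k) ≠ 0, (f j / 2 + f k / 2) := by
      rw [e]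
      exact Finset.sum_le_sum fun k _ => Finset.sum_le_sum fun j _ => hpair j k
    simp only [Finset.sum_add_distrib, ← Finset.sum_div] at e3
    linarith
  simp only [hsq]
  rw [hR']
  have h3 : a w w - a (w - γ • x) (w - γ • x) = 2 * γ * a w x - γ ^ 2 * a x x := by
    simp only [map_sub, map_smul, LinearMap.sub_apply, LinearMap.smul_apply, smul_eq_mul,
      ha.symm x w]
    ring
  rw [h3, h1]
  nlinarith [mul_le_mul_of_nonneg_left h2 (sq_nonneg γ)]

/-- The successive corrections of the adjoint Gauss–Seidel step decrease the energy by squares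
`t_j ^ 2`, and each residual is controlled by the corrections of the interacting unknowns. -/
lemma gaussSeidel_corrections (hg : IsInnerForm g) (ha : IsInnerForm a) (hφ : ∀ i, φ i ≠ 0)
    {A : Module.End ℝ V} {S : κ → Module.End ℝ V} (hA : ∀ x y, g (A x) y = a x y)
    (hS : ∀ i x, S i x = (g x (φ i) / a (φ i) (φ i)) • φ i) (s : List κ) (hs : s.Nodup) :
    ∃ R' : Module.End ℝ V,
      (∀ x y, g (s.foldl (fun R i => R + S i * (1 - A * R)) 0 x) y = g x (R' y)) ∧
      ∀ w, ∃ t : κ → ℝ, (∀ j ∉ s, t j = 0) ∧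
        a w w - a (w - R' (A w)) (w - R' (A w)) = ∑ j, t j ^ 2 ∧
        ∀ k ∈ s, |a w (φ k)| ≤ √(a (φ k) (φ k)) * ∑ j with a (φ j) (φ k) ≠ 0, |t j| := by
  induction s using List.reverseRecOn with
  | nil => exact ⟨0, by simp, fun w => ⟨0, by simp⟩⟩
  | append_singleton s i ih =>
    rw [List.nodup_append] at hs
    obtain ⟨R', hR', ht⟩ := ih hs.1
    have his : i ∉ s := fun h => hs.2.2 i h i (List.mem_singleton_self i) rfl
    set R := s.foldl (fun R i => R + S i * (1 - A * R)) 0 with hR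
    have hSadj : ∀ x y, g (S i x) y = g x (S i y) := fun x y => by
      rw [hS, hS]
      simp only [map_smul, LinearMap.smul_apply, smul_eq_mul]
      rw [hg.symm (φ i) y]
      ring
    have hAadj : ∀ x y, g (A x) y = g x (A y) := fun x y => by
      rw [hA, hg.symm, hA, ha.symm]
    refine ⟨R' + (1 - R' * A) * S i, fun x y => ?_, fun w => ?_⟩
    · rw [List.foldl_append, List.foldl_cons, List.foldl_nil, ← hR]
      simp only [LinearMap.add_apply, LinearMap.sub_apply, Module.End.mul_apply,
        Module.End.one_apply, map_add, map_sub, hSadj, hR', hAadj]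
    set r := a w (φ i) / a (φ i) (φ i) with hr
    have hi := ha.pos (hφ i)
    set v := w - r • φ i with hv
    have hSv : w - S i (A w) = v := by rw [hS, hA]
    obtain ⟨t, ht0, hte, htk⟩ := ht v
    have hti : t i = 0 := ht0 i his
    set ti := a w (φ i) / √(a (φ i) (φ i)) with hti'
    have hsi : √(a (φ i) (φ i)) ≠ 0 := (Real.sqrt_pos.2 hi).ne'
    have hupd : ∀ (u : ℝ → ℝ) (P : κ → Prop) [DecidablePred P], u 0 = 0 →
        ∑ j with P j, u (Function.update t i ti j) =
          ∑ j with P j, u (t j) + if P i then u ti else 0 := by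
      intro u P _ hu
      rw [Finset.sum_filter, Finset.sum_filter, ← Finset.add_sum_erase _ _ (Finset.mem_univ i),
        ← Finset.add_sum_erase (Finset.univ) (fun j => if P j then u (t j) else 0)
          (Finset.mem_univ i), Function.update_self, hti, hu, ite_self, zero_add, add_comm]
      congr 1
      refine Finset.sum_congr rfl fun j hj => ?_
      rw [Function.update_of_ne (Finset.ne_of_mem_erase hj)]
    refine ⟨Function.update t i ti, fun j hj => ?_, ?_, fun k hk => ?_⟩
    · rw [List.mem_append, not_or] at hj
      rw [Function.update_of_ne (fun h => hj.2 (List.mem_singleton.2 h))]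
      exact ht0 j hj.1
    · have h1 : w - (R' + (1 - R' * A) * S i) (A w) = v - R' (A v) := by
        rw [← hSv]
        simp only [LinearMap.add_apply, LinearMap.sub_apply, Module.End.mul_apply,
          Module.End.one_apply, map_sub]
        abel
      have h2 : a w w - a v v = ti ^ 2 := by
        rw [hv, hti', div_pow, Real.sq_sqrt hi.le]
        simp only [map_sub, map_smul, LinearMap.sub_apply, LinearMap.smul_apply, smul_eq_mul,
          ha.symm (φ i) w, hr]
        field_simp
        ring
      have h3 := hupd (fun x => x ^ 2) (fun _ => True) (by simp)
      simp only [Finset.filter_true, if_true] at h3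
      rw [h1, h3, ← hte, ← h2]
      ring
    · have h1 := hupd (fun x => |x|) (fun j => a (φ j) (φ k) ≠ 0) abs_zero
      rw [h1, mul_add]
      have hik : |a (φ i) (φ k)| ≤ √(a (φ i) (φ i)) * √(a (φ k) (φ k)) := by
        rw [← Real.sqrt_mul hi.le]
        exact Real.abs_le_sqrt (ha.sq_le _ _)
      have hri : |r| * √(a (φ i) (φ i)) = |ti| := by
        rw [hr, hti', abs_div, abs_div, abs_of_pos hi, abs_of_pos (Real.sqrt_pos.2 hi)]
        nth_rewrite 1 [← Real.mul_self_sqrt hi.le]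
        field_simp
      have hcorr : |r * a (φ i) (φ k)| ≤
          √(a (φ k) (φ k)) * if a (φ i) (φ k) ≠ 0 then |ti| else 0 := by
        split_ifs with h
        · rw [abs_mul, ← hri]
          calc |r| * |a (φ i) (φ k)| ≤ |r| * (√(a (φ i) (φ i)) * √(a (φ k) (φ k))) := by gcongr
            _ = _ := by ring
        · rw [not_not.1 h]; simp
      rw [List.mem_append, List.mem_singleton] at hk
      rcases hk with hk | rfl
      · have h2 : a w (φ k) = a v (φ k) + r * a (φ i) (φ k) := by
          rw [hv]; simp
        rw [h2]
        exact (abs_add_le _ _).trans (add_le_add (htk k hk) hcorr)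
      · have h2 : a w (φ k) = r * a (φ k) (φ k) := by
          rw [hr, div_mul_cancel₀ _ hi.ne']
        rw [h2]
        exact hcorr.trans (le_add_of_nonneg_left (mul_nonneg (Real.sqrt_nonneg _)
          (Finset.sum_nonneg fun _ _ => abs_nonneg _)))

/-- The lower bound for the Gauss–Seidel smoother. -/
lemma gaussSeidel_lower_bound (hg : IsInnerForm g) (ha : IsInnerForm a) (hφ : ∀ i, φ i ≠ 0)
    {N : ℝ} (hN0 : 0 ≤ N) (hN : ∀ i, (({j | a (φ i) (φ j) ≠ 0} : Set κ).ncard : ℝ) ≤ N)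
    {A R' : Module.End ℝ V} {S : κ → Module.End ℝ V} (hA : ∀ x y, g (A x) y = a x y)
    (hS : ∀ i x, S i x = (g x (φ i) / a (φ i) (φ i)) • φ i) {s : List κ} (hs : s.Nodup)
    (hall : ∀ i, i ∈ s)
    (hR : ∀ x y, g (s.foldl (fun R i => R + S i * (1 - A * R)) 0 x) y = g x (R' y)) (w : V) :
    ∑ i, g (A w) (φ i) ^ 2 / a (φ i) (φ i) ≤ N ^ 2 *
      g ((1 - (1 - s.foldl (fun R i => R + S i * (1 - A * R)) 0 * A) * (1 - R' * A)) w) (A w) := by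
  obtain ⟨R₁, hR₁, ht⟩ := gaussSeidel_corrections hg ha hφ hA hS s hs
  have hRR : R' = R₁ := LinearMap.ext fun y => hg.ext_left fun x => by
    rw [hg.symm, ← hR, hR₁, hg.symm]
  rw [inner_symmetrized_smoother hg ha hA hR, hRR]
  obtain ⟨t, -, hte, htk⟩ := ht w
  rw [hte]
  have h1 : ∀ k, g (A w) (φ k) ^ 2 / a (φ k) (φ k) ≤
      N * ∑ j with a (φ j) (φ k) ≠ 0, t j ^ 2 := by
    intro k
    have hk := ha.pos (hφ k)
    rw [hA, div_le_iff₀ hk, ← sq_abs]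
    calc |a w (φ k)| ^ 2 ≤ (√(a (φ k) (φ k)) * ∑ j with a (φ j) (φ k) ≠ 0, |t j|) ^ 2 :=
          pow_le_pow_left₀ (abs_nonneg _) (htk k (hall k)) 2
      _ = (∑ j with a (φ j) (φ k) ≠ 0, |t j|) ^ 2 * a (φ k) (φ k) := by
          rw [mul_pow, Real.sq_sqrt hk.le, mul_comm]
      _ ≤ (N * ∑ j with a (φ j) (φ k) ≠ 0, t j ^ 2) * a (φ k) (φ k) := by
          refine mul_le_mul_of_nonneg_right ?_ hk.le
          refine sq_sum_le_card_mul_sum_sq.trans ?_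
          simp only [sq_abs]
          exact mul_le_mul_of_nonneg_right (card_interaction_le ha hN k)
            (Finset.sum_nonneg fun _ _ => sq_nonneg _)
  refine (Finset.sum_le_sum fun k _ => h1 k).trans ?_
  rw [← Finset.mul_sum, sq, mul_assoc]
  exact mul_le_mul_of_nonneg_left (sum_interaction_le hN _ fun _ => sq_nonneg _) hN0

end Abstract

/-! ### Degrees of freedom -/

lemma cons_mem_stdSimplex {y : Fin n → ℝ} (hy : y ∈ refSimplex n) :
    (Fin.cons (1 - ∑ j, y j) y : Fin (n + 1) → ℝ) ∈ stdSimplex ℝ (Fin (n + 1)) := by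
  refine ⟨fun i => ?_, by simp [Fin.sum_univ_succ]⟩
  refine Fin.cases ?_ (fun j => ?_) i
  · simpa using hy.2
  · simpa using hy.1 j

open Classical in
/-- The point of the standard simplex with the coordinates `(1 - ∑ y, y)`, and a vertex if `y` does
not lie in the reference simplex. -/
def refPoint (y : Fin n → ℝ) : stdSimplex ℝ (Fin (n + 1)) :=
  if hy : y ∈ refSimplex n then ⟨Fin.cons (1 - ∑ j, y j) y, cons_mem_stdSimplex hy⟩
  else ⟨Pi.single 0 1, single_mem_stdSimplex ℝ 0⟩

lemma refPoint_val {y : Fin n → ℝ} (hy : y ∈ refSimplex n) :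
    (refPoint y).1 = Fin.cons (1 - ∑ j, y j) y := by rw [refPoint, dif_pos hy]

lemma exists_refPoint_eq (t : stdSimplex ℝ (Fin (n + 1))) : ∃ y ∈ refSimplex n, refPoint y = t := by
  have hsum := t.2.2
  rw [Fin.sum_univ_succ] at hsum
  have hy : Fin.tail t.1 ∈ refSimplex n := by
    refine ⟨fun j => t.2.1 _, ?_⟩
    have := t.2.1 0
    change ∑ j : Fin n, t.1 j.succ ≤ 1
    linarith
  refine ⟨Fin.tail t.1, hy, Subtype.ext ?_⟩
  rw [refPoint_val hy]
  have : 1 - ∑ j, Fin.tail t.1 j = t.1 0 := by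
    change 1 - ∑ j : Fin n, t.1 j.succ = t.1 0
    linarith
  rw [this, Fin.cons_self_tail]

lemma exists_continuous_eqOn (f : refPoly (n + 1) p) :
    ∃ f' : (Fin n → ℝ) → ℝ, Continuous f' ∧ ∀ y ∈ refSimplex n, f.1 (refPoint y) = f' y := by
  obtain ⟨q, -, hq⟩ := f.2
  refine ⟨fun y => MvPolynomial.eval (Fin.cons (1 - ∑ j, y j) y : Fin (n + 1) → ℝ) q, ?_,
    fun y hy => by rw [hq, refPoint_val hy]⟩
  refine (MvPolynomial.continuous_eval q).comp (continuous_pi fun i => ?_)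
  refine Fin.cases ?_ (fun j => ?_) i
  · simp only [Fin.cons_zero]
    fun_prop
  · simp only [Fin.cons_succ]
    fun_prop

lemma integrableOn_refPoly_mul (f g : refPoly (n + 1) p) :
    IntegrableOn (fun y => f.1 (refPoint y) * g.1 (refPoint y)) (refSimplex n) := by
  obtain ⟨f', hf', ef⟩ := exists_continuous_eqOn f
  obtain ⟨g', hg', eg⟩ := exists_continuous_eqOn g
  refine ((hf'.mul hg').continuousOn.integrableOn_compact (isCompact_refSimplex n)).congr_fun
    (fun y hy => ?_) (isCompact_refSimplex n).measurableSet
  simp [ef y hy, eg y hy]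

/-- The `L²` inner product of polynomials on the reference facet. -/
def refForm (n p : ℕ) : LinearMap.BilinForm ℝ (refPoly (n + 1) p) :=
  have hadd : ∀ f f' g : refPoly (n + 1) p,
      ∫ y in refSimplex n, (f + f' : refPoly (n + 1) p).1 (refPoint y) * g.1 (refPoint y) =
      (∫ y in refSimplex n, f.1 (refPoint y) * g.1 (refPoint y)) +
        ∫ y in refSimplex n, f'.1 (refPoint y) * g.1 (refPoint y) := fun f f' g => by
    rw [← integral_add (integrableOn_refPoly_mul f g) (integrableOn_refPoly_mul f' g)]
    simp [add_mul]
  have hsmul : ∀ (c : ℝ) (f g : refPoly (n + 1) p),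
      ∫ y in refSimplex n, (c • f : refPoly (n + 1) p).1 (refPoint y) * g.1 (refPoint y) =
      c * ∫ y in refSimplex n, f.1 (refPoint y) * g.1 (refPoint y) := fun c f g => by
    rw [← integral_const_mul]
    simp [mul_assoc]
  LinearMap.mk₂ ℝ (fun f g => ∫ y in refSimplex n, f.1 (refPoint y) * g.1 (refPoint y)) hadd hsmul
    (fun f g g' => by simpa only [mul_comm] using hadd g g' f)
    (fun c f g => by simpa only [mul_comm (f.1 _), smul_eq_mul] using hsmul c g f)

lemma refForm_apply (f g : refPoly (n + 1) p) :
    refForm n p f g = ∫ y in refSimplex n, f.1 (refPoint y) * g.1 (refPoint y) := rfl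

lemma isInnerForm_refForm (n p : ℕ) : IsInnerForm (refForm n p) where
  symm f g := by simp only [refForm_apply, mul_comm]
  nonneg f := setIntegral_nonneg (isCompact_refSimplex n).measurableSet fun y _ => mul_self_nonneg _
  eq_zero f h := by
    obtain ⟨f', hf', ef⟩ := exists_continuous_eqOn f
    have h1 : ∫ y in refSimplex n, f' y * f' y = 0 := by
      rw [← h, refForm_apply]
      exact setIntegral_congr_fun (isCompact_refSimplex n).measurableSet fun y hy => by
        simp [ef y hy]
    have h2 := eq_zero_on_refSimplex (hf'.mul hf') (fun y _ => mul_self_nonneg _) h1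
    refine Subtype.ext (funext fun t => ?_)
    obtain ⟨y, hy, rfl⟩ := exists_refPoint_eq t
    rw [ef y hy]
    exact mul_self_eq_zero.1 (h2 y hy)

lemma simplexMap_eq_param {𝒯 : Mesh Ω} (ord : 𝒯.Numbering) (F : 𝒯.Facet) {y : Fin n → ℝ}
    (hy : y ∈ refSimplex n) :
    simplexMap (fun k => (ord F k : E (n + 1))) y = param ord F (refPoint y) := by
  rw [simplexMap_eq_sum, param, refPoint_val hy, Fin.sum_univ_succ]
  simp

/-- Change of variables from a facet to the reference facet. -/
lemma exists_facetInt_eq_refForm {𝒯 : Mesh Ω} (ord : 𝒯.Numbering) (F : 𝒯.Facet) :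
    ∃ J : ℝ, 0 < J ∧ ∀ (f : refPoly (n + 1) p) (g : E (n + 1) → ℝ),
      (∀ t, g (param ord F t) = f.1 t) → facetInt F.1 (fun x => g x * g x) = J * refForm n p f f := by
  obtain ⟨J, hJ, h⟩ := exists_facet_jacobian F (w := fun k => (ord F k : E (n + 1)))
    (Subtype.val_injective.comp (ord F).injective) (by
      change Set.range (Subtype.val ∘ ord F) = _
      rw [(ord F).surjective.range_comp, Subtype.range_coe_subtype]
      exact Finset.setOfPred_mem)
  refine ⟨J, hJ, fun f g hg => ?_⟩
  rw [h, refForm_apply]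
  congr 1
  exact setIntegral_congr_fun (isCompact_refSimplex n).measurableSet fun y hy => by
    simp only [simplexMap_eq_param ord F hy, hg]

/-- The pull-back of an element of the skeletal space to the reference facet. -/
def pullback {𝒯 : Mesh Ω} (ord : 𝒯.Numbering) (lam : skeletal 𝒯 p) (F : 𝒯.Facet) :
    refPoly (n + 1) p :=
  ⟨fun t => lam.1 F (param ord F t), by
    obtain ⟨q, hq, e⟩ := lam.2.1 F
    let l : Fin (n + 1) → MvPolynomial (Fin (n + 1)) ℝ := fun i =>
      ∑ k, MvPolynomial.C ((ord F k : E (n + 1)) i) * MvPolynomial.X k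
    refine ⟨MvPolynomial.aeval l q, totalDegree_aeval_le l (fun i => ?_) q hq, fun t => ?_⟩
    · refine MvPolynomial.totalDegree_finsetSum_le fun k _ => ?_
      refine (MvPolynomial.totalDegree_mul _ _).trans ?_
      simp
    · have hmem : param ord F t ∈ hull F.1 := by
        rw [← range_param ord F]; exact ⟨t, rfl⟩
      change lam.1 F (param ord F t) = _
      rw [e, Set.indicator_of_mem hmem, pev, ← MvPolynomial.coe_aeval_eq_eval,
        ← MvPolynomial.coe_aeval_eq_eval, RingHom.coe_coe, RingHom.coe_coe, ← AlgHom.comp_apply,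
        MvPolynomial.comp_aeval]
      congr 2
      ext i
      simp [l, param, mul_comm]⟩

variable {ι : Type*}

section Dofs

variable (b : Module.Basis ι ℝ (refPoly (n + 1) p)) {𝒯 : Mesh Ω} (ord : 𝒯.Numbering)

lemma basisFun_of_ne {i : 𝒯.Dof ι} {F : 𝒯.Facet} (h : F ≠ i.1.1) : (basisFun b ord i).1 F = 0 :=
  if_neg h

lemma basisFun_param (i : 𝒯.Dof ι) (t : stdSimplex ℝ (Fin (n + 1))) :
    (basisFun b ord i).1 i.1.1 (param ord i.1.1 t) = (b i.2).1 t := by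
  have : (basisFun b ord i).1 i.1.1 = transport ord i.1.1 (b i.2).1 := if_pos rfl
  rw [this, transport_param]

lemma basisFun_ne_zero (i : 𝒯.Dof ι) : basisFun b ord i ≠ 0 := by
  intro h
  refine b.ne_zero i.2 (Subtype.ext (funext fun t => ?_))
  rw [← basisFun_param b ord i t, h]
  rfl

variable [Fintype ι]

/-- The coefficients of an element of the skeletal space. -/
def dofCoeff (lam : skeletal 𝒯 p) (i : 𝒯.Dof ι) : ℝ := b.repr (pullback ord lam i.1.1) i.2

lemma sum_dofCoeff (lam : skeletal 𝒯 p) (F : 𝒯.FreeFacet) :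
    ∑ k, dofCoeff b ord lam (F, k) • b k = pullback ord lam F.1 := by
  simp only [dofCoeff]
  exact b.sum_repr (pullback ord lam F.1)

lemma eq_sum_basisFun (lam : skeletal 𝒯 p) :
    lam = ∑ i, dofCoeff b ord lam i • basisFun b ord i := by
  classical
  refine skeletal_ext fun F x hx => ?_
  have e : (∑ i, dofCoeff b ord lam i • basisFun b ord i : skeletal 𝒯 p).1 F x =
      ∑ i, dofCoeff b ord lam i * (basisFun b ord i).1 F x := by
    simp [Finset.sum_apply]
  rw [e]
  by_cases hD : 𝒯.IsDirichlet F
  · rw [lam.2.2 F hD, Finset.sum_eq_zero]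
    · rfl
    · intro i _
      rw [(basisFun b ord i).2.2 F hD]
      simp
  · rw [← range_param ord F] at hx
    obtain ⟨t, rfl⟩ := hx
    rw [Fintype.sum_prod_type, Finset.sum_eq_single (⟨F, hD⟩ : 𝒯.FreeFacet)]
    · have h1 := congrArg (fun f : refPoly (n + 1) p => f.1 t) (sum_dofCoeff b ord lam ⟨F, hD⟩)
      simp only [Submodule.coe_sum, Finset.sum_apply, Submodule.coe_smul, Pi.smul_apply,
        smul_eq_mul] at h1
      refine h1.symm.trans (Finset.sum_congr rfl fun k _ => ?_)
      rw [← basisFun_param b ord (⟨F, hD⟩, k) t]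
    · intro F' _ hF'
      refine Finset.sum_eq_zero fun k _ => ?_
      rw [basisFun_of_ne b ord (i := (F', k)) fun h => hF' (Subtype.ext h.symm)]
      simp
    · intro h
      exact absurd (Finset.mem_univ _) h

include b ord in
lemma finiteDimensional_skeletal : FiniteDimensional ℝ (skeletal 𝒯 p) :=
  Module.Finite.of_surjective (Fintype.linearCombination ℝ (basisFun b ord)) fun lam =>
    ⟨dofCoeff b ord lam, by
      rw [Fintype.linearCombination_apply]
      exact (eq_sum_basisFun b ord lam).symm⟩

/-- The splitting along the degrees of freedom is stable in the weighted norm, because it is so on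
the reference facet and the surface measure of a facet is a multiple of the reference measure. -/
lemma sum_dofCoeff_sq_le {C : ℝ} (hC : ∀ c : ι → ℝ, ∑ k, c k ^ 2 * refForm n p (b k) (b k) ≤
      C * refForm n p (∑ k, c k • b k) (∑ k, c k • b k)) (hC0 : 0 ≤ C) (lam : skeletal 𝒯 p) :
    ∑ i, dofCoeff b ord lam i ^ 2 * ip 𝒯 (basisFun b ord i) (basisFun b ord i) ≤
      C * ip 𝒯 lam lam := by
  classical
  have hF : ∀ F : 𝒯.Facet, ∑ i, dofCoeff b ord lam i ^ 2 *
      facetInt F.1 (fun x => (basisFun b ord i).1 F x * (basisFun b ord i).1 F x) ≤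
      C * facetInt F.1 (fun x => lam.1 F x * lam.1 F x) := by
    intro F
    have hzero : ∀ i : 𝒯.Dof ι, F ≠ i.1.1 → dofCoeff b ord lam i ^ 2 *
        facetInt F.1 (fun x => (basisFun b ord i).1 F x * (basisFun b ord i).1 F x) = 0 := by
      intro i hi
      simp [basisFun_of_ne b ord hi, facetInt]
    by_cases hD : 𝒯.IsDirichlet F
    · rw [Finset.sum_eq_zero fun i _ => hzero i fun h => i.1.2 (h ▸ hD)]
      refine mul_nonneg hC0 (setIntegral_nonneg (isCompact_hull F.1).measurableSet fun x _ =>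
        mul_self_nonneg _)
    · obtain ⟨J, hJ, h⟩ := exists_facetInt_eq_refForm (p := p) ord F
      rw [h (pullback ord lam F) (lam.1 F) fun t => rfl, Fintype.sum_prod_type,
        Finset.sum_eq_single (⟨F, hD⟩ : 𝒯.FreeFacet)]
      · rw [← sum_dofCoeff b ord lam ⟨F, hD⟩]
        have h1 : ∀ k, facetInt F.1 (fun x => (basisFun b ord (⟨F, hD⟩, k)).1 F x *
            (basisFun b ord (⟨F, hD⟩, k)).1 F x) = J * refForm n p (b k) (b k) := fun k =>
          h (b k) _ (basisFun_param b ord (⟨F, hD⟩, k))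
        simp only [h1]
        calc ∑ k, dofCoeff b ord lam (⟨F, hD⟩, k) ^ 2 * (J * refForm n p (b k) (b k))
            = J * ∑ k, dofCoeff b ord lam (⟨F, hD⟩, k) ^ 2 * refForm n p (b k) (b k) := by
              rw [Finset.mul_sum]
              exact Finset.sum_congr rfl fun k _ => by ring
          _ ≤ J * (C * _) := mul_le_mul_of_nonneg_left (hC _) hJ.le
          _ = _ := by ring
      · intro F' _ hF'
        exact Finset.sum_eq_zero fun k _ => hzero (F', k) fun h => hF' (Subtype.ext h.symm)
      · intro h
        exact absurd (Finset.mem_univ _) h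
  calc ∑ i, dofCoeff b ord lam i ^ 2 * ip 𝒯 (basisFun b ord i) (basisFun b ord i)
      = ∑ T : 𝒯.Cell, cellVol T.1 / surfaceArea 𝒯 T * ∑ F ∈ 𝒯.facetsOf T,
        ∑ i, dofCoeff b ord lam i ^ 2 *
          facetInt F.1 (fun x => (basisFun b ord i).1 F x * (basisFun b ord i).1 F x) := by
        simp only [ip, Finset.mul_sum]
        rw [Finset.sum_comm]
        refine Finset.sum_congr rfl fun T _ => ?_
        rw [Finset.sum_comm]
        exact Finset.sum_congr rfl fun F _ => Finset.sum_congr rfl fun i _ => by ring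
    _ ≤ ∑ T : 𝒯.Cell, cellVol T.1 / surfaceArea 𝒯 T * ∑ F ∈ 𝒯.facetsOf T,
        C * facetInt F.1 (fun x => lam.1 F x * lam.1 F x) :=
        Finset.sum_le_sum fun T _ => mul_le_mul_of_nonneg_left
          (Finset.sum_le_sum fun F _ => hF F) (cellVol_div_surfaceArea_pos T).le
    _ = _ := by
        simp only [ip, Finset.mul_sum]
        exact Finset.sum_congr rfl fun T _ => Finset.sum_congr rfl fun F _ => by ring

end Dofs

/-! ### Interaction of degrees of freedom -/

lemma form_eq_zero_of_no_common_cell {𝒯 : Mesh Ω} {τ : ℝ} (hτ : 0 < τ) {lam mu : skeletal 𝒯 p}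
    (h : ∀ T : 𝒯.Cell, (∀ F ∈ 𝒯.facetsOf T, lam.1 F = 0) ∨ ∀ F ∈ 𝒯.facetsOf T, mu.1 F = 0) :
    form 𝒯 p τ lam mu = 0 := by
  have h1 : ∀ (T : 𝒯.Cell) (l : skeletal 𝒯 p), (∀ F ∈ 𝒯.facetsOf T, l.1 F = 0) →
      (∀ x, locU 𝒯 p τ l T x = 0) ∧ ∀ i x, locQ 𝒯 p τ l T i x = 0 := fun T l hl => by
    have := localSol_eq_zero hτ T l hl
    constructor <;> intros <;> simp [locU, locQ, this]
  rw [form, Finset.sum_eq_zero, Finset.sum_eq_zero, add_zero]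
  · intro T _
    refine Finset.sum_eq_zero fun F hF => ?_
    rcases h T with h | h
    · simp [(h1 T lam h).1, h F hF, facetInt]
    · simp [(h1 T mu h).1, h F hF, facetInt]
  · intro T _
    rcases h T with h | h
    · simp [(h1 T lam h).2, cellInt]
    · simp [(h1 T mu h).2, cellInt]

/-- A facet has a common cell with at most `2 d + 1` facets. -/
lemma exists_finset_common_cell {𝒯 : Mesh Ω} (F : 𝒯.Facet) : ∃ S : Finset 𝒯.Facet,
    S.card ≤ 2 * (n + 1) + 1 ∧ ∀ (T : 𝒯.Cell) (F' : 𝒯.Facet), F ∈ 𝒯.facetsOf T →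
      F' ∈ 𝒯.facetsOf T → F' ∈ S := by
  classical
  obtain ⟨T, hT⟩ := exists_cell F
  by_cases h : ∃ T', T' ≠ T ∧ F ∈ 𝒯.facetsOf T'
  · obtain ⟨T', hne, hT'⟩ := h
    refine ⟨𝒯.facetsOf T ∪ 𝒯.facetsOf T', ?_, fun T'' F' h1 h2 => ?_⟩
    · have h1 := Finset.card_union_add_card_inter (𝒯.facetsOf T) (𝒯.facetsOf T')
      have h2 : 0 < (𝒯.facetsOf T ∩ 𝒯.facetsOf T').card :=
        Finset.card_pos.2 ⟨F, Finset.mem_inter.2 ⟨hT, hT'⟩⟩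
      rw [card_facetsOf, card_facetsOf] at h1
      omega
    · rcases eq_or_eq_of_facet hne.symm hT hT' h1 with rfl | rfl
      · exact Finset.mem_union_left _ h2
      · exact Finset.mem_union_right _ h2
  · push Not at h
    refine ⟨𝒯.facetsOf T, by rw [card_facetsOf]; omega, fun T'' F' h1 h2 => ?_⟩
    by_cases h3 : T'' = T
    · rwa [h3] at h2
    · exact absurd h1 (h T'' h3)

theorem limitedInteraction [Fintype ι] (b : Module.Basis ι ℝ (refPoly (n + 1) p)) {𝒯 : Mesh Ω}
    {τ : ℝ} (hτ : 0 < τ) (ord : 𝒯.Numbering) : LimitedInteraction b τ ord := by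
  classical
  have h1 : ∀ i j : 𝒯.Dof ι, form 𝒯 p τ (basisFun b ord i) (basisFun b ord j) ≠ 0 →
      ∃ T : 𝒯.Cell, i.1.1 ∈ 𝒯.facetsOf T ∧ j.1.1 ∈ 𝒯.facetsOf T := by
    intro i j hij
    by_contra! hcon
    refine hij (form_eq_zero_of_no_common_cell hτ fun T => ?_)
    by_cases hi : i.1.1 ∈ 𝒯.facetsOf T
    · exact Or.inr fun F hF => basisFun_of_ne b ord fun h => hcon T hi (h ▸ hF)
    · exact Or.inl fun F hF => basisFun_of_ne b ord fun h => hi (h ▸ hF)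
  refine ⟨h1, fun i => ?_⟩
  obtain ⟨S, hS, hmem⟩ := exists_finset_common_cell i.1.1
  let f : 𝒯.Dof ι → 𝒯.Facet × ι := fun j => (j.1.1, j.2)
  have hf : Function.Injective f := fun j j' h =>
    Prod.ext (Subtype.ext (Prod.mk.inj h).1) (Prod.mk.inj h).2
  calc {j | form 𝒯 p τ (basisFun b ord i) (basisFun b ord j) ≠ 0}.ncard
      ≤ ((S ×ˢ Finset.univ : Finset (𝒯.Facet × ι)) : Set (𝒯.Facet × ι)).ncard := by
        refine Set.ncard_le_ncard_of_injOn f (fun j hj => ?_) hf.injOn (Finset.finite_toSet _)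
        obtain ⟨T, hi, hj⟩ := h1 i j hj
        simpa [f] using hmem T _ hi hj
    _ = S.card * Fintype.card ι := by
        rw [Set.ncard_coe_finset, Finset.card_product, Finset.card_univ]
    _ ≤ _ := Nat.mul_le_mul_right _ hS

/-! ### Well-posedness and the smoothing property -/

lemma isInnerForm_ipForm (𝒯 : Mesh Ω) (p : ℕ) : IsInnerForm (ipForm 𝒯 p) where
  symm x y := ip_comm x.1 y.1
  nonneg x := ip_self_nonneg x
  eq_zero _ h := eq_zero_of_ip_self h

lemma isInnerForm_condensedForm (𝒯 : Mesh Ω) (p : ℕ) {τ : ℝ} (hτ : 0 < τ) :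
    IsInnerForm (condensedForm 𝒯 p hτ) where
  symm x y := form_comm τ x.1 y.1
  nonneg x := form_self_nonneg hτ x
  eq_zero _ h := eq_zero_of_form_self hτ h

section Smoothing

variable [Fintype ι] (b : Module.Basis ι ℝ (refPoly (n + 1) p)) {𝒯 : Mesh Ω} {τ : ℝ} (hτ : 0 < τ)
  (ord : 𝒯.Numbering)

include b ord hτ

lemma opA_spec (x y : skeletal 𝒯 p) :
    ipForm 𝒯 p (opA 𝒯 p τ x) y = condensedForm 𝒯 p hτ x y := by
  have := finiteDimensional_skeletal b ord
  have h : ∃ A, Represents 𝒯 p τ A :=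
    ((isInnerForm_ipForm 𝒯 p).existsUnique_represents (condensedForm 𝒯 p hτ)).exists
  exact Classical.epsilon_spec h x y

omit hτ in
lemma dagger_spec (R : Module.End ℝ (skeletal 𝒯 p)) (x y : skeletal 𝒯 p) :
    ipForm 𝒯 p (R x) y = ipForm 𝒯 p x (dagger 𝒯 p R y) := by
  have := finiteDimensional_skeletal b ord
  have h : ∃ S, IsAdjoint 𝒯 p R S := ((isInnerForm_ipForm 𝒯 p).existsUnique_adjoint R).exists
  exact Classical.epsilon_spec h x y

theorem wellPosed : WellPosed 𝒯 p τ := by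
  have := finiteDimensional_skeletal b ord
  have hg := isInnerForm_ipForm 𝒯 p
  have ha := isInnerForm_condensedForm 𝒯 p hτ
  refine ⟨fun T lam => existsUnique_isLocalSolution hτ T lam,
    hg.existsUnique_represents (condensedForm 𝒯 p hτ),
    ha.isUnit_of_represents (opA_spec b hτ ord), hg.existsUnique_adjoint, fun _ => ?_⟩
  have h := hg.isGreatest_eigenvalues ha (opA_spec b hτ ord)
  exact ⟨h.1, h.2.1⟩

/-- A smoother satisfies the smoothing hypothesis as soon as its symmetrization dominates the
one-dimensional corrections. -/
lemma smoothingHypothesis_of_lower_bound {C C' : ℝ}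
    (hC : ∀ c : ι → ℝ, ∑ k, c k ^ 2 * refForm n p (b k) (b k) ≤
      C * refForm n p (∑ k, c k • b k) (∑ k, c k • b k)) (hC0 : 0 < C)
    {R : Module.End ℝ (skeletal 𝒯 p)}
    (hR : ∀ w, ∑ i : 𝒯.Dof ι, ipForm 𝒯 p (opA 𝒯 p τ w) (basisFun b ord i) ^ 2 /
        condensedForm 𝒯 p hτ (basisFun b ord i) (basisFun b ord i) ≤
      C' * ipForm 𝒯 p ((1 - (1 - R * opA 𝒯 p τ) * (1 - dagger 𝒯 p R * opA 𝒯 p τ)) w)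
        (opA 𝒯 p τ w)) :
    SmoothingHypothesis 𝒯 p τ R (C * C') := by
  have := finiteDimensional_skeletal b ord
  have hg := isInnerForm_ipForm 𝒯 p
  have ha := isInnerForm_condensedForm 𝒯 p hτ
  intro lam
  by_cases hlam : lam = 0
  -- Both sides vanish; in particular the value of `lamMax` on the zero space does not matter.
  · subst hlam
    have h1 : ip 𝒯 (0 : skeletal 𝒯 p) (0 : skeletal 𝒯 p) = 0 := by
      change ipForm 𝒯 p 0 0 = 0
      simp
    have h2 : ip 𝒯 (opK 𝒯 p τ R 0) (0 : skeletal 𝒯 p) = 0 := by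
      change ipForm 𝒯 p (opK 𝒯 p τ R 0) 0 = 0
      simp
    rw [h1, h2]
    simp
  · have : Nontrivial (skeletal 𝒯 p) := ⟨⟨lam, 0, hlam⟩⟩
    obtain ⟨-, hpos, hΛ⟩ := hg.isGreatest_eigenvalues ha (opA_spec b hτ ord)
    change 0 < lamMax 𝒯 p τ at hpos
    change ∀ x, condensedForm 𝒯 p hτ x x ≤ lamMax 𝒯 p τ * ipForm 𝒯 p x x at hΛ
    have hu := ha.isUnit_of_represents (opA_spec b hτ ord)
    set w := Ring.inverse (opA 𝒯 p τ) lam with hw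
    have hAw : opA 𝒯 p τ w = lam :=
      LinearMap.congr_fun (Ring.mul_inverse_cancel _ hu) lam
    have h1 := hR w
    rw [hAw] at h1
    have h2 := sum_sq_div_lower_bound ha hg (basisFun_ne_zero b ord) hpos.le hC0.le hΛ
      (eq_sum_basisFun b ord lam) (sum_dofCoeff_sq_le b ord hC hC0.le lam)
    rw [div_le_iff₀ hpos]
    calc ip 𝒯 lam lam ≤ lamMax 𝒯 p τ * C * _ := h2
      _ ≤ lamMax 𝒯 p τ * C * (C' * ip 𝒯 (opK 𝒯 p τ R lam) lam) :=
          mul_le_mul_of_nonneg_left h1 (mul_nonneg hpos.le hC0.le)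
      _ = _ := by ring

lemma interaction_card_le (i : 𝒯.Dof ι) :
    (({j | condensedForm 𝒯 p hτ (basisFun b ord i) (basisFun b ord j) ≠ 0} :
      Set (𝒯.Dof ι)).ncard : ℝ) ≤ (2 * (n + 1 : ℕ) + 1) * Fintype.card ι := by
  exact_mod_cast (limitedInteraction b hτ ord).2 i

theorem smoothingHypothesis_jacobi {C : ℝ}
    (hC : ∀ c : ι → ℝ, ∑ k, c k ^ 2 * refForm n p (b k) (b k) ≤
      C * refForm n p (∑ k, c k • b k) (∑ k, c k • b k)) (hC0 : 0 < C) {γ : ℝ} (hγ : 0 < γ)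
    (hγ' : γ * ((2 * (n + 1 : ℕ) + 1) * Fintype.card ι) < 2) :
    SmoothingHypothesis 𝒯 p τ (jacobi b τ ord γ)
      (C * (γ * (2 - γ * ((2 * (n + 1 : ℕ) + 1) * Fintype.card ι)))⁻¹) := by
  refine smoothingHypothesis_of_lower_bound b hτ ord hC hC0 fun w => ?_
  rw [inv_mul_eq_div, le_div_iff₀' (mul_pos hγ (by linarith))]
  exact jacobi_lower_bound (isInnerForm_ipForm 𝒯 p) (isInnerForm_condensedForm 𝒯 p hτ)
    (basisFun_ne_zero b ord) (interaction_card_le b hτ ord)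
    (S := fun i => lineSolve 𝒯 p τ (basisFun b ord i)) (opA_spec b hτ ord) (fun _ _ => rfl) γ
    (dagger_spec b ord _) w

theorem smoothingHypothesis_gaussSeidel {C : ℝ}
    (hC : ∀ c : ι → ℝ, ∑ k, c k ^ 2 * refForm n p (b k) (b k) ≤
      C * refForm n p (∑ k, c k • b k) (∑ k, c k • b k)) (hC0 : 0 < C)
    {s : List (𝒯.Dof ι)} (hs : s.Nodup) (hall : ∀ i, i ∈ s) :
    SmoothingHypothesis 𝒯 p τ (gaussSeidel b τ ord s)
      (C * ((2 * (n + 1 : ℕ) + 1) * Fintype.card ι) ^ 2) :=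
  smoothingHypothesis_of_lower_bound b hτ ord hC hC0 fun w =>
    gaussSeidel_lower_bound (isInnerForm_ipForm 𝒯 p) (isInnerForm_condensedForm 𝒯 p hτ)
      (basisFun_ne_zero b ord) (by positivity) (interaction_card_le b hτ ord)
      (S := fun i => lineSolve 𝒯 p τ (basisFun b ord i)) (opA_spec b hτ ord) (fun _ _ => rfl) hs
      hall (dagger_spec b ord _) w

end Smoothing

/-- The reference basis is nonempty, because it has to represent the constant polynomials. -/
lemma card_pos_of_basis [Fintype ι] (b : Module.Basis ι ℝ (refPoly (n + 1) p)) :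
    0 < Fintype.card ι := by
  rw [Fintype.card_pos_iff]
  by_contra h
  rw [not_nonempty_iff] at h
  let one : refPoly (n + 1) p := ⟨fun _ => 1, 1, by simp, by simp⟩
  have h1 : one = 0 := by rw [← b.sum_repr one]; simp
  have h2 := congrFun (congrArg Subtype.val h1) ⟨Pi.single 0 1, single_mem_stdSimplex ℝ 0⟩
  exact one_ne_zero h2

end HDG

end

theorem mainTheorem5 (d p : ℕ) (hd : 1 ≤ d) (hp : 1 ≤ p) {ι : Type*} [Fintype ι]
    (b : Module.Basis ι ℝ (HDG.refPoly d p)) :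
    (∀ (Ω : Set (HDG.E d)) (L : ℕ) (κ cref : ℝ) (H : HDG.MeshHierarchy Ω L κ cref)
      (τ : Fin (L + 1) → ℝ), (∀ ℓ, 0 < τ ℓ) → ∀ (ℓ : Fin (L + 1)) (ord : (H.mesh ℓ).Numbering),
      HDG.WellPosed (H.mesh ℓ) p (τ ℓ) ∧ HDG.LimitedInteraction b (τ ℓ) ord) ∧
    (∀ γ : ℝ, 0 < γ → γ * ((2 * d + 1) * Fintype.card ι) < 2 → ∃ C₃ : ℝ, 0 < C₃ ∧
      ∀ (Ω : Set (HDG.E d)) (L : ℕ) (κ cref : ℝ) (H : HDG.MeshHierarchy Ω L κ cref)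
        (τ : Fin (L + 1) → ℝ), (∀ ℓ, 0 < τ ℓ) → ∀ (ℓ : Fin (L + 1)) (ord : (H.mesh ℓ).Numbering),
        HDG.SmoothingHypothesis (H.mesh ℓ) p (τ ℓ) (HDG.jacobi b (τ ℓ) ord γ) C₃) ∧
    (∃ C₃ : ℝ, 0 < C₃ ∧
      ∀ (Ω : Set (HDG.E d)) (L : ℕ) (κ cref : ℝ) (H : HDG.MeshHierarchy Ω L κ cref)
        (τ : Fin (L + 1) → ℝ), (∀ ℓ, 0 < τ ℓ) → ∀ (ℓ : Fin (L + 1)) (ord : (H.mesh ℓ).Numbering)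
        (s : List ((H.mesh ℓ).Dof ι)), s.Nodup → (∀ i, i ∈ s) →
        HDG.SmoothingHypothesis (H.mesh ℓ) p (τ ℓ) (HDG.gaussSeidel b (τ ℓ) ord s) C₃) := by
  obtain ⟨n, rfl⟩ : ∃ n, d = n + 1 := ⟨d - 1, by omega⟩
  have := b.finiteDimensional_of_finite
  obtain ⟨C, hC0, hC⟩ := (HDG.isInnerForm_refForm n p).exists_stable_basis_splitting b
  have hN : (0 : ℝ) < (2 * (n + 1 : ℕ) + 1) * Fintype.card ι := by
    have : (0 : ℝ) < Fintype.card ι := Nat.cast_pos.2 (HDG.card_pos_of_basis b)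
    positivity
  refine ⟨fun Ω L κ cref H τ hτ ℓ ord =>
    ⟨HDG.wellPosed b (hτ ℓ) ord, HDG.limitedInteraction b (hτ ℓ) ord⟩, fun γ hγ hγ' => ?_, ?_⟩
  · exact ⟨_, mul_pos hC0 (inv_pos.2 (mul_pos hγ (by linarith))),
      fun Ω L κ cref H τ hτ ℓ ord => HDG.smoothingHypothesis_jacobi b (hτ ℓ) ord hC hC0 hγ hγ'⟩
  · exact ⟨_, mul_pos hC0 (pow_pos hN 2), fun Ω L κ cref H τ hτ ℓ ord s hs hall =>
      HDG.smoothingHypothesis_gaussSeidel b (hτ ℓ) ord hC hC0 hs hall⟩
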